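/- Let $J=\begin{pmatrix}0&0&1\\0&1&0\\1&0&0\end{pmatrix}$ and let $\langle v,w\rangle=v^TJ\overline w$ be the corresponding hermitian form of signature $(2,1)$ on $\mathbb C^3$; $\mathrm{PU}(2,1)$ is its unitary group modulo scalars. A complex line $C$ of the complex hyperbolic plane is given by a 2-dimensional subspace of $\mathbb C^3$ containing a vector $v$ with $\langle v,v\rangle<0$; a polar vector of $C$ is a nonzero vector $\mathbf c$ orthogonal to this subspace. A flag is a pair $(C,p)$ of a complex line and a boundary point $p$ of it, i.e. an isotropic line $\mathbb C\mathbf p$ contained in the subspace of $C$. Flags $(C_1,p_1),(C_2,p_2),(C_3,p_3)$ with polar vectors $\mathbf c_i$ are in generic position if $p_i\notin C_j$ and $\langle\mathbf c_i,\mathbf c_j\rangle\neq0$ for $i\ne j$ and $\mathbf c_1,\mathbf c_2,\mathbf c_3$ is a basis of $\mathbb C^3$. Their invariants are $$\varphi_{ij}=\frac{|\langle \mathbf c_i,\mathbf c_j\rangle|^2}{\langle \mathbf c_i,\mathbf c_i\rangle\langle \mathbf c_j,\mathbf c_j\rangle},\quad \Phi_{ijk}=\frac{\langle \mathbf c_i,\mathbf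 c_j\rangle\langle \mathbf c_j,\mathbf c_k\rangle\langle \mathbf c_k,\mathbf c_i\rangle}{\langle \mathbf c_i,\mathbf c_i\rangle\langle \mathbf c_j,\mathbf c_j\rangle\langle \mathbf c_k,\mathbf c_k\rangle},\quad \delta^i_{jk}=\frac{\langle \mathbf c_j,\mathbf c_k\rangle\langle \mathbf p_i,\mathbf c_j\rangle}{\langle \mathbf c_j,\mathbf c_j\rangle\langle \mathbf p_i,\mathbf c_k\rangle}.$$ Let $p>0$, $2-2g-p<0$, and let $\Sigma_{g,p}$ be the closed oriented surface of genus $g$ minus $p$ points (the punctures), $\pi_{g,p}$ its fundamental group acting by deck transformations on the universal covering $\widehat\Sigma_{g,p}$, and $X$ the $\pi_{g,p}$-set of lifted punctures, i.e. of ends of $\widehat\Sigma_{g,p}$ over the punctures. Let $T$ be an ideal triangulation of $\Sigma_{g,p}$: a finite oriented complex of triangles glued along their sides, with a homeomorphism from its realization to the closed surface that maps the set of vertices onto the set of punctures (distinct triangles may share the same vertices). Let $\mathfrak R^T_{g,p}$ be the set of pairs $(\rho,F)$, up to the action of $\mathrm{PU}(2,1)$ (by conjugation on $\rho$, by isometries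 on $F$), where $\rho:\pi_{g,p}\to \mathrm{PU}(2,1)$ is a homomorphism, $F$ is a map from $X$ to the set of flags with $F(\gamma x)=\rho(\gamma)F(x)$, and the flags $F(x),F(y),F(z)$ are in generic position whenever $x,y,z$ are the vertices of a lift of a triangle of $T$. Let $\mathcal X(T)$ be the set of decorations of $T$, i.e. of triples $(\varphi,\Phi,\delta)$ of a function $\varphi>0$ on the unoriented edges of $T$ and complex-valued functions $\Phi$, $\delta$ on the ordered faces of $T$ (write $\delta^i_{jk}$ for the value of $\delta$ at $(i,j,k)$) such that for every ordered face $(i,j,k)$ $$|\Phi_{ijk}|^2=\varphi_{ij}\varphi_{jk}\varphi_{ki},\qquad \Phi_{ijk}=\Phi_{jki}=\overline{\Phi_{ikj}},$$ $$\Delta_{ijk}:=1-\varphi_{ij}-\varphi_{jk}-\varphi_{ik}+\Phi_{ijk}+\Phi_{ikj}<0,\qquad \delta^i_{jk}\delta^i_{kj}=\varphi_{jk},$$ $$|\delta^i_{jk}|^2(1-\varphi_{ik})+2\,\mathrm{Re}\bigl[\delta^i_{jk}(\Phi_{ikj}-\varphi_{jk})\bigr]+\varphi_{jk}(1-\varphi_{ij})=0,$$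 and such that, with $$m^k_{ij}=\frac{\varphi_{ik}\varphi_{jk}(\Phi_{ijk}-\varphi_{ij})+\varphi_{ik}(\varphi_{ij}\varphi_{jk}-\Phi_{ijk})\delta^i_{kj}+\varphi_{jk}(\varphi_{ij}\varphi_{ik}-\Phi_{ijk})\overline{\delta^j_{ki}}+\Phi_{ijk}(1-\varphi_{ij})\delta^i_{kj}\overline{\delta^j_{ki}}}{\Delta_{ijk}\varphi_{ik}\varphi_{jk}},$$ one has $m^k_{ij}=m^l_{ij}$ for every edge $(i,j)$ bordering the faces $(i,j,k)$ and $(i,j,l)$. Then there is a bijection $\mathfrak R^T_{g,p}\to\mathcal X(T)$; it sends the class of $(\rho,F)$ to the decoration whose values on the edges and ordered faces of a triangle of $T$ are the invariants $\varphi,\Phi,\delta$ of the flags $F(x),F(y),F(z)$ at the vertices $x,y,z$ of any lift of that triangle. -/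

import Mathlib

open Set Filter Topology
open scoped Matrix

noncomputable section

namespace ComplexHyperbolic

/-! ### The complex hyperbolic plane: hermitian form, flags, the group PU(2,1) -/

/-- The vector space `ℂ³`. -/
abbrev V : Type := Fin 3 → ℂ

/-- The matrix of the hermitian form of signature `(2,1)`. -/
def J : Matrix (Fin 3) (Fin 3) ℂ := !![0, 0, 1; 0, 1, 0; 1, 0, 0]

/-- The hermitian form `⟨v, w⟩ = vᵀ J w̄`. -/
def herm (v w : V) : ℂ := v ⬝ᵥ (J *ᵥ star w)

/-- A complex line of the complex hyperbolic plane, given by the 2-dimensional subspace of `ℂ³`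
whose projectivization cuts it out; this subspace contains a negative vector. -/
def IsComplexLine (W : Submodule ℂ V) : Prop :=
  Module.finrank ℂ W = 2 ∧ ∃ v ∈ W, (herm v v).re < 0

/-- A point of the boundary of the complex hyperbolic plane, as an isotropic line of `ℂ³`. -/
def IsBoundaryPoint (L : Submodule ℂ V) : Prop :=
  Module.finrank ℂ L = 1 ∧ ∀ v ∈ L, herm v v = 0

/-- A flag: a complex line together with a boundary point of it. -/
@[ext] structure Flag where
  line : Submodule ℂ V
  pt : Submodule ℂ V
  isComplexLine : IsComplexLine line
  isBoundaryPoint : IsBoundaryPoint pt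
  pt_le_line : pt ≤ line

/-- The unitary group `U(2,1)` of the hermitian form. -/
def U21 : Subgroup (V ≃ₗ[ℂ] V) where
  carrier := {A | ∀ v w, herm (A v) (A w) = herm v w}
  one_mem' := fun _ _ => rfl
  mul_mem' := by
    intro A B hA hB v w
    exact (hA _ _).trans (hB _ _)
  inv_mem' := by
    intro A hA v w
    have h := hA (A⁻¹ v) (A⁻¹ w)
    have e : ∀ u, A (A⁻¹ u) = u := fun u => A.apply_symm_apply u
    rw [e, e] at h
    exact h.symm

/-- The subgroup of scalar matrices in `U(2,1)`. -/
def scalars : Subgroup U21 where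
  carrier := {A | ∃ c : ℂ, ∀ v : V, A.1 v = c • v}
  one_mem' := ⟨1, fun v => (one_smul ℂ v).symm⟩
  mul_mem' := by
    rintro A B ⟨a, ha⟩ ⟨b, hb⟩
    refine ⟨a * b, fun v => ?_⟩
    change A.1 (B.1 v) = _
    rw [hb, ha, mul_smul]
  inv_mem' := by
    rintro A ⟨a, ha⟩
    refine ⟨a⁻¹, fun v => ?_⟩
    change A.1.symm v = _
    rw [LinearEquiv.symm_apply_eq, ha, smul_smul]
    by_cases h : a = 0
    · have h1 := ha v
      rw [h, zero_smul] at h1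
      have h2 : v = 0 := A.1.map_eq_zero_iff.1 h1
      rw [h2, smul_zero]
    · rw [mul_inv_cancel₀ h, one_smul]

instance : scalars.Normal where
  conj_mem := by
    rintro A ⟨a, ha⟩ B
    refine ⟨a, fun v => ?_⟩
    change B.1 (A.1 (B.1.symm v)) = _
    rw [ha, map_smul, LinearEquiv.apply_symm_apply]

/-- The group `PU(2,1)`. -/
abbrev PU21 : Type := U21 ⧸ scalars

/-- The action of `U(2,1)` on flags. -/
instance : MulAction U21 Flag where
  smul A F :=
    { line := F.line.map (A.1 : V →ₗ[ℂ] V)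
      pt := F.pt.map (A.1 : V →ₗ[ℂ] V)
      isComplexLine := by
        obtain ⟨h1, v, hv, h2⟩ := F.isComplexLine
        refine ⟨by rw [← h1]; exact LinearEquiv.finrank_map_eq A.1 F.line, A.1 v,
          Submodule.mem_map_of_mem hv, ?_⟩
        rw [A.2 v v]; exact h2
      isBoundaryPoint := by
        obtain ⟨h1, h2⟩ := F.isBoundaryPoint
        refine ⟨by rw [← h1]; exact LinearEquiv.finrank_map_eq A.1 F.pt, ?_⟩
        rintro _ ⟨v, hv, rfl⟩
        exact (A.2 v v).trans (h2 v hv)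
      pt_le_line := Submodule.map_mono F.pt_le_line }
  one_smul F := Flag.ext (Submodule.map_id _) (Submodule.map_id _)
  mul_smul A B F := Flag.ext
    (Submodule.map_comp (B.1 : V →ₗ[ℂ] V) (A.1 : V →ₗ[ℂ] V) F.line)
    (Submodule.map_comp (B.1 : V →ₗ[ℂ] V) (A.1 : V →ₗ[ℂ] V) F.pt)

theorem map_eq_of_scalar (A : V ≃ₗ[ℂ] V) (c : ℂ) (h : ∀ v, A v = c • v) (W : Submodule ℂ V) :
    W.map (A : V →ₗ[ℂ] V) = W := by
  refine Submodule.eq_of_le_of_finrank_eq ?_ (LinearEquiv.finrank_map_eq A W)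
  rintro _ ⟨v, hv, rfl⟩
  change A v ∈ W
  rw [h]
  exact W.smul_mem c hv

/-- The induced action of `PU(2,1)` on flags. -/
instance : MulAction PU21 Flag :=
  MulAction.compHom Flag (QuotientGroup.lift scalars (MulAction.toPermHom U21 Flag) (by
    rintro A ⟨c, hc⟩
    ext F : 1
    exact Flag.ext (map_eq_of_scalar A.1 c hc F.line) (map_eq_of_scalar A.1 c hc F.pt)))

namespace Flag

theorem exists_polar (F : Flag) : ∃ c : V, c ≠ 0 ∧ ∀ w ∈ F.line, herm w c = 0 := by
  have hlt : F.line < ⊤ := by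
    rw [lt_top_iff_ne_top]
    intro h
    have h1 := F.isComplexLine.1
    rw [h, finrank_top, Module.finrank_fin_fun] at h1
    omega
  obtain ⟨f, hf, hle⟩ := Submodule.exists_le_ker_of_lt_top F.line hlt
  have hJ : J * J = 1 := by
    ext i j
    fin_cases i <;> fin_cases j <;> simp [J, Matrix.mul_apply, Fin.sum_univ_three]
  set a : V := fun i => f (Pi.single i 1) with ha
  have hfa : ∀ v, f v = v ⬝ᵥ a := by
    intro v
    conv_lhs => rw [← Finset.univ_sum_single v]
    rw [map_sum]
    refine Finset.sum_congr rfl fun i _ => ?_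
    have : (Pi.single i (v i) : V) = v i • Pi.single i 1 := by
      rw [← Pi.single_smul, smul_eq_mul, mul_one]
    rw [this, map_smul, smul_eq_mul]
  have key : ∀ v, herm v (star (J *ᵥ a)) = f v := by
    intro v
    rw [herm, star_star, Matrix.mulVec_mulVec, hJ, Matrix.one_mulVec, hfa]
  refine ⟨star (J *ᵥ a), fun h0 => hf ?_, fun w hw => (key w).trans (hle hw)⟩
  refine LinearMap.ext fun v => ?_
  rw [← key, h0]
  simp [herm]

/-- A polar vector of the complex line of a flag (well defined up to a nonzero scalar). -/
def polar (F : Flag) : V := F.exists_polar.choose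

theorem exists_lift (F : Flag) : ∃ v : V, v ≠ 0 ∧ v ∈ F.pt := by
  have h : 0 < Module.finrank ℂ F.pt := by rw [F.isBoundaryPoint.1]; exact one_pos
  obtain ⟨⟨v, hv⟩, h0⟩ := Module.finrank_pos_iff_exists_ne_zero.1 h
  exact ⟨v, fun h => h0 (Subtype.ext h), hv⟩

/-- A vector representing the boundary point of a flag (well defined up to a nonzero scalar). -/
def lift (F : Flag) : V := F.exists_lift.choose

end Flag

/-- The invariant `φ` of (the complex lines of) two flags. -/
def phi (F₁ F₂ : Flag) : ℝ :=
  ‖herm F₁.polar F₂.polar‖ ^ 2 / ((herm F₁.polar F₁.polar).re * (herm F₂.polar F₂.polar).re)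

/-- The invariant `Φ` of (the complex lines of) three flags. -/
def Phi (F₁ F₂ F₃ : Flag) : ℂ :=
  (herm F₁.polar F₂.polar * herm F₂.polar F₃.polar * herm F₃.polar F₁.polar) /
    (herm F₁.polar F₁.polar * herm F₂.polar F₂.polar * herm F₃.polar F₃.polar)

/-- The invariant `δ¹₂₃` of a flag `F₁` and (the complex lines of) two flags `F₂`, `F₃`. -/
def delta (F₁ F₂ F₃ : Flag) : ℂ :=
  (herm F₂.polar F₃.polar * herm F₁.lift F₂.polar) /
    (herm F₂.polar F₂.polar * herm F₁.lift F₃.polar)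

/-- Two flags are in generic position: neither boundary point lies on the other complex line,
and the complex lines are not orthogonal. -/
def Generic₂ (F₁ F₂ : Flag) : Prop :=
  ¬ F₁.pt ≤ F₂.line ∧ ¬ F₂.pt ≤ F₁.line ∧ herm F₁.polar F₂.polar ≠ 0

/-- Three flags are in generic position: they are pairwise so, and polar vectors of the
three complex lines form a basis of `ℂ³`. -/
def Generic₃ (F₁ F₂ F₃ : Flag) : Prop :=
  Generic₂ F₁ F₂ ∧ Generic₂ F₂ F₃ ∧ Generic₂ F₃ F₁ ∧
    LinearIndependent ℂ ![F₁.polar, F₂.polar, F₃.polar]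

end ComplexHyperbolic

namespace PuncturedSurface

open ComplexHyperbolic

/-! ### Surfaces -/

/-- The point at position `s` on the boundary of the unit disc, seen as a polygon with `4g` sides;
the `k`-th side consists of the positions in `[k, k + 1]`. -/
def polygonPoint (g : ℕ) (s : ℝ) : Metric.closedBall (0 : ℂ) 1 :=
  ⟨(Circle.exp (2 * Real.pi * s / (4 * g)) : ℂ),
    mem_closedBall_zero_iff.2 (Circle.norm_coe _).le⟩

/-- The identification of the sides of the `4g`-gon according to the word
`∏ aₖ bₖ aₖ⁻¹ bₖ⁻¹`. -/
inductive PolygonRel (g : ℕ) : Metric.closedBall (0 : ℂ) 1 → Metric.closedBall (0 : ℂ) 1 → Prop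
  | a (k : ℕ) (hk : k < g) (t : ℝ) (h₀ : 0 ≤ t) (h₁ : t ≤ 1) :
      PolygonRel g (polygonPoint g (4 * k + t)) (polygonPoint g (4 * k + 2 + (1 - t)))
  | b (k : ℕ) (hk : k < g) (t : ℝ) (h₀ : 0 ≤ t) (h₁ : t ≤ 1) :
      PolygonRel g (polygonPoint g (4 * k + 1 + t)) (polygonPoint g (4 * k + 3 + (1 - t)))

/-- `S` is a closed oriented surface of genus `g`: it is homeomorphic to the sphere if `g = 0`,
and to the standard quotient of the `4g`-gon if `g > 0`. -/
def IsClosedSurfaceOfGenus (g : ℕ) (S : Type*) [TopologicalSpace S] : Prop :=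
  (g = 0 ∧ Nonempty (S ≃ₜ Metric.sphere (0 : EuclideanSpace ℝ (Fin 3)) 1)) ∨
    (0 < g ∧ Nonempty (S ≃ₜ Quot (PolygonRel g)))

/-! ### Ideal triangulations -/

/-- The closed triangle (in barycentric coordinates). -/
abbrev Triangle : Type := stdSimplex ℝ (Fin 3)

/-- A vertex of the closed triangle. -/
def Triangle.vertex (i : Fin 3) : Triangle := ⟨Pi.single i 1, single_mem_stdSimplex ℝ i⟩

/-- The ideal triangle: the closed triangle without its vertices. -/
abbrev IdealTriangle : Type := {t : Triangle // ∀ i, t ≠ Triangle.vertex i}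

/-- A finite oriented 2-dimensional quasi-simplicial complex without boundary. The corners of each
face are numbered by `Fin 3` compatibly with the orientation; the side `(f, i)` of the face `f` is
the one opposite to the corner `i`, running from the corner `i + 1` to the corner `i + 2`. Each
side is glued to exactly one other side, by the affine map reversing the direction. Faces may
share several vertices or sides, and two sides of the same face may be glued. -/
structure Complex₂ where
  Face : Type*
  finite : Finite Face
  glue : Face × Fin 3 → Face × Fin 3
  glue_glue : ∀ s, glue (glue s) = s
  glue_ne : ∀ s, glue s ≠ s

namespace Complex₂

variable (T : Complex₂)

/-- Gluing of the points of the sides. -/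
inductive GlueRel : (Σ _ : T.Face, Triangle) → (Σ _ : T.Face, Triangle) → Prop
  | glue (f f' : T.Face) (i i' : Fin 3) (h : T.glue (f, i) = (f', i')) (t t' : Triangle)
      (ht : t.1 i = 0) (ht' : t'.1 i' = 0)
      (h₁ : t'.1 (i' + 2) = t.1 (i + 1)) (h₂ : t'.1 (i' + 1) = t.1 (i + 2)) :
      GlueRel ⟨f, t⟩ ⟨f', t'⟩

/-- The topological realization `|T|`. -/
def Realization : Type _ := Quot T.GlueRel

instance : TopologicalSpace T.Realization :=
  inferInstanceAs (TopologicalSpace (Quot T.GlueRel))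

/-- The point of `|T|` with barycentric coordinates `t` in the face `f`. -/
def point (f : T.Face) (t : Triangle) : T.Realization := Quot.mk _ ⟨f, t⟩

/-- The unoriented edges: sides of faces, two glued sides being the same edge. -/
def Edge : Type _ := Quot fun s s' : T.Face × Fin 3 => T.glue s = s'

/-- The edge opposite to the corner `i` in the face `f`. -/
def edge (f : T.Face) (i : Fin 3) : T.Edge := Quot.mk _ (f, i)

/-- An ordered face: a face with an ordering `(i, j, k)` of its corners,
`i = corner 0`, `j = corner 1`, `k = corner 2`. -/
structure OrderedFace where
  face : T.Face
  corner : Equiv.Perm (Fin 3)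

namespace OrderedFace

variable {T}

/-- From `(i, j, k)` to `(j, k, i)`. -/
def jki (o : T.OrderedFace) : T.OrderedFace := ⟨o.face, o.corner * finRotate 3⟩

/-- From `(i, j, k)` to `(i, k, j)`. -/
def ikj (o : T.OrderedFace) : T.OrderedFace := ⟨o.face, o.corner * Equiv.swap 1 2⟩

/-- From `(i, j, k)` to `(j, i, k)`. -/
def jik (o : T.OrderedFace) : T.OrderedFace := ⟨o.face, o.corner * Equiv.swap 0 1⟩

/-- The edge `ij` of `(i, j, k)`. -/
def edgeij (o : T.OrderedFace) : T.Edge := T.edge o.face (o.corner 2)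

/-- The edge `jk` of `(i, j, k)`. -/
def edgejk (o : T.OrderedFace) : T.Edge := T.edge o.face (o.corner 0)

/-- The edge `ik` of `(i, j, k)`. -/
def edgeik (o : T.OrderedFace) : T.Edge := T.edge o.face (o.corner 1)

end OrderedFace

/-- The ordered face `(i + 1, i + 2, i)` attached to the side `(f, i)`: its first two corners are
the endpoints of the side, in the direction given by the orientation of `f`. -/
def sideFace (s : T.Face × Fin 3) : T.OrderedFace := ⟨s.1, Equiv.addLeft (s.2 + 1)⟩

/-! ### Decorations -/

section

variable {T} (φ : T.Edge → ℝ) (Φ δ : T.OrderedFace → ℂ)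

/-- `Δᵢⱼₖ` -/
def decDelta (o : T.OrderedFace) : ℂ :=
  1 - φ o.edgeij - φ o.edgejk - φ o.edgeik + Φ o + Φ o.ikj

/-- `mᵏᵢⱼ`. For `o = (i, j, k)`, the two values of `δ` that occur are `δⁱₖⱼ` and `δʲₖᵢ`. -/
def decM (o : T.OrderedFace) : ℂ :=
  (φ o.edgeik * φ o.edgejk * (Φ o - φ o.edgeij)
    + φ o.edgeik * (φ o.edgeij * φ o.edgejk - Φ o) * δ o.ikj
    + φ o.edgejk * (φ o.edgeij * φ o.edgeik - Φ o) * star (δ o.jki)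
    + Φ o * (1 - φ o.edgeij) * δ o.ikj * star (δ o.jki)) /
  (decDelta φ Φ o * φ o.edgeik * φ o.edgejk)

end

/-- The set `𝒳(T)` of decorations of `T`. -/
structure Decoration where
  φ : T.Edge → ℝ
  Φ : T.OrderedFace → ℂ
  δ : T.OrderedFace → ℂ
  φ_pos : ∀ e, 0 < φ e
  norm_Φ : ∀ o, ‖Φ o‖ ^ 2 = φ o.edgeij * φ o.edgejk * φ o.edgeik
  Φ_rotate : ∀ o, Φ o = Φ o.jki
  Φ_swap : ∀ o, Φ o = star (Φ o.ikj)
  /-- `Δᵢⱼₖ` is real by the previous relation. -/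
  decDelta_neg : ∀ o, (decDelta φ Φ o).re < 0
  δ_mul_δ : ∀ o, δ o * δ o.ikj = φ o.edgejk
  circle : ∀ o, ‖δ o‖ ^ 2 * (1 - φ o.edgeik) + 2 * (δ o * (Φ o.ikj - φ o.edgejk)).re
    + φ o.edgejk * (1 - φ o.edgeij) = 0
  /-- For every edge with a chosen direction `(i, j)`, bordering the faces `(i, j, k)` and
  `(i, j, l)`. If `s` is the side `(i, j)` of the first face, then gluing identifies `i` and `j`
  with the second and the first endpoint of the side `glue s`, respectively. -/
  compat : ∀ s, decM φ Φ δ (T.sideFace s) = decM φ Φ δ (T.sideFace (T.glue s)).jik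

end Complex₂

/-- An ideal triangulation of the surface `S` punctured at the points of `P`: a complex with a
homeomorphism from its realization to `S`, mapping the set of vertices to the set of punctures. -/
structure IdealTriangulation (S : Type*) [TopologicalSpace S] (P : Set S) extends Complex₂ where
  homeo : toComplex₂.Realization ≃ₜ S
  image_vertices :
    homeo '' {x | ∃ f i, x = toComplex₂.point f (Triangle.vertex i)} = P

/-! ### The universal covering, its deck group, the lifted punctures -/

section

variable {S : Type*} [TopologicalSpace S] {P : Set S} {Y : Type*} [TopologicalSpace Y]

/-- `q` is a universal covering of the punctured surface `S ∖ P`. -/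
structure IsUniversalCovering (q : Y → (Pᶜ : Set S)) : Prop where
  isCoveringMap : IsCoveringMap q
  surjective : Function.Surjective q
  simplyConnected : SimplyConnectedSpace Y

/-- The fundamental group of the punctured surface, as the group of deck transformations of its
universal covering. -/
def deckGroup (q : Y → (Pᶜ : Set S)) : Subgroup (Y ≃ₜ Y) where
  carrier := {g | ∀ y, q (g y) = q y}
  one_mem' := fun _ => rfl
  mul_mem' := by
    intro g h hg hh y
    exact (hg _).trans (hh y)
  inv_mem' := by
    intro g hg y
    have h := hg (g⁻¹ y)
    have e : g (g⁻¹ y) = y := g.apply_symm_apply y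
    rw [e] at h
    exact h.symm

/-- The part of the covering lying over a neighbourhood `U` of a puncture. -/
def overSet (q : Y → (Pᶜ : Set S)) (U : Set S) : Set Y := {y | (q y : S) ∈ U}

/-- A lifted puncture: an end of the universal covering lying over a puncture `pt`, that is,
a compatible choice, for all open neighbourhoods `U` of `pt`, of a connected component of the
preimage of `U` minus the punctures. -/
@[ext] structure LiftedPuncture (q : Y → (Pᶜ : Set S)) where
  pt : S
  mem : pt ∈ P
  comp : TopologicalSpace.OpenNhdsOf pt → Set Y
  isComp : ∀ U : TopologicalSpace.OpenNhdsOf pt, ∃ y ∈ overSet q U, comp U = connectedComponentIn (overSet q U) y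
  mono : ∀ U U', U ≤ U' → comp U ⊆ comp U'

theorem image_overSet {S : Type*} {P : Set S} {q : Y → (Pᶜ : Set S)} (g : deckGroup q) (U : Set S) :
    g.1 '' overSet q U = overSet q U := by
  ext y
  constructor
  · rintro ⟨z, hz, rfl⟩
    change (q (g.1 z) : S) ∈ U
    rw [g.2 z]; exact hz
  · intro hy
    refine ⟨g.1.symm y, ?_, g.1.apply_symm_apply y⟩
    change (q (g.1.symm y) : S) ∈ U
    rw [← g.2 (g.1.symm y), g.1.apply_symm_apply]; exact hy

/-- The action of the deck group on the lifted punctures. -/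
instance (q : Y → (Pᶜ : Set S)) : SMul (deckGroup q) (LiftedPuncture q) where
  smul g x :=
    { pt := x.pt
      mem := x.mem
      comp := fun U => g.1 '' x.comp U
      isComp := by
        intro U
        obtain ⟨y, hy, h⟩ := x.isComp U
        refine ⟨g.1 y, (image_overSet g U) ▸ mem_image_of_mem _ hy, ?_⟩
        rw [h, g.1.image_connectedComponentIn hy, image_overSet]
      mono := fun U U' h => image_mono (x.mono U U' h) }

/-- A lift of a triangle of the ideal triangulation to the universal covering. -/
structure LiftedTriangle (T : IdealTriangulation S P) (q : Y → (Pᶜ : Set S)) where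
  face : T.Face
  toFun : IdealTriangle → Y
  continuous : Continuous toFun
  isLift : ∀ t, (q (toFun t) : S) = T.homeo (T.point face t.1)

/-- The lifted puncture `x` is the vertex with number `i` of the lifted triangle `τ`. -/
def LiftedTriangle.IsVertex {T : IdealTriangulation S P} {q : Y → (Pᶜ : Set S)}
    (τ : LiftedTriangle T q) (i : Fin 3) (x : LiftedPuncture q) : Prop :=
  x.pt = T.homeo (T.point τ.face (Triangle.vertex i)) ∧
    ∀ U : TopologicalSpace.OpenNhdsOf x.pt,
      ∀ᶠ t in comap (Subtype.val : IdealTriangle → Triangle) (𝓝 (Triangle.vertex i)),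
        τ.toFun t ∈ x.comp U

/-! ### Flagged representations -/

/-- A pair `(ρ, F)`: a representation into `PU(2,1)` and an equivariant map from the lifted
punctures to the flags. -/
@[ext] structure FlaggedRep (q : Y → (Pᶜ : Set S)) where
  ρ : deckGroup q →* PU21
  F : LiftedPuncture q → Flag
  equivariant : ∀ (g : deckGroup q) (x : LiftedPuncture q), F (g • x) = ρ g • F x

/-- The action of `PU(2,1)`, on `ρ` by conjugation and on `F` by isometries. -/
instance (q : Y → (Pᶜ : Set S)) : MulAction PU21 (FlaggedRep q) where
  smul A a :=
    { ρ := (MulAut.conj A).toMonoidHom.comp a.ρ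
      F := fun x => A • a.F x
      equivariant := by
        intro g x
        change A • a.F (g • x) = (A * a.ρ g * A⁻¹) • A • a.F x
        rw [a.equivariant, mul_smul, inv_smul_smul, mul_smul] }
  one_smul a := by
    refine FlaggedRep.ext (MonoidHom.ext fun g => ?_) (funext fun x => one_smul _ _)
    change 1 * a.ρ g * 1⁻¹ = a.ρ g
    group
  mul_smul A B a := by
    refine FlaggedRep.ext (MonoidHom.ext fun g => ?_) (funext fun x => mul_smul _ _ _)
    change A * B * a.ρ g * (A * B)⁻¹ = A * (B * a.ρ g * B⁻¹) * A⁻¹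
    group

/-- The space `𝔑` of pairs `(ρ, F)` up to `PU(2,1)`. -/
abbrev RepSpace (q : Y → (Pᶜ : Set S)) : Type _ :=
  MulAction.orbitRel.Quotient PU21 (FlaggedRep q)

/-- The class of a pair. -/
def FlaggedRep.cls {q : Y → (Pᶜ : Set S)} (a : FlaggedRep q) : RepSpace q := Quotient.mk'' a

/-- A pair is generic with respect to `T` if the flags at the vertices of every lift of a triangle
of `T` are in generic position. -/
def FlaggedRep.IsGeneric {q : Y → (Pᶜ : Set S)} (a : FlaggedRep q)
    (T : IdealTriangulation S P) : Prop :=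
  ∀ (τ : LiftedTriangle T q) (x : Fin 3 → LiftedPuncture q), (∀ i, τ.IsVertex i (x i)) →
    Generic₃ (a.F (x 0)) (a.F (x 1)) (a.F (x 2))

/-- The subset of the classes of pairs which are generic with respect to `T`. -/
def genericRepSpace (T : IdealTriangulation S P) (q : Y → (Pᶜ : Set S)) : Set (RepSpace q) :=
  {c | ∃ a : FlaggedRep q, a.IsGeneric T ∧ a.cls = c}

/-- `D` consists of the invariants of the flags attached by `a` to the vertices of the lifts of
the triangles of `T`. -/
def FlaggedRep.HasInvariants {q : Y → (Pᶜ : Set S)} (a : FlaggedRep q)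
    (T : IdealTriangulation S P) (D : T.Decoration) : Prop :=
  ∀ (τ : LiftedTriangle T q) (x : Fin 3 → LiftedPuncture q), (∀ i, τ.IsVertex i (x i)) →
    ∀ o : T.OrderedFace, o.face = τ.face →
      D.φ o.edgeij = phi (a.F (x (o.corner 0))) (a.F (x (o.corner 1))) ∧
      D.Φ o = Phi (a.F (x (o.corner 0))) (a.F (x (o.corner 1))) (a.F (x (o.corner 2))) ∧
      D.δ o = delta (a.F (x (o.corner 0))) (a.F (x (o.corner 1))) (a.F (x (o.corner 2)))

end

end PuncturedSurface

end

/-! The proof rests on two rigidity facts about flags and a developing argument.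

Pairs: besides `phi`, a generic pair has the invariant `pairInv`, built from the two boundary
vectors and the two polar vectors. Together they determine the pair up to PU(2,1)
(`Generic₂.exists_smul_eq`), and the isometry is unique because a generic pair has trivial
stabilizer (`Generic₂.eq_one`).

Triples: the polar vectors form a basis, and the form is recovered from their Gram matrix
(`gramDet_mul_herm`). After normalization all products between polar vectors, and of boundary
vectors with polar vectors, are functions of φ, Φ, δ, so these determine the triple
(`Generic₃.exists_smul_eq`). Conversely, negativity of Δ gives a Gram matrix of signature (2,1), and
the quadratic relation on δ says exactly that the boundary vectors are isotropic (`exists_triple`).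
The same expansion applied to two boundary vectors shows that m for an edge equals `pairInv` of its
two flags (`Generic₃.pairInv_eq`), which does not involve the third flag. The equation imposed on an
edge therefore says that the triples of the two adjacent faces can be matched along it.

From a decoration, choose a triple of flags for each face. Glued sides then carry unique elements of
PU(2,1), inverse to each other on the two sides. No further relation is needed, since the vertices
of the triangles have been removed. These elements define a cocycle on the union of the ideal
triangles, hence a principal covering of the punctured surface; it becomes trivial over the simply
connected covering, so every lifted triangle `τ` gets an element `g τ` (`exists_development`).
Moving the chosen triples by `g` gives flags at the corners, and comparing `g` on a triangle and on
its deck translates gives ρ.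

Flags must be attached to ends of the covering rather than to corners. For this, every end is a
vertex of some lifted triangle (`exists_isVertex`), and two corners at the same end are linked by a
connected piece of a star neighbourhood, so that data agreeing across sides agree at the end
(`IsVertex.eq_of_corner_invariant`). Injectivity follows from the same principle: the isometries
carrying one family of triples to another agree on adjacent triangles, hence everywhere. -/

noncomputable section

/-! ### Principal coverings defined by locally trivial cocycles -/

namespace CocycleCovering

variable {Z M G : Type*} [TopologicalSpace Z] [TopologicalSpace M] [Group G]

/-- A cocycle on `Z ×_M Z` with values in a group `G`, which is locally a coboundary. -/
structure LocalCocycle (G : Type*) [Group G] (r : Z → M) (σ : Z → Z → G) : Prop where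
  isQuotientMap : IsQuotientMap r
  mul : ∀ {x y z}, r x = r y → r y = r z → σ x y * σ y z = σ x z
  coboundary : ∀ z₀, ∃ (N : Set Z) (κ : Z → G), IsOpen N ∧ z₀ ∈ N ∧
    (∀ z z', r z = r z' → z ∈ N → z' ∈ N) ∧ (∀ z ∈ N, ∀ᶠ z' in 𝓝 z, κ z' = κ z) ∧
    ∀ z ∈ N, ∀ z' ∈ N, r z = r z' → σ z z' = (κ z)⁻¹ * κ z'

variable {r : Z → M} {σ : Z → Z → G} (hσ : LocalCocycle G r σ)

theorem LocalCocycle.self_eq_one (hσ : LocalCocycle G r σ) (z : Z) : σ z z = 1 := by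
  have := hσ.mul (rfl : r z = r z) (rfl : r z = r z)
  simpa using this

/-- The relation whose quotient is the principal covering attached to a cocycle. -/
def LocalCocycle.setoid : Setoid (Z × G) where
  r a b := r a.1 = r b.1 ∧ b.2 = a.2 * σ a.1 b.1
  iseqv :=
    { refl := fun a => ⟨rfl, by rw [hσ.self_eq_one, mul_one]⟩
      symm := by
        rintro a b ⟨h, h'⟩
        refine ⟨h.symm, ?_⟩
        rw [h', mul_assoc, hσ.mul h h.symm, hσ.self_eq_one, mul_one]
      trans := by
        rintro a b c ⟨h, h'⟩ ⟨k, k'⟩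
        exact ⟨h.trans k, by rw [k', h', mul_assoc, hσ.mul h k]⟩ }

/-- The total space of the principal covering attached to a cocycle. -/
def LocalCocycle.Total : Type _ := Quotient hσ.setoid

/-- The quotient map onto the total space. -/
def LocalCocycle.cell (z : Z) (g : G) : hσ.Total := Quotient.mk hσ.setoid (z, g)

theorem LocalCocycle.cell_eq_mk {z z' : Z} {g g' : G} :
    hσ.cell z g = hσ.cell z' g' ↔ r z = r z' ∧ g' = g * σ z z' :=
  Quotient.eq (r := hσ.setoid)

theorem LocalCocycle.cell_surj (e : hσ.Total) : ∃ z g, e = hσ.cell z g := by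
  induction e using Quotient.inductionOn with
  | h a => exact ⟨a.1, a.2, rfl⟩

/-- The projection of the total space. -/
def LocalCocycle.proj : hσ.Total → M :=
  Quotient.lift (fun a : Z × G => r a.1) fun _ _ h => h.1

instance : MulAction G hσ.Total where
  smul g := Quotient.map (fun a : Z × G => (a.1, g * a.2)) (by
    rintro a b ⟨h, h'⟩
    exact ⟨h, by simp [h', mul_assoc]⟩)
  one_smul e := by
    obtain ⟨z, g, rfl⟩ := hσ.cell_surj e
    exact congrArg (hσ.cell z) (one_mul g)
  mul_smul a b e := by
    obtain ⟨z, g, rfl⟩ := hσ.cell_surj e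
    exact congrArg (hσ.cell z) (mul_assoc a b g)

/-- The factor `G` is made discrete here, so that the fibres of the projection are discrete; no
topology on `G` is assumed. -/
instance : TopologicalSpace hσ.Total :=
  let _ : TopologicalSpace G := ⊥
  inferInstanceAs (TopologicalSpace (Quotient hσ.setoid))

theorem LocalCocycle.isOpen_iff {U : Set hσ.Total} :
    IsOpen U ↔ ∀ g, IsOpen {z | hσ.cell z g ∈ U} := by
  let _ : TopologicalSpace G := ⊥
  have : DiscreteTopology G := ⟨rfl⟩
  change IsOpen ((fun a : Z × G => hσ.cell a.1 a.2) ⁻¹' U) ↔ _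
  constructor
  · intro h g
    exact h.preimage (by fun_prop : Continuous fun z : Z => (z, g))
  · intro h
    rw [isOpen_iff_mem_nhds]
    rintro ⟨z, g⟩ hz
    rw [nhds_prod_eq, nhds_discrete G, prod_pure]
    exact (h g).mem_nhds hz

theorem LocalCocycle.continuous_cell (g : G) : Continuous fun z => hσ.cell z g :=
  continuous_def.2 fun _ hU => hσ.isOpen_iff.1 hU g

/-- Where the cocycle is the coboundary of a locally constant `κ`, the points `cell z (a * κ z)`
with `a` fixed form an open sheet, and different `a` give disjoint sheets permuted by `G`. -/
theorem LocalCocycle.isQuotientCoveringMap : IsQuotientCoveringMap hσ.proj G where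
  surjective m := by
    obtain ⟨z, rfl⟩ := hσ.isQuotientMap.surjective m
    exact ⟨hσ.cell z 1, rfl⟩
  eq_coinduced := by
    refine TopologicalSpace.ext_iff.2 fun U => ?_
    rw [isOpen_coinduced, hσ.isOpen_iff, ← hσ.isQuotientMap.isOpen_preimage]
    exact ⟨fun h _ => h, fun h => h 1⟩
  continuous_const_smul g := continuous_def.2 fun U hU =>
    hσ.isOpen_iff.2 fun g' => hσ.isOpen_iff.1 hU (g * g')
  apply_eq_iff_mem_orbit {e₁ e₂} := by
    obtain ⟨z, g, rfl⟩ := hσ.cell_surj e₁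
    obtain ⟨z', g', rfl⟩ := hσ.cell_surj e₂
    constructor
    · intro h
      replace h : r z = r z' := h
      refine ⟨g * σ z z' * g'⁻¹, ?_⟩
      change hσ.cell z' _ = hσ.cell z g
      rw [eq_comm, hσ.cell_eq_mk]
      exact ⟨h, by group⟩
    · rintro ⟨a, ha⟩
      exact ((hσ.cell_eq_mk).1 ha).1.symm
  disjoint e := by
    obtain ⟨z₀, g₀, rfl⟩ := hσ.cell_surj e
    obtain ⟨N, κ, hN, hz₀, hsat, hκ, hco⟩ := hσ.coboundary z₀
    -- The constant `g₀ * (κ z₀)⁻¹` selects the sheet through the given point.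
    refine ⟨{e | ∃ z ∈ N, e = hσ.cell z (g₀ * (κ z₀)⁻¹ * κ z)}, ?_, ?_⟩
    · refine IsOpen.mem_nhds (hσ.isOpen_iff.2 fun g => ?_) ⟨z₀, hz₀, by simp⟩
      have : {z | hσ.cell z g ∈ {e | ∃ z ∈ N, e = hσ.cell z (g₀ * (κ z₀)⁻¹ * κ z)}} =
          {z | z ∈ N ∧ g = g₀ * (κ z₀)⁻¹ * κ z} := by
        ext z
        constructor
        · rintro ⟨z', hz', h⟩
          obtain ⟨h1, h2⟩ := hσ.cell_eq_mk.1 h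
          have hz : z ∈ N := hsat z' z h1.symm hz'
          refine ⟨hz, ?_⟩
          rw [hco z hz z' hz' h1] at h2
          rw [← mul_inv_eq_iff_eq_mul.2 h2]
          group
        · rintro ⟨hz, h⟩
          exact ⟨z, hz, by rw [h]⟩
      rw [this, isOpen_iff_mem_nhds]
      rintro z ⟨hz, h⟩
      filter_upwards [hN.mem_nhds hz, hκ z hz] with z' h1 h2
      exact ⟨h1, by rw [h2, h]⟩
    · rintro g ⟨_, ⟨_, ⟨z, hz, rfl⟩, rfl⟩, z', hz', h⟩
      change hσ.cell z _ = _ at h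
      obtain ⟨h1, h2⟩ := hσ.cell_eq_mk.1 h
      rw [hco z hz z' hz' h1] at h2
      have : g₀ * (κ z₀)⁻¹ * κ z' = g * (g₀ * (κ z₀)⁻¹ * κ z') :=
        h2.trans (by group)
      simpa using this

/-- A local cocycle becomes trivial on a simply connected space. -/
theorem LocalCocycle.exists_trivialization (hσ : LocalCocycle G r σ) {Y : Type*} [TopologicalSpace Y]
    [SimplyConnectedSpace Y] [LocallyPathConnectedSpace Y] {q : Y → M} (hq : Continuous q) :
    ∃ u : Z → Y → G,
      (∀ z z' y, r z = q y → r z' = q y → u z' y = u z y * σ z z') ∧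
      ∀ (A : Type) [TopologicalSpace A] [PreconnectedSpace A] (a : A → Z) (b : A → Y),
        Continuous a → Continuous b → (∀ t, r (a t) = q (b t)) →
          ∀ t t', u (a t) (b t) = u (a t') (b t') := by
  have cov := hσ.isQuotientCoveringMap.isCoveringMap
  obtain ⟨y₀⟩ : Nonempty Y := inferInstance
  obtain ⟨e₀, he₀⟩ := hσ.isQuotientCoveringMap.surjective (q y₀)
  -- A lift of `q` to the total space is a section of the pulled back covering; `u z y` will be its
  -- coordinate over `y` in the trivialization given by `z`, with junk value 1 when `z` and `y` do
  -- not lie over the same point.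
  obtain ⟨ℓ, ⟨-, hℓ⟩, -⟩ := cov.existsUnique_continuousMap_lifts ⟨q, hq⟩ y₀ e₀ he₀
  have hproj : ∀ y, hσ.proj (ℓ y) = q y := fun y => congrFun hℓ y
  have key : ∀ z y, ∃ g, r z = q y → hσ.cell z g = ℓ y := by
    intro z y
    by_cases h : r z = q y
    · obtain ⟨z', g', h'⟩ := hσ.cell_surj (ℓ y)
      have hz' : r z' = q y := by rw [← hproj, h']; rfl
      refine ⟨g' * σ z' z, fun _ => ?_⟩
      rw [h', eq_comm, hσ.cell_eq_mk]
      exact ⟨hz'.trans h.symm, rfl⟩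
    · exact ⟨1, fun h' => absurd h' h⟩
  choose u hu using key
  refine ⟨u, fun z z' y h h' => ?_, fun A _ _ a b ha hb hab t t' => ?_⟩
  · exact (hσ.cell_eq_mk.1 ((hu z y h).trans (hu z' y h').symm)).2
  -- With the coordinate frozen at its value for `t`, both sides lift the same map from a connected
  -- space and agree at `t`.
  · have h1 : (fun s => hσ.cell (a s) (u (a t) (b t))) = fun s => ℓ (b s) := by
      refine cov.eq_of_comp_eq ((hσ.continuous_cell _).comp ha) (ℓ.continuous.comp hb) ?_ t
        (hu _ _ (hab t))
      funext s
      exact (hab s).trans (hproj _).symm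
    have h2 := (congrFun h1 t').trans (hu _ _ (hab t')).symm
    obtain ⟨-, h3⟩ := hσ.cell_eq_mk.1 h2
    rw [h3, hσ.self_eq_one, mul_one]

end CocycleCovering

namespace PuncturedSurface

/-! ### The closed triangle and the ideal triangle -/

namespace Triangle

theorem nonneg (t : Triangle) (i : Fin 3) : 0 ≤ t.1 i := t.2.1 i

theorem sum_eq_one (t : Triangle) (i : Fin 3) : t.1 i + t.1 (i + 1) + t.1 (i + 2) = 1 := by
  have h := t.2.2
  rw [Fin.sum_univ_three] at h
  fin_cases i <;> simp at h ⊢ <;> linarith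

theorem ext_of_eq {t t' : Triangle} (i : Fin 3) (h₀ : t.1 i = t'.1 i)
    (h₁ : t.1 (i + 1) = t'.1 (i + 1)) : t = t' := by
  have h₂ : t.1 (i + 2) = t'.1 (i + 2) := by
    linarith [t.sum_eq_one i, t'.sum_eq_one i]
  refine Subtype.ext (funext fun j => ?_)
  fin_cases i <;> fin_cases j <;> simp_all

theorem vertex_apply_self (i : Fin 3) : (vertex i).1 i = 1 := by simp [vertex]

theorem vertex_apply_of_ne {i j : Fin 3} (h : j ≠ i) : (vertex i).1 j = 0 := by
  simp [vertex, h]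

theorem eq_vertex_iff {t : Triangle} {i : Fin 3} : t = vertex i ↔ t.1 i = 1 := by
  constructor
  · rintro rfl
    exact vertex_apply_self i
  · intro h
    have h1 := t.sum_eq_one i
    have h2 := t.nonneg (i + 1)
    have h3 := t.nonneg (i + 2)
    refine ext_of_eq i (by rw [h, vertex_apply_self]) ?_
    rw [vertex_apply_of_ne (by fin_cases i <;> decide)]
    linarith

theorem continuous_apply (i : Fin 3) : Continuous fun t : Triangle => t.1 i :=
  (_root_.continuous_apply i).comp continuous_subtype_val

theorem isOpen_ideal : IsOpen {t : Triangle | ∀ i, t ≠ vertex i} := by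
  simp only [ne_eq, eq_vertex_iff, ofPred_forall]
  exact isOpen_iInter_of_finite fun i =>
    (isClosed_singleton.preimage (continuous_apply i)).isOpen_compl

end Triangle

theorem Convex.locallyPathConnectedSpace {E : Type*} [NormedAddCommGroup E] [NormedSpace ℝ E]
    {s : Set E} (hs : Convex ℝ s) : LocallyPathConnectedSpace s := by
  refine LocallyPathConnectedSpace.of_bases (fun x => Metric.nhds_basis_ball (x := x)) ?_
  intro x ε hε
  rw [Topology.IsInducing.subtypeVal.isPathConnected_iff]
  have : Subtype.val '' Metric.ball x ε = s ∩ Metric.ball (x : E) ε := by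
    ext y
    constructor
    · rintro ⟨z, hz, rfl⟩
      exact ⟨z.2, hz⟩
    · rintro ⟨h1, h2⟩
      exact ⟨⟨y, h1⟩, h2, rfl⟩
  rw [this]
  exact (hs.inter (convex_ball _ _)).isPathConnected ⟨x, x.2, Metric.mem_ball_self hε⟩

namespace IdealTriangle

/-- The ideal triangle as a subset of `ℝ³`. -/
def carrier : Set (Fin 3 → ℝ) := {v | v ∈ stdSimplex ℝ (Fin 3) ∧ ∀ i, v i < 1}

theorem lt_one (t : IdealTriangle) (i : Fin 3) : t.1.1 i < 1 := by
  refine lt_of_le_of_ne ?_ fun h => t.2 i (Triangle.eq_vertex_iff.2 h)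
  linarith [t.1.sum_eq_one i, t.1.nonneg (i + 1), t.1.nonneg (i + 2)]

theorem continuous_apply (i : Fin 3) : Continuous fun t : IdealTriangle => t.1.1 i :=
  (Triangle.continuous_apply i).comp continuous_subtype_val

theorem convex_carrier : Convex ℝ carrier := by
  have : carrier = stdSimplex ℝ (Fin 3) ∩ ⋂ i : Fin 3, {v | v i < 1} := by
    ext v; simp [carrier]
  rw [this]
  refine (convex_stdSimplex ℝ (Fin 3)).inter (convex_iInter fun i => ?_)
  exact convex_halfSpace_lt (LinearMap.isLinear (LinearMap.proj i : (Fin 3 → ℝ) →ₗ[ℝ] ℝ)) 1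

/-- The ideal triangle as a convex subset of `ℝ³`. -/
def homeoCarrier : IdealTriangle ≃ₜ carrier where
  toFun t := ⟨t.1.1, t.1.2, lt_one t⟩
  invFun v := ⟨⟨v.1, v.2.1⟩, fun i h => (v.2.2 i).ne (Triangle.eq_vertex_iff.1 h)⟩
  left_inv _ := rfl
  right_inv _ := rfl
  continuous_toFun := by fun_prop
  continuous_invFun := by fun_prop

/-- The barycenter. -/
def center : IdealTriangle :=
  ⟨⟨fun _ => 1 / 3, fun _ => by norm_num, by rw [Fin.sum_univ_three]; norm_num⟩, fun i h => by
    have := Triangle.eq_vertex_iff.1 h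
    norm_num at this⟩

instance : ContractibleSpace IdealTriangle :=
  haveI := convex_carrier.contractibleSpace ⟨_, (homeoCarrier center).2⟩
  homeoCarrier.contractibleSpace

instance : LocallyPathConnectedSpace IdealTriangle :=
  haveI := Convex.locallyPathConnectedSpace convex_carrier
  homeoCarrier.isOpenEmbedding.locallyPathConnectedSpace

theorem isPreconnected_of_convex {C : Set (Fin 3 → ℝ)} (hC : Convex ℝ C) :
    IsPreconnected {t : IdealTriangle | t.1.1 ∈ C} := by
  have hind : IsInducing fun t : IdealTriangle => t.1.1 :=
    IsInducing.subtypeVal.comp IsInducing.subtypeVal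
  rw [← hind.isPreconnected_image]
  have : (fun t : IdealTriangle => t.1.1) '' {t | t.1.1 ∈ C} = carrier ∩ C := by
    ext v
    constructor
    · rintro ⟨t, ht, rfl⟩
      exact ⟨(homeoCarrier t).2, ht⟩
    · rintro ⟨h, h'⟩
      exact ⟨homeoCarrier.symm ⟨v, h⟩, h', rfl⟩
  rw [this]
  exact (convex_carrier.inter hC).isPreconnected

theorem isPreconnected_corner (i : Fin 3) (a : ℝ) :
    IsPreconnected {t : IdealTriangle | a < t.1.1 i} :=
  isPreconnected_of_convex (C := {v | a < v i})
    (convex_halfSpace_gt (LinearMap.isLinear (LinearMap.proj i : (Fin 3 → ℝ) →ₗ[ℝ] ℝ)) a)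

/-- If two coordinates vanished the third would be 1, and the point would be a removed vertex. -/
theorem eq_of_side {t : IdealTriangle} {i j : Fin 3} (hi : t.1.1 i = 0) (hj : t.1.1 j = 0) :
    i = j := by
  by_contra h
  have h1 := t.1.sum_eq_one i
  have h2 := lt_one t (i + 1)
  have h3 := lt_one t (i + 2)
  have h4 : j = i + 1 ∨ j = i + 2 := by
    revert h; fin_cases i <;> fin_cases j <;> simp
  rcases h4 with rfl | rfl <;> linarith

/-- The points of the ideal triangle on the side opposite to the corner `i`. -/
def sidePoint (i : Fin 3) (s : ℝ) (h₀ : 0 < s) (h₁ : s < 1) : IdealTriangle :=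
  ⟨⟨fun j => if j = i then 0 else if j = i + 1 then 1 - s else s, fun j => by
      dsimp only; split_ifs <;> linarith, by
      rw [Fin.sum_univ_three]; fin_cases i <;> simp⟩, fun k h => by
      have := Triangle.eq_vertex_iff.1 h
      dsimp only at this
      split_ifs at this <;> linarith⟩

theorem sidePoint_apply (i : Fin 3) (s : ℝ) (h₀ : 0 < s) (h₁ : s < 1) :
    (sidePoint i s h₀ h₁).1.1 i = 0 := by simp [sidePoint]

theorem sidePoint_apply_one (i : Fin 3) (s : ℝ) (h₀ : 0 < s) (h₁ : s < 1) :
    (sidePoint i s h₀ h₁).1.1 (i + 1) = 1 - s := by simp [sidePoint]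

theorem sidePoint_apply_two (i : Fin 3) (s : ℝ) (h₀ : 0 < s) (h₁ : s < 1) :
    (sidePoint i s h₀ h₁).1.1 (i + 2) = s := by
  fin_cases i <;> simp [sidePoint]

theorem exists_eq_sidePoint {t : IdealTriangle} {i : Fin 3} (h : t.1.1 i = 0) :
    ∃ s h₀ h₁, t = sidePoint i s h₀ h₁ := by
  have h1 := t.1.sum_eq_one i
  have h2 := lt_one t (i + 1)
  have h3 := lt_one t (i + 2)
  refine ⟨t.1.1 (i + 2), by linarith, h3, Subtype.ext (Triangle.ext_of_eq i ?_ ?_)⟩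
  · exact h.trans (sidePoint_apply _ _ _ _).symm
  · rw [sidePoint_apply_one]; linarith

end IdealTriangle

/-! ### Gluing -/

namespace Complex₂

variable {T : Complex₂}

theorem GlueRel.symm {z z' : Σ _ : T.Face, Triangle} (h : T.GlueRel z z') : T.GlueRel z' z := by
  obtain ⟨f, f', i, i', h, t, t', ht, ht', h₁, h₂⟩ := h
  exact ⟨f', f, i', i, by rw [← h, T.glue_glue], t', t, ht', ht, h₂.symm, h₁.symm⟩

/-- Being a corner of a face. -/
def IsCorner (z : Σ _ : T.Face, Triangle) : Prop := ∃ i, z.2 = Triangle.vertex i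

theorem eq_or_eq_of_ne {i j : Fin 3} (h : j ≠ i) : j = i + 1 ∨ j = i + 2 := by
  revert h; fin_cases i <;> fin_cases j <;> simp

theorem GlueRel.isCorner {z z' : Σ _ : T.Face, Triangle} (h : T.GlueRel z z') (hz : IsCorner z) :
    IsCorner z' := by
  obtain ⟨f, f', i, i', h, t, t', ht, ht', h₁, h₂⟩ := h
  obtain ⟨j, hj⟩ := hz
  replace hj := Triangle.eq_vertex_iff.1 hj
  have hne : j ≠ i := by rintro rfl; simp only at hj; linarith
  rcases eq_or_eq_of_ne hne with rfl | rfl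
  · exact ⟨i' + 2, Triangle.eq_vertex_iff.2 (h₁.trans hj)⟩
  · exact ⟨i' + 1, Triangle.eq_vertex_iff.2 (h₂.trans hj)⟩

theorem side_unique {t : Triangle} (h : ¬ ∃ i, t = Triangle.vertex i) {i j : Fin 3}
    (hi : t.1 i = 0) (hj : t.1 j = 0) : i = j :=
  IdealTriangle.eq_of_side (t := ⟨t, fun i hi => h ⟨i, hi⟩⟩) hi hj

/-- Away from the corners a point lies on at most one side, and that side is glued to only one
other. -/
theorem GlueRel.eq_of_common {z z' z'' : Σ _ : T.Face, Triangle} (hc : ¬ IsCorner z)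
    (h : T.GlueRel z z') (h' : T.GlueRel z z'') : z' = z'' := by
  obtain ⟨f, f', i, i', h, t, t', ht, ht', h₁, h₂⟩ := h
  obtain ⟨_, f'', j, j', k, _, t'', kt, kt', k₁, k₂⟩ := h'
  obtain rfl := side_unique hc ht kt
  obtain ⟨rfl, rfl⟩ := Prod.ext_iff.1 (h.symm.trans k)
  congr 1
  exact Triangle.ext_of_eq _ (ht'.trans kt'.symm) (h₂.trans k₂.symm)

/-- By `GlueRel.eq_of_common`, a chain of gluings that avoids the corners closes up after two steps.
At corners the chains can be long, but there it suffices that corners are only ever glued to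
corners. -/
theorem point_eq_point {f f' : T.Face} {t t' : Triangle} (h : T.point f t = T.point f' t') :
    (⟨f, t⟩ : Σ _ : T.Face, Triangle) = ⟨f', t'⟩ ∨ T.GlueRel ⟨f, t⟩ ⟨f', t'⟩ ∨
      ((∃ i, t = Triangle.vertex i) ∧ ∃ i, t' = Triangle.vertex i) := by
  have key : ∀ z z' : Σ _ : T.Face, Triangle, Relation.EqvGen T.GlueRel z z' →
      z = z' ∨ T.GlueRel z z' ∨ IsCorner z ∧ IsCorner z' := by
    intro z z' h
    induction h with
    | rel x y h => exact .inr (.inl h)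
    | refl x => exact .inl rfl
    | symm x y _ h =>
      rcases h with rfl | h | h
      · exact .inl rfl
      · exact .inr (.inl h.symm)
      · exact .inr (.inr h.symm)
    | trans x y z _ _ h h' =>
      rcases h with rfl | h | h
      · exact h'
      · rcases h' with rfl | h' | h'
        · exact .inr (.inl h)
        · by_cases hy : IsCorner y
          · exact .inr (.inr ⟨h.symm.isCorner hy, h'.isCorner hy⟩)
          · exact .inl (h.symm.eq_of_common hy h')
        · exact .inr (.inr ⟨h.symm.isCorner h'.1, h'.2⟩)
      · rcases h' with rfl | h' | h'
        · exact .inr (.inr h)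
        · exact .inr (.inr ⟨h.1, h'.isCorner h.2⟩)
        · exact .inr (.inr ⟨h.1, h'.2⟩)
  exact key _ _ (Quot.eqvGen_exact h)

theorem isOpen_realization_iff {U : Set T.Realization} :
    IsOpen U ↔ ∀ f, IsOpen {t | T.point f t ∈ U} :=
  Iff.trans (Iff.symm (isQuotientMap_quot_mk (r := T.GlueRel)).isOpen_preimage) isOpen_sigma_iff

theorem continuous_point (f : T.Face) : Continuous (T.point f) :=
  continuous_def.2 fun _ hU => isOpen_realization_iff.1 hU f

theorem exists_eq_point (x : T.Realization) : ∃ f t, x = T.point f t := by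
  induction x using Quot.inductionOn with
  | h z => exact ⟨z.1, z.2, rfl⟩

theorem point_glue {f f' : T.Face} {i i' : Fin 3} (h : T.glue (f, i) = (f', i')) {t t' : Triangle}
    (ht : t.1 i = 0) (ht' : t'.1 i' = 0) (h₁ : t'.1 (i' + 2) = t.1 (i + 1)) :
    T.point f t = T.point f' t' :=
  Quot.sound ⟨f, f', i, i', h, t, t', ht, ht', h₁, by
    linarith [t.sum_eq_one i, t'.sum_eq_one i']⟩

theorem point_vertex_one {f f' : T.Face} {i i' : Fin 3} (h : T.glue (f, i) = (f', i')) :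
    T.point f (Triangle.vertex (i + 1)) = T.point f' (Triangle.vertex (i' + 2)) :=
  point_glue h (Triangle.vertex_apply_of_ne (by fin_cases i <;> decide))
    (Triangle.vertex_apply_of_ne (by fin_cases i' <;> decide))
    (by rw [Triangle.vertex_apply_self, Triangle.vertex_apply_self])

theorem point_vertex_two {f f' : T.Face} {i i' : Fin 3} (h : T.glue (f, i) = (f', i')) :
    T.point f (Triangle.vertex (i + 2)) = T.point f' (Triangle.vertex (i' + 1)) :=
  (point_vertex_one (by rw [← h, T.glue_glue])).symm

end Complex₂

/-! ### Ideal triangulations -/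

namespace IdealTriangulation

variable {S : Type*} [TopologicalSpace S] {P : Set S} (T : IdealTriangulation S P)

theorem isOpen_iff {U : Set S} : IsOpen U ↔ ∀ f, IsOpen {t | T.homeo (T.point f t) ∈ U} := by
  rw [← T.homeo.isOpen_preimage, Complex₂.isOpen_realization_iff]
  rfl

theorem mem_iff {f : T.Face} {t : Triangle} :
    T.homeo (T.point f t) ∈ P ↔ ∃ i, t = Triangle.vertex i := by
  have him : T.homeo (T.point f t) ∈ P ↔
      T.point f t ∈ {x | ∃ f i, x = T.point f (Triangle.vertex i)} :=
    (Set.ext_iff.1 T.image_vertices _).symm.trans T.homeo.injective.mem_set_image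
  rw [him]
  constructor
  · rintro ⟨f', i, h⟩
    rcases Complex₂.point_eq_point h with h | h | h
    · cases h; exact ⟨i, rfl⟩
    · exact h.symm.isCorner ⟨i, rfl⟩
    · exact h.1
  · rintro ⟨i, rfl⟩
    exact ⟨f, i, rfl⟩

/-- The ideal triangle of a face, in the punctured surface. -/
def chart (f : T.Face) (t : IdealTriangle) : (Pᶜ : Set S) :=
  ⟨T.homeo (T.point f t.1), fun h => by
    obtain ⟨i, hi⟩ := T.mem_iff.1 h
    exact t.2 i hi⟩

theorem continuous_chart (f : T.Face) : Continuous (T.chart f) :=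
  Continuous.subtype_mk
    (T.homeo.continuous.comp ((Complex₂.continuous_point f).comp continuous_subtype_val)) _

theorem exists_eq_chart (x : (Pᶜ : Set S)) : ∃ f t, x = T.chart f t := by
  obtain ⟨f, t, h⟩ := Complex₂.exists_eq_point (T.homeo.symm x.1)
  have h' : x.1 = T.homeo (T.point f t) := by rw [← h, T.homeo.apply_symm_apply]
  refine ⟨f, ⟨t, fun i hi => x.2 ?_⟩, Subtype.ext h'⟩
  rw [h']
  exact T.mem_iff.2 ⟨i, hi⟩

/-- The non-corner points are open in each triangle and saturated for the gluing, and a quotient map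
restricts to a quotient map over the image of such a set. -/
theorem isQuotientMap_chart :
    IsQuotientMap fun z : Σ _ : T.Face, IdealTriangle => T.chart z.1 z.2 := by
  refine ⟨⟨TopologicalSpace.ext_iff.2 fun U => ⟨fun h => ?_, fun h => ?_⟩⟩, fun x => ?_⟩
  · exact h.preimage (continuous_sigma fun f => T.continuous_chart f)
  · rw [isOpen_coinduced, isOpen_sigma_iff] at h
    have : IsOpen (Subtype.val '' U : Set S) := by
      rw [T.isOpen_iff]
      intro f
      convert! Triangle.isOpen_ideal.isOpenMap_subtype_val _ (h f) using 1
      ext t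
      constructor
      · rintro ⟨x, hx, hxt⟩
        have ht : ∀ i, t ≠ Triangle.vertex i := fun i hi => (hxt ▸ x.2 : _ ∈ Pᶜ) (T.mem_iff.2 ⟨i, hi⟩)
        refine ⟨⟨t, ht⟩, ?_, rfl⟩
        have : x = T.chart f ⟨t, ht⟩ := Subtype.ext hxt
        exact (this ▸ hx : T.chart f ⟨t, ht⟩ ∈ U)
      · rintro ⟨t, ht, rfl⟩
        exact ⟨_, ht, rfl⟩
    have h' := this.preimage (continuous_subtype_val : Continuous (Subtype.val : (Pᶜ : Set S) → S))
    rwa [preimage_image_eq _ Subtype.val_injective] at h'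
  · obtain ⟨f, t, rfl⟩ := T.exists_eq_chart x
    exact ⟨⟨f, t⟩, rfl⟩

theorem locallyPathConnectedSpace (T : IdealTriangulation S P) :
    LocallyPathConnectedSpace (Pᶜ : Set S) :=
  T.isQuotientMap_chart.locallyPathConnectedSpace

/-- Two points of the ideal triangles with the same image are equal or glued along a side. -/
theorem chart_eq_chart {f f' : T.Face} {t t' : IdealTriangle} (h : T.chart f t = T.chart f' t') :
    (f = f' ∧ t = t') ∨ ∃ i i', T.glue (f, i) = (f', i') ∧ t.1.1 i = 0 ∧ t'.1.1 i' = 0 ∧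
      t'.1.1 (i' + 2) = t.1.1 (i + 1) ∧ t'.1.1 (i' + 1) = t.1.1 (i + 2) := by
  have h' : T.point f t.1 = T.point f' t'.1 := T.homeo.injective (congrArg Subtype.val h)
  rcases Complex₂.point_eq_point h' with h | h | h
  · left
    obtain ⟨h1, h2⟩ := Sigma.mk.inj_iff.1 h
    exact ⟨h1, Subtype.ext (eq_of_heq h2)⟩
  · right
    generalize hz : (⟨f, t.1⟩ : Σ _ : T.Face, Triangle) = z at h
    generalize hz' : (⟨f', t'.1⟩ : Σ _ : T.Face, Triangle) = z' at h
    obtain ⟨g, g', i, i', h, s, s', hs, hs', h₁, h₂⟩ := h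
    obtain ⟨rfl, h2⟩ := Sigma.mk.inj_iff.1 hz
    obtain ⟨rfl, h3⟩ := Sigma.mk.inj_iff.1 hz'
    obtain rfl := eq_of_heq h2
    obtain rfl := eq_of_heq h3
    exact ⟨i, i', h, hs, hs', h₁, h₂⟩
  · obtain ⟨⟨i, hi⟩, -⟩ := h
    exact absurd hi (t.2 i)

theorem chart_glue {f f' : T.Face} {i i' : Fin 3} (h : T.glue (f, i) = (f', i'))
    {t t' : IdealTriangle} (ht : t.1.1 i = 0) (ht' : t'.1.1 i' = 0)
    (h₁ : t'.1.1 (i' + 2) = t.1.1 (i + 1)) : T.chart f t = T.chart f' t' :=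
  Subtype.ext (congrArg T.homeo (Complex₂.point_glue h ht ht' h₁))

end IdealTriangulation

end PuncturedSurface

namespace PuncturedSurface

/-! ### Neighbourhoods of the corners of a triangle -/

theorem eventually_vertex_iff {p : IdealTriangle → Prop} {i : Fin 3} :
    (∀ᶠ t in comap (Subtype.val : IdealTriangle → Triangle) (𝓝 (Triangle.vertex i)), p t) ↔
      ∃ a < 1, ∀ t : IdealTriangle, a < t.1.1 i → p t := by
  constructor
  · intro h
    obtain ⟨W, hW, hWp⟩ := mem_comap.1 h
    obtain ⟨ε, hε, hball⟩ := Metric.mem_nhds_iff.1 hW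
    -- The three coordinates sum to 1, so once one exceeds `1 - ε` the other two are below `ε`.
    refine ⟨1 - ε, by linarith, fun t ht => hWp (hball ?_)⟩
    change dist t.1.1 (Triangle.vertex i).1 < ε
    rw [dist_pi_lt_iff hε]
    intro j
    have h1 := t.1.sum_eq_one i
    have h2 := t.1.nonneg (i + 1)
    have h3 := t.1.nonneg (i + 2)
    rw [Real.dist_eq, abs_lt]
    by_cases hj : j = i
    · subst hj
      rw [Triangle.vertex_apply_self]
      constructor <;> linarith
    · rw [Triangle.vertex_apply_of_ne hj]
      rcases Complex₂.eq_or_eq_of_ne hj with rfl | rfl <;> constructor <;> linarith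
  · rintro ⟨a, ha, h⟩
    refine mem_comap.2 ⟨{t | a < t.1 i}, ?_, fun t ht => h t ht⟩
    refine (isOpen_lt continuous_const (Triangle.continuous_apply i)).mem_nhds ?_
    change a < (Triangle.vertex i).1 i
    rwa [Triangle.vertex_apply_self]

theorem exists_glued_near_corner (i i' : Fin 3) {a : ℝ} (ha : a < 1) :
    ∃ t t' : IdealTriangle, t.1.1 i = 0 ∧ t'.1.1 i' = 0 ∧ t'.1.1 (i' + 2) = t.1.1 (i + 1) ∧
      a < t.1.1 (i + 1) := by
  obtain ⟨s, hs, hs'⟩ := exists_between (max_lt ha one_pos)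
  obtain ⟨h1, h2⟩ := max_lt_iff.1 hs
  refine ⟨IdealTriangle.sidePoint i (1 - s) (by linarith) (by linarith),
    IdealTriangle.sidePoint i' s h2 hs', IdealTriangle.sidePoint_apply _ _ _ _,
    IdealTriangle.sidePoint_apply _ _ _ _, ?_, ?_⟩
  · rw [IdealTriangle.sidePoint_apply_one, IdealTriangle.sidePoint_apply_two]; ring
  · rw [IdealTriangle.sidePoint_apply_one]; linarith

instance (i : Fin 3) :
    (comap (Subtype.val : IdealTriangle → Triangle) (𝓝 (Triangle.vertex i))).NeBot := by
  rw [neBot_iff]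
  intro h
  have h' : ∀ᶠ t in comap (Subtype.val : IdealTriangle → Triangle) (𝓝 (Triangle.vertex i)),
      False := by rw [h]; exact eventually_bot
  obtain ⟨a, ha, h'⟩ := eventually_vertex_iff.1 h'
  obtain ⟨t, _, _, _, _, h''⟩ := exists_glued_near_corner (i + 2) 0 ha
  refine h' t ?_
  have e : i + 2 + 1 = i := by fin_cases i <;> rfl
  rwa [e] at h''

/-- This is why 1/2 serves as threshold for closeness to a corner: the corner regions of one
triangle are then disjoint. -/
theorem corner_unique {t : Triangle} {j j' : Fin 3} (h : 1 / 2 < t.1 j) (h' : 1 / 2 < t.1 j') :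
    j = j' := by
  by_contra hne
  have h1 := t.sum_eq_one j
  have h2 := t.nonneg (j + 1)
  have h3 := t.nonneg (j + 2)
  rcases Complex₂.eq_or_eq_of_ne (Ne.symm hne) with rfl | rfl <;> linarith

/-! ### Lifted triangles -/

variable {S : Type*} [TopologicalSpace S] {P : Set S} {Y : Type*} [TopologicalSpace Y]
  {T : IdealTriangulation S P} {q : Y → (Pᶜ : Set S)}

/-- Required for lifting maps from `Y` through coverings. The property passes from triangles to
their quotient, and then to `Y` along the local homeomorphism `q`. -/
theorem IsUniversalCovering.locallyPathConnectedSpace (hq : IsUniversalCovering q)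
    (T : IdealTriangulation S P) : LocallyPathConnectedSpace Y := by
  have := T.locallyPathConnectedSpace
  choose e he _ using hq.isCoveringMap.isLocalHomeomorph
  let _ : ChartedSpace (Pᶜ : Set S) Y :=
    { atlas := range e
      chartAt := e
      mem_chart_source := he
      chart_mem_atlas := mem_range_self }
  exact ChartedSpace.locallyPathConnectedSpace (Pᶜ : Set S) Y

namespace LiftedTriangle

theorem q_apply (τ : LiftedTriangle T q) (t : IdealTriangle) :
    q (τ.toFun t) = T.chart τ.face t := Subtype.ext (τ.isLift t)

theorem eq_of_apply_eq (hq : IsUniversalCovering q) {τ τ' : LiftedTriangle T q}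
    (hf : τ.face = τ'.face) (t : IdealTriangle) (h : τ.toFun t = τ'.toFun t) : τ = τ' := by
  have h' : τ.toFun = τ'.toFun := by
    refine hq.isCoveringMap.eq_of_comp_eq τ.continuous τ'.continuous (funext fun s => ?_) t h
    exact (τ.q_apply s).trans ((hf ▸ rfl : _ = _).trans (τ'.q_apply s).symm)
  obtain ⟨f, u, _, _⟩ := τ
  obtain ⟨f', u', _, _⟩ := τ'
  obtain rfl : f = f' := hf
  obtain rfl : u = u' := h'
  rfl

theorem exists_apply_eq (hq : IsUniversalCovering q) {f : T.Face} {t : IdealTriangle} {y : Y}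
    (h : q y = T.chart f t) : ∃ τ : LiftedTriangle T q, τ.face = f ∧ τ.toFun t = y := by
  obtain ⟨F, ⟨h1, h2⟩, -⟩ := hq.isCoveringMap.existsUnique_continuousMap_lifts
    ⟨T.chart f, T.continuous_chart f⟩ t y h
  exact ⟨⟨f, F, F.continuous, fun s => congrArg Subtype.val (congrFun h2 s)⟩, rfl, h1⟩

theorem exists_eq_apply (hq : IsUniversalCovering q) (T : IdealTriangulation S P) (y : Y) :
    ∃ (τ : LiftedTriangle T q) (t : IdealTriangle), y = τ.toFun t := by
  obtain ⟨f, t, h⟩ := T.exists_eq_chart (q y)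
  obtain ⟨τ, -, h'⟩ := exists_apply_eq hq h
  exact ⟨τ, t, h'.symm⟩

theorem exists_face (hq : IsUniversalCovering q) (f : T.Face) :
    ∃ τ : LiftedTriangle T q, τ.face = f := by
  obtain ⟨y, hy⟩ := hq.surjective (T.chart f IdealTriangle.center)
  obtain ⟨τ, h, -⟩ := exists_apply_eq hq hy
  exact ⟨τ, h⟩

/-- The translate of a lifted triangle by a deck transformation. -/
def translate (γ : deckGroup q) (τ : LiftedTriangle T q) : LiftedTriangle T q where
  face := τ.face
  toFun t := γ.1 (τ.toFun t)
  continuous := γ.1.continuous.comp τ.continuous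
  isLift t := by rw [γ.2, τ.isLift]

theorem IsVertex.translate {τ : LiftedTriangle T q} {i : Fin 3} {x : LiftedPuncture q}
    (h : τ.IsVertex i x) (γ : deckGroup q) : (τ.translate γ).IsVertex i (γ • x) :=
  ⟨h.1, fun U => (h.2 U).mono fun _ ht => mem_image_of_mem _ ht⟩

end LiftedTriangle

/-- Lift `q` through itself, once sending `y` to `y'` and once back; by uniqueness of lifts the two
maps are inverse to each other. -/
theorem IsUniversalCovering.exists_deck (hq : IsUniversalCovering q) (T : IdealTriangulation S P)
    {y y' : Y} (h : q y = q y') : ∃ γ : deckGroup q, γ.1 y = y' := by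
  have := hq.locallyPathConnectedSpace T
  have := hq.simplyConnected
  have cov := hq.isCoveringMap
  have key : ∀ {y y' : Y}, q y = q y' → ∃ F : C(Y, Y), F y = y' ∧ ∀ z, q (F z) = q z := by
    intro y y' h
    obtain ⟨F, ⟨h1, h2⟩, -⟩ :=
      cov.existsUnique_continuousMap_lifts ⟨q, cov.continuous⟩ y y' h.symm
    exact ⟨F, h1, congrFun h2⟩
  have comp : ∀ {y : Y} (F G : C(Y, Y)), (∀ z, q (F z) = q z) → (∀ z, q (G z) = q z) →
      F (G y) = y → ∀ z, F (G z) = z := by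
    intro y F G hF hG h z
    exact congrFun (cov.eq_of_comp_eq (g₁ := fun z => F (G z)) (g₂ := id)
      (F.continuous.comp G.continuous) continuous_id
      (funext fun z => (hF _).trans (hG z)) y h) z
  obtain ⟨F, hF, hFq⟩ := key h
  obtain ⟨G, hG, hGq⟩ := key h.symm
  exact ⟨⟨⟨⟨F, G, comp G F hGq hFq (by rw [hF, hG]), comp F G hFq hGq (by rw [hG, hF])⟩,
    F.continuous, G.continuous⟩, hFq⟩, hF⟩

namespace LiftedTriangle

theorem exists_translate_eq (hq : IsUniversalCovering q) {τ τ' : LiftedTriangle T q}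
    (h : τ.face = τ'.face) : ∃ γ : deckGroup q, τ.translate γ = τ' := by
  have : q (τ.toFun IdealTriangle.center) = q (τ'.toFun IdealTriangle.center) := by
    rw [τ.q_apply, τ'.q_apply, h]
  obtain ⟨γ, hγ⟩ := hq.exists_deck T this
  exact ⟨γ, eq_of_apply_eq hq h _ hγ⟩

/-- The side `i` of `τ` and the side `i'` of `τ'` are the same, with opposite orientations. -/
def Adjacent (τ : LiftedTriangle T q) (i : Fin 3) (τ' : LiftedTriangle T q) (i' : Fin 3) : Prop :=
  T.glue (τ.face, i) = (τ'.face, i') ∧ ∀ t t' : IdealTriangle, t.1.1 i = 0 → t'.1.1 i' = 0 →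
    t'.1.1 (i' + 2) = t.1.1 (i + 1) → τ.toFun t = τ'.toFun t'

theorem Adjacent.symm {τ τ' : LiftedTriangle T q} {i i' : Fin 3} (h : Adjacent τ i τ' i') :
    Adjacent τ' i' τ i := by
  refine ⟨by rw [← h.1, T.glue_glue], fun t t' ht ht' h' => (h.2 t' t ht' ht ?_).symm⟩
  linarith [t.1.sum_eq_one i', t'.1.sum_eq_one i]

theorem Adjacent.translate {τ τ' : LiftedTriangle T q} {i i' : Fin 3} (h : Adjacent τ i τ' i')
    (γ : deckGroup q) : Adjacent (τ.translate γ) i (τ'.translate γ) i' :=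
  ⟨h.1, fun t t' ht ht' h' => congrArg γ.1 (h.2 t t' ht ht' h')⟩

theorem continuous_sidePoint (i : Fin 3) :
    Continuous fun s : Ioo (0 : ℝ) 1 => IdealTriangle.sidePoint i s.1 s.2.1 s.2.2 := by
  refine Continuous.subtype_mk (Continuous.subtype_mk (continuous_pi fun j => ?_) _) _
  split_ifs <;> fun_prop

/-- An open side is connected, so two lifts of it that agree at one point agree along the whole
side. The parameter is reversed because gluing reverses the direction. -/
theorem adjacent_of_apply_eq (hq : IsUniversalCovering q) {τ τ' : LiftedTriangle T q}
    {i i' : Fin 3} (hg : T.glue (τ.face, i) = (τ'.face, i')) {t t' : IdealTriangle}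
    (ht : t.1.1 i = 0) (ht' : t'.1.1 i' = 0) (h : t'.1.1 (i' + 2) = t.1.1 (i + 1))
    (he : τ.toFun t = τ'.toFun t') : Adjacent τ i τ' i' := by
  have : PreconnectedSpace (Ioo (0 : ℝ) 1) :=
    Subtype.preconnectedSpace isPreconnected_Ioo
  have symm_mem : ∀ s : Ioo (0 : ℝ) 1, 1 - s.1 ∈ Ioo (0 : ℝ) 1 := fun s =>
    ⟨by linarith [s.2.2], by linarith [s.2.1]⟩
  have hsymm : Continuous fun s : Ioo (0 : ℝ) 1 => (⟨1 - s.1, symm_mem s⟩ : Ioo (0 : ℝ) 1) := by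
    fun_prop
  have key : (fun s : Ioo (0 : ℝ) 1 => τ.toFun (IdealTriangle.sidePoint i s.1 s.2.1 s.2.2)) =
      fun s => τ'.toFun (IdealTriangle.sidePoint i' (1 - s.1) (symm_mem s).1 (symm_mem s).2) := by
    obtain ⟨s, h₀, h₁, rfl⟩ := IdealTriangle.exists_eq_sidePoint ht
    obtain ⟨s', h₀', h₁', rfl⟩ := IdealTriangle.exists_eq_sidePoint ht'
    rw [IdealTriangle.sidePoint_apply_one, IdealTriangle.sidePoint_apply_two] at h
    subst h
    refine hq.isCoveringMap.eq_of_comp_eq (τ.continuous.comp (continuous_sidePoint i))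
      (τ'.continuous.comp ((continuous_sidePoint i').comp hsymm))
      (funext fun s => ?_) ⟨s, h₀, h₁⟩ he
    refine (τ.q_apply _).trans (Eq.trans ?_ (τ'.q_apply _).symm)
    refine T.chart_glue hg (IdealTriangle.sidePoint_apply _ _ _ _)
      (IdealTriangle.sidePoint_apply _ _ _ _) ?_
    rw [IdealTriangle.sidePoint_apply_one]
    exact IdealTriangle.sidePoint_apply_two _ _ _ _
  refine ⟨hg, fun u u' hu hu' h' => ?_⟩
  obtain ⟨s, h₀, h₁, rfl⟩ := IdealTriangle.exists_eq_sidePoint hu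
  obtain ⟨s', h₀', h₁', rfl⟩ := IdealTriangle.exists_eq_sidePoint hu'
  rw [IdealTriangle.sidePoint_apply_one, IdealTriangle.sidePoint_apply_two] at h'
  subst h'
  exact congrFun key ⟨s, h₀, h₁⟩

theorem exists_adjacent (hq : IsUniversalCovering q) (τ : LiftedTriangle T q) (i : Fin 3) :
    ∃ τ' i', Adjacent τ i τ' i' := by
  obtain ⟨t, t', ht, ht', h, -⟩ :=
    exists_glued_near_corner i (T.glue (τ.face, i)).2 (a := 0) one_pos
  have h1 : q (τ.toFun t) = T.chart (T.glue (τ.face, i)).1 t' :=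
    (τ.q_apply t).trans (T.chart_glue rfl ht ht' h)
  obtain ⟨τ', hf, h'⟩ := exists_apply_eq hq h1
  exact ⟨τ', _, adjacent_of_apply_eq hq (Prod.ext hf.symm rfl) ht ht' h h'.symm⟩

theorem eq_or_adjacent (hq : IsUniversalCovering q) {τ τ' : LiftedTriangle T q}
    {t t' : IdealTriangle} (h : τ.toFun t = τ'.toFun t') :
    (τ = τ' ∧ t = t') ∨ ∃ i i', Adjacent τ i τ' i' ∧ t.1.1 i = 0 ∧ t'.1.1 i' = 0 ∧
      t'.1.1 (i' + 2) = t.1.1 (i + 1) ∧ t'.1.1 (i' + 1) = t.1.1 (i + 2) := by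
  have h' := congrArg q h
  rw [τ.q_apply, τ'.q_apply] at h'
  rcases T.chart_eq_chart h' with ⟨h1, rfl⟩ | ⟨i, i', hg, ht, ht', h1, h2⟩
  · exact .inl ⟨eq_of_apply_eq hq h1 t h, rfl⟩
  · exact .inr ⟨i, i', adjacent_of_apply_eq hq hg ht ht' h1 h, ht, ht', h1, h2⟩

end LiftedTriangle

/-- `Y` carries the weak topology of its lifted triangles: on a sheet of `q` openness can be tested
downstairs, where the ideal triangles give a quotient map, and any point of a triangle downstairs
lifts together with its triangle. -/
theorem IsUniversalCovering.isOpen_of_lift (hq : IsUniversalCovering q)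
    (T : IdealTriangulation S P) {A : Set Y}
    (h : ∀ τ : LiftedTriangle T q, IsOpen {t | τ.toFun t ∈ A}) : IsOpen A := by
  rw [isOpen_iff_mem_nhds]
  intro y hy
  obtain ⟨e, he, heq⟩ := hq.isCoveringMap.isLocalHomeomorph y
  have hopen : IsOpen (q '' (A ∩ e.source)) := by
    rw [← T.isQuotientMap_chart.isOpen_preimage, isOpen_sigma_iff]
    intro f
    rw [isOpen_iff_mem_nhds]
    rintro t ⟨y', ⟨hy', hy's⟩, h'⟩
    obtain ⟨τ, rfl, rfl⟩ := LiftedTriangle.exists_apply_eq hq h'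
    have h1 := (h τ).mem_nhds hy'
    have h2 := τ.continuous.continuousAt.preimage_mem_nhds (e.open_source.mem_nhds hy's)
    filter_upwards [h1, h2] with s hs hs'
    exact ⟨τ.toFun s, ⟨hs, hs'⟩, τ.q_apply s⟩
  have h1 : q ⁻¹' (q '' (A ∩ e.source)) ∩ e.source ∈ 𝓝 y :=
    inter_mem (hq.isCoveringMap.continuous.continuousAt.preimage_mem_nhds
      (hopen.mem_nhds ⟨y, ⟨hy, he⟩, rfl⟩)) (e.open_source.mem_nhds he)
  refine mem_of_superset h1 ?_
  rintro z ⟨⟨w, ⟨hw, hws⟩, hwz⟩, hz⟩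
  rw [heq] at hwz
  rwa [← e.injOn hws hz hwz]

/-- A function on the lifted triangles which is invariant under adjacency is constant. -/
theorem LiftedTriangle.eq_of_adjacent_invariant (hq : IsUniversalCovering q) {α : Type*}
    (c : LiftedTriangle T q → α) (hc : ∀ τ i τ' i', Adjacent τ i τ' i' → c τ = c τ')
    (τ τ' : LiftedTriangle T q) : c τ = c τ' := by
  have wd : ∀ {τ τ' : LiftedTriangle T q} {t t'}, τ.toFun t = τ'.toFun t' → c τ = c τ' := by
    intro τ τ' t t' h
    rcases eq_or_adjacent hq h with ⟨rfl, -⟩ | ⟨i, i', h', -⟩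
    · rfl
    · exact hc _ _ _ _ h'
  -- The function descends to a locally constant one on `Y`: for each `p` the points covered by
  -- triangles whose value satisfies `p` form an open set. Connectedness, applied to a value and its
  -- negation, finishes.
  have hopen : ∀ p : α → Prop,
      IsOpen {y | ∃ (τ : LiftedTriangle T q) (t : _), y = τ.toFun t ∧ p (c τ)} := by
    intro p
    refine hq.isOpen_of_lift T fun τ => ?_
    have : {t | τ.toFun t ∈ {y | ∃ (τ : LiftedTriangle T q) (t : _), y = τ.toFun t ∧ p (c τ)}} =
        {_t | p (c τ)} := by
      ext t
      constructor
      · rintro ⟨τ', t', h, h'⟩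
        change p (c τ)
        rwa [wd h]
      · intro h
        exact ⟨τ, t, rfl, h⟩
    rw [this]
    exact isOpen_const
  have := hq.simplyConnected
  by_contra hne
  obtain ⟨y, -, ⟨τ₁, t₁, h₁, h₁'⟩, τ₂, t₂, h₂, h₂'⟩ :=
    isPreconnected_univ (α := Y) _ _ (hopen fun a => a = c τ) (hopen fun a => a ≠ c τ)
      (fun y _ => by
        obtain ⟨σ, t, h⟩ := exists_eq_apply hq T y
        by_cases h' : c σ = c τ
        · exact .inl ⟨σ, t, h, h'⟩
        · exact .inr ⟨σ, t, h, h'⟩)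
      ⟨_, trivial, τ, IdealTriangle.center, rfl, rfl⟩
      ⟨_, trivial, τ', IdealTriangle.center, rfl, fun h => hne h.symm⟩
  exact h₂' ((wd (h₂.symm.trans h₁)).trans h₁')

/-- A function on the corners of the lifted triangles, invariant under adjacency, is constant on a
connected set of points close to the corners. -/
theorem LiftedTriangle.eq_of_corner_invariant (hq : IsUniversalCovering q) {α : Type*}
    (c : LiftedTriangle T q → Fin 3 → α)
    (hc : ∀ τ i τ' i', Adjacent τ i τ' i' → c τ (i + 1) = c τ' (i' + 2))
    {C : Set Y} (hC : IsPreconnected C)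
    (hCc : ∀ y ∈ C, ∃ (τ : LiftedTriangle T q) (t : _) (j : _), y = τ.toFun t ∧ 1 / 2 < t.1.1 j)
    {τ τ' : LiftedTriangle T q} {t t' : IdealTriangle} {j j' : Fin 3} (h : τ.toFun t ∈ C)
    (hj : 1 / 2 < t.1.1 j) (h' : τ'.toFun t' ∈ C) (hj' : 1 / 2 < t'.1.1 j') :
    c τ j = c τ' j' := by
  have wd : ∀ {τ τ' : LiftedTriangle T q} {t t' : IdealTriangle} {j j'},
      τ.toFun t = τ'.toFun t' → 1 / 2 < t.1.1 j → 1 / 2 < t'.1.1 j' → c τ j = c τ' j' := by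
    intro τ τ' t t' j j' h hj hj'
    rcases eq_or_adjacent hq h with ⟨rfl, rfl⟩ | ⟨i, i', h', ht, ht', h1, h2⟩
    · rw [corner_unique hj hj']
    · have hne : j ≠ i := by rintro rfl; linarith
      rcases Complex₂.eq_or_eq_of_ne hne with rfl | rfl
      · rw [← h1] at hj
        rw [corner_unique hj' hj]
        exact hc _ _ _ _ h'
      · rw [← h2] at hj
        rw [corner_unique hj' hj]
        exact (hc _ _ _ _ h'.symm).symm
  have hopen : ∀ p : α → Prop, IsOpen {y | ∃ (τ : LiftedTriangle T q) (t : _) (j : _),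
      y = τ.toFun t ∧ 1 / 2 < t.1.1 j ∧ p (c τ j)} := by
    intro p
    refine hq.isOpen_of_lift T fun τ => ?_
    have : {t | τ.toFun t ∈ {y | ∃ (τ : LiftedTriangle T q) (t : _) (j : _),
        y = τ.toFun t ∧ 1 / 2 < t.1.1 j ∧ p (c τ j)}} =
        ⋃ j : Fin 3, {t : IdealTriangle | 1 / 2 < t.1.1 j ∧ p (c τ j)} := by
      ext t
      simp only [mem_iUnion]
      constructor
      · rintro ⟨τ', t', j', h, hj', h'⟩
        -- Gluing carries the two possibly nonzero coordinates of a side point to each other, so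
        -- closeness to a corner is visible in either triangle.
        have hj : ∃ j, 1 / 2 < t.1.1 j := by
          rcases eq_or_adjacent hq h with ⟨-, rfl⟩ | ⟨i, i', -, ht, ht', h1, h2⟩
          · exact ⟨j', hj'⟩
          · have hne : j' ≠ i' := by rintro rfl; linarith
            rcases Complex₂.eq_or_eq_of_ne hne with rfl | rfl
            · exact ⟨i + 2, h2 ▸ hj'⟩
            · exact ⟨i + 1, h1 ▸ hj'⟩
        obtain ⟨j, hj⟩ := hj
        refine ⟨j, hj, ?_⟩
        rwa [wd h hj hj']
      · rintro ⟨j, hj, h⟩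
        exact ⟨τ, t, j, rfl, hj, h⟩
    rw [this]
    refine isOpen_iUnion fun j => ?_
    exact (isOpen_lt continuous_const (IdealTriangle.continuous_apply j)).and isOpen_const
  by_contra hne
  obtain ⟨y, -, ⟨τ₁, t₁, j₁, h₁, hj₁, h₁'⟩, τ₂, t₂, j₂, h₂, hj₂, h₂'⟩ :=
    hC _ _ (hopen fun a => a = c τ j) (hopen fun a => a ≠ c τ j)
      (fun y hy => by
        obtain ⟨σ, t, k, h, hk⟩ := hCc y hy
        by_cases h' : c σ k = c τ j
        · exact .inl ⟨σ, t, k, h, hk, h'⟩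
        · exact .inr ⟨σ, t, k, h, hk, h'⟩)
      ⟨_, h, τ, t, j, rfl, hj, rfl⟩
      ⟨_, h', τ', t', j', rfl, hj', fun h => hne h.symm⟩
  exact h₂' ((wd (h₂.symm.trans h₁) hj₂ hj₁).trans h₁')

end PuncturedSurface

/-! ### Ends of the universal covering and vertices of lifted triangles -/

namespace PuncturedSurface

variable {S : Type*} [TopologicalSpace S] {P : Set S} {Y : Type*} [TopologicalSpace Y]
  {T : IdealTriangulation S P} {q : Y → (Pᶜ : Set S)}

namespace LiftedPuncture

theorem comp_subset (x : LiftedPuncture q) (U : TopologicalSpace.OpenNhdsOf x.pt) : x.comp U ⊆ overSet q U := by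
  obtain ⟨y, -, h⟩ := x.isComp U
  rw [h]
  exact connectedComponentIn_subset _ _

theorem isPreconnected_comp (x : LiftedPuncture q) (U : TopologicalSpace.OpenNhdsOf x.pt) :
    IsPreconnected (x.comp U) := by
  obtain ⟨y, -, h⟩ := x.isComp U
  rw [h]
  exact isPreconnected_connectedComponentIn

theorem comp_eq_of_mem (x : LiftedPuncture q) (U : TopologicalSpace.OpenNhdsOf x.pt) {z : Y}
    (hz : z ∈ x.comp U) : x.comp U = connectedComponentIn (overSet q U) z := by
  obtain ⟨y, -, h⟩ := x.isComp U
  rw [h] at hz ⊢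
  exact connectedComponentIn_eq hz

theorem comp_nonempty (x : LiftedPuncture q) (U : TopologicalSpace.OpenNhdsOf x.pt) : (x.comp U).Nonempty := by
  obtain ⟨y, hy, h⟩ := x.isComp U
  rw [h]
  exact ⟨y, mem_connectedComponentIn hy⟩

/-- Connected components of the same set that meet are equal. -/
theorem ext_of_inter {x x' : LiftedPuncture q} (h : x.pt = x'.pt)
    (hU : ∀ (U : TopologicalSpace.OpenNhdsOf x.pt) (U' : TopologicalSpace.OpenNhdsOf x'.pt), (U : Set S) = U' →
      (x.comp U ∩ x'.comp U').Nonempty) : x = x' := by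
  obtain ⟨v, hv, c, hc, hm⟩ := x
  obtain ⟨v', hv', c', hc', hm'⟩ := x'
  obtain rfl : v = v' := h
  have : c = c' := by
    funext U
    obtain ⟨z, hz, hz'⟩ := hU U U rfl
    exact (comp_eq_of_mem ⟨v, hv, c, hc, hm⟩ U hz).trans
      (comp_eq_of_mem ⟨v, hv', c', hc', hm'⟩ U hz').symm
  subst this
  rfl

end LiftedPuncture

namespace LiftedTriangle

theorem exists_corner_subset (τ : LiftedTriangle T q) (i : Fin 3) {U : Set S} (hU : IsOpen U)
    (hv : T.homeo (T.point τ.face (Triangle.vertex i)) ∈ U) :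
    ∃ a < 1, ∀ t : IdealTriangle, a < t.1.1 i → τ.toFun t ∈ overSet q U := by
  rw [← eventually_vertex_iff]
  have h : ∀ᶠ t in 𝓝 (Triangle.vertex i), T.homeo (T.point τ.face t) ∈ U :=
    (T.homeo.continuous.comp (Complex₂.continuous_point τ.face)).continuousAt.preimage_mem_nhds
      (hU.mem_nhds hv)
  refine (tendsto_comap.eventually h).mono fun t ht => ?_
  change (q (τ.toFun t) : S) ∈ U
  rwa [τ.isLift]

/-- A small corner region of the triangle is convex, hence connected, so its lift stays in a single
component. -/
theorem exists_eventually_mem_component (τ : LiftedTriangle T q) (i : Fin 3) {U : Set S}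
    (hU : IsOpen U) (hv : T.homeo (T.point τ.face (Triangle.vertex i)) ∈ U) :
    ∃ y ∈ overSet q U,
      ∀ᶠ t in comap (Subtype.val : IdealTriangle → Triangle) (𝓝 (Triangle.vertex i)),
        τ.toFun t ∈ connectedComponentIn (overSet q U) y := by
  obtain ⟨a, ha, h⟩ := τ.exists_corner_subset i hU hv
  obtain ⟨t₀, ht₀⟩ := (eventually_vertex_iff.2 ⟨a, ha, fun t ht => ht⟩ :
    ∀ᶠ t in comap (Subtype.val : IdealTriangle → Triangle) (𝓝 (Triangle.vertex i)),
      a < t.1.1 i).exists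
  refine ⟨τ.toFun t₀, h t₀ ht₀, eventually_vertex_iff.2 ⟨a, ha, fun t ht => ?_⟩⟩
  have hpre : IsPreconnected (τ.toFun '' {t | a < t.1.1 i}) :=
    (IdealTriangle.isPreconnected_corner i a).image _ τ.continuous.continuousOn
  exact hpre.subset_connectedComponentIn (mem_image_of_mem _ ht₀)
    (by rintro _ ⟨t, ht, rfl⟩; exact h t ht) (mem_image_of_mem _ ht)

/-- The vertex `i` of a lifted triangle. -/
def vertex (τ : LiftedTriangle T q) (i : Fin 3) : LiftedPuncture q where
  pt := T.homeo (T.point τ.face (Triangle.vertex i))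
  mem := T.mem_iff.2 ⟨i, rfl⟩
  comp U := connectedComponentIn (overSet q U)
    (τ.exists_eventually_mem_component i U.isOpen U.mem).choose
  isComp U := ⟨_, (τ.exists_eventually_mem_component i U.isOpen U.mem).choose_spec.1, rfl⟩
  mono U U' h := by
    have h1 := (τ.exists_eventually_mem_component i U.isOpen U.mem).choose_spec.2
    have h2 := (τ.exists_eventually_mem_component i U'.isOpen U'.mem).choose_spec.2
    -- Both components contain all points of the triangle close enough to the corner, so they share
    -- one.
    obtain ⟨t, ht, ht'⟩ := (h1.and h2).exists
    rw [connectedComponentIn_eq ht, connectedComponentIn_eq ht']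
    exact connectedComponentIn_mono _ (fun y hy => h hy)

theorem isVertex_vertex (τ : LiftedTriangle T q) (i : Fin 3) : τ.IsVertex i (τ.vertex i) :=
  ⟨rfl, fun U => (τ.exists_eventually_mem_component i U.isOpen U.mem).choose_spec.2⟩

theorem IsVertex.eq {τ : LiftedTriangle T q} {i : Fin 3} {x x' : LiftedPuncture q}
    (h : τ.IsVertex i x) (h' : τ.IsVertex i x') : x = x' := by
  refine LiftedPuncture.ext_of_inter (h.1.trans h'.1.symm) fun U U' _ => ?_
  obtain ⟨t, ht, ht'⟩ := ((h.2 U).and (h'.2 U')).exists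
  exact ⟨_, ht, ht'⟩

theorem isVertex_iff {τ : LiftedTriangle T q} {i : Fin 3} {x : LiftedPuncture q} :
    τ.IsVertex i x ↔ x = τ.vertex i :=
  ⟨fun h => h.eq (τ.isVertex_vertex i), fun h => h ▸ τ.isVertex_vertex i⟩

theorem vertex_translate (γ : deckGroup q) (τ : LiftedTriangle T q) (i : Fin 3) :
    (τ.translate γ).vertex i = γ • τ.vertex i :=
  (isVertex_iff.1 ((τ.isVertex_vertex i).translate γ)).symm

/-- Points of the common side that approach its endpoint lie in the components chosen by both
triangles. The indices are crossed by the reversal of direction. -/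
theorem Adjacent.vertex_eq {τ τ' : LiftedTriangle T q} {i i' : Fin 3} (h : Adjacent τ i τ' i') :
    τ.vertex (i + 1) = τ'.vertex (i' + 2) := by
  refine LiftedPuncture.ext_of_inter (congrArg T.homeo (Complex₂.point_vertex_one h.1))
    fun U U' _ => ?_
  obtain ⟨a, ha, h1⟩ := eventually_vertex_iff.1 ((τ.isVertex_vertex (i + 1)).2 U)
  obtain ⟨a', ha', h1'⟩ := eventually_vertex_iff.1 ((τ'.isVertex_vertex (i' + 2)).2 U')
  obtain ⟨t, t', ht, ht', he, hta⟩ := exists_glued_near_corner i i' (max_lt ha ha')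
  obtain ⟨h2, h3⟩ := max_lt_iff.1 hta
  refine ⟨τ.toFun t, h1 t h2, ?_⟩
  rw [h.2 t t' ht ht' he]
  exact h1' t' (he ▸ h3)

theorem Adjacent.vertex_eq' {τ τ' : LiftedTriangle T q} {i i' : Fin 3} (h : Adjacent τ i τ' i') :
    τ.vertex (i + 2) = τ'.vertex (i' + 1) := h.symm.vertex_eq.symm

end LiftedTriangle

/-! ### Star neighbourhoods of the punctures -/

namespace IdealTriangulation

variable (T) in
/-- The points whose barycentric coordinate at a corner over `v` is larger than `a`. -/
def star (v : S) (a : ℝ) : Set S :=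
  {s | ∃ f t j, s = T.homeo (T.point f t) ∧ T.homeo (T.point f (Triangle.vertex j)) = v ∧
    a < t.1 j}

/-- Membership can be tested in any triangle containing the point, since gluing preserves the
coordinates at the endpoints of a side. The bound `0 ≤ a` excludes the opposite corner, whose
coordinate vanishes on the side. -/
theorem mem_star {v : S} {a : ℝ} (ha : 0 ≤ a) {f : T.Face} {t : Triangle} :
    T.homeo (T.point f t) ∈ T.star v a ↔
      ∃ j, T.homeo (T.point f (Triangle.vertex j)) = v ∧ a < t.1 j := by
  constructor
  · rintro ⟨f', t', j, h, hj, hta⟩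
    rcases Complex₂.point_eq_point (T.homeo.injective h) with h | h | ⟨⟨i, rfl⟩, i', rfl⟩
    · cases h; exact ⟨j, hj, hta⟩
    · generalize hz : (⟨f, t⟩ : Σ _ : T.Face, Triangle) = z at h
      generalize hz' : (⟨f', t'⟩ : Σ _ : T.Face, Triangle) = z' at h
      obtain ⟨g, g', i, i', hg, s, s', hs, hs', h₁, h₂⟩ := h
      cases hz
      cases hz'
      have hne : j ≠ i' := by rintro rfl; linarith
      rcases Complex₂.eq_or_eq_of_ne hne with rfl | rfl
      · exact ⟨i + 2, by rw [Complex₂.point_vertex_two hg, hj], h₂ ▸ hta⟩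
      · exact ⟨i + 1, by rw [Complex₂.point_vertex_one hg, hj], h₁ ▸ hta⟩
    · have hj' : j = i' := by
        by_contra hne
        rw [Triangle.vertex_apply_of_ne hne] at hta
        linarith
      subst hj'
      rw [Triangle.vertex_apply_self] at hta
      exact ⟨i, by rw [h, hj], by rwa [Triangle.vertex_apply_self]⟩
  · rintro ⟨j, hj, h⟩
    exact ⟨f, t, j, rfl, hj, h⟩

theorem isOpen_star (v : S) {a : ℝ} (ha : 0 ≤ a) : IsOpen (T.star v a) := by
  rw [T.isOpen_iff]
  intro f
  simp only [mem_star ha]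
  have : {t : Triangle | ∃ j, T.homeo (T.point f (Triangle.vertex j)) = v ∧ a < t.1 j} =
      ⋃ j : Fin 3, {t | T.homeo (T.point f (Triangle.vertex j)) = v ∧ a < t.1 j} := by
    ext t; simp
  rw [this]
  exact isOpen_iUnion fun j =>
    isOpen_const.and (isOpen_lt continuous_const (Triangle.continuous_apply j))

theorem mem_star_self {v : S} (hv : v ∈ P) {a : ℝ} (ha : a < 1) : v ∈ T.star v a := by
  obtain ⟨f, t, h⟩ := Complex₂.exists_eq_point (T.homeo.symm v)
  have h' : v = T.homeo (T.point f t) := by rw [← h, T.homeo.apply_symm_apply]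
  obtain ⟨i, rfl⟩ := T.mem_iff.1 (h' ▸ hv)
  exact ⟨f, _, i, h', h'.symm, by rwa [Triangle.vertex_apply_self]⟩

theorem star_mono (v : S) {a b : ℝ} (h : a ≤ b) : T.star v b ⊆ T.star v a := by
  rintro s ⟨f, t, j, hs, hj, ht⟩
  exact ⟨f, t, j, hs, hj, h.trans_lt ht⟩

/-- Each corner over `v` has its own threshold, and there are finitely many faces, so one threshold
serves all; it is raised to 1/2 to keep corner regions disjoint. -/
theorem exists_star_subset {v : S} {U : Set S} (hU : IsOpen U) (hv : v ∈ U) :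
    ∃ a, 1 / 2 ≤ a ∧ a < 1 ∧ ∀ s ∈ Pᶜ, s ∈ T.star v a → s ∈ U := by
  have key : ∀ z : T.Face × Fin 3, ∃ a < 1, T.homeo (T.point z.1 (Triangle.vertex z.2)) = v →
      ∀ t : IdealTriangle, a < t.1.1 z.2 → T.homeo (T.point z.1 t.1) ∈ U := by
    rintro ⟨f, j⟩
    by_cases h : T.homeo (T.point f (Triangle.vertex j)) = v
    · have h1 : ∀ᶠ t in 𝓝 (Triangle.vertex j), T.homeo (T.point f t) ∈ U :=
        (T.homeo.continuous.comp (Complex₂.continuous_point f)).continuousAt.preimage_mem_nhds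
          (hU.mem_nhds (by rwa [← h] at hv))
      obtain ⟨a, ha, h2⟩ := eventually_vertex_iff.1 (tendsto_comap.eventually h1)
      exact ⟨a, ha, fun _ => h2⟩
    · exact ⟨0, one_pos, fun h' => absurd h' h⟩
  choose a ha h using key
  have := T.finite
  obtain ⟨b, hb, hab⟩ : ∃ b < 1, ∀ z, a z ≤ b := by
    by_cases hn : Nonempty (T.Face × Fin 3)
    · obtain ⟨z, hz⟩ := Finite.exists_max a
      exact ⟨a z, ha z, hz⟩
    · exact ⟨0, one_pos, fun z => absurd ⟨z⟩ hn⟩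
  refine ⟨max b (1 / 2), le_max_right _ _, max_lt hb (by norm_num), ?_⟩
  rintro s hs ⟨f, t, j, rfl, hj, hta⟩
  have ht : ∀ i, t ≠ Triangle.vertex i := fun i hi => hs (T.mem_iff.2 ⟨i, hi⟩)
  exact h (f, j) hj ⟨t, ht⟩ ((hab _).trans_lt ((le_max_left _ _).trans_lt hta))

/-- The star of a puncture as an open neighbourhood. -/
def starNhd (T : IdealTriangulation S P) {v : S} (hv : v ∈ P) {a : ℝ} (h₀ : 1 / 2 ≤ a) (h₁ : a < 1) : TopologicalSpace.OpenNhdsOf v :=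
  ⟨⟨T.star v a, isOpen_star v (by linarith)⟩, mem_star_self hv h₁⟩

end IdealTriangulation

namespace LiftedTriangle

theorem exists_corner_of_mem_comp (hq : IsUniversalCovering q) (T : IdealTriangulation S P)
    {x : LiftedPuncture q} {a : ℝ} (h₀ : 1 / 2 ≤ a) (h₁ : a < 1) {y : Y}
    (hy : y ∈ x.comp (T.starNhd x.mem h₀ h₁)) :
    ∃ (τ : LiftedTriangle T q) (t : IdealTriangle) (j : Fin 3), y = τ.toFun t ∧
      T.homeo (T.point τ.face (Triangle.vertex j)) = x.pt ∧ a < t.1.1 j := by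
  obtain ⟨τ, t, rfl⟩ := exists_eq_apply hq T y
  have h := x.comp_subset _ hy
  change (q (τ.toFun t) : S) ∈ T.star x.pt a at h
  rw [τ.isLift, IdealTriangulation.mem_star (by linarith)] at h
  obtain ⟨j, hj⟩ := h
  exact ⟨τ, t, j, rfl, hj⟩

/-- A function on the corners of the lifted triangles, invariant under adjacency, only depends on
the vertex. -/
theorem IsVertex.eq_of_corner_invariant (hq : IsUniversalCovering q) {α : Type*}
    (c : LiftedTriangle T q → Fin 3 → α)
    (hc : ∀ τ i τ' i', Adjacent τ i τ' i' → c τ (i + 1) = c τ' (i' + 2))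
    {τ τ' : LiftedTriangle T q} {j j' : Fin 3} {x : LiftedPuncture q}
    (h : τ.IsVertex j x) (h' : τ'.IsVertex j' x) : c τ j = c τ' j' := by
  have hlt : (1 / 2 : ℝ) < 1 := by norm_num
  set U := T.starNhd x.mem le_rfl hlt with hU
  have near : ∀ {τ : LiftedTriangle T q} {j}, τ.IsVertex j x →
      ∃ t, τ.toFun t ∈ x.comp U ∧ 1 / 2 < t.1.1 j := fun h =>
    ((h.2 U).and (eventually_vertex_iff.2 ⟨1 / 2, hlt, fun _ ht => ht⟩)).exists
  obtain ⟨t, ht, hj⟩ := near h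
  obtain ⟨t', ht', hj'⟩ := near h'
  refine LiftedTriangle.eq_of_corner_invariant hq c hc (x.isPreconnected_comp U) (fun y hy => ?_)
    ht hj ht' hj'
  obtain ⟨σ, s, k, h1, -, h2⟩ := exists_corner_of_mem_comp hq T le_rfl hlt hy
  exact ⟨σ, s, k, h1, h2⟩

/-- Every lifted puncture is a vertex of a lifted triangle. -/
theorem exists_isVertex (hq : IsUniversalCovering q) (T : IdealTriangulation S P)
    (x : LiftedPuncture q) : ∃ (τ : LiftedTriangle T q) (j : Fin 3), τ.IsVertex j x := by
  have hlt : (1 / 2 : ℝ) < 1 := by norm_num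
  obtain ⟨y, hy⟩ := x.comp_nonempty (T.starNhd x.mem le_rfl hlt)
  obtain ⟨τ, t, j, rfl, hpt, hj⟩ := exists_corner_of_mem_comp hq T le_rfl hlt hy
  refine ⟨τ, j, isVertex_iff.2 (LiftedPuncture.ext_of_inter hpt.symm fun U U' hUU => ?_)⟩
  obtain ⟨a, ha, ha', hsub⟩ := T.exists_star_subset U.isOpen U.mem
  obtain ⟨z, hz⟩ := x.comp_nonempty (T.starNhd x.mem ha ha')
  have hsub' : ∀ {y}, y ∈ overSet q (T.star x.pt a) → y ∈ overSet q (U : Set S) := fun {y} hy =>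
    hsub _ (q y).2 hy
  -- The star is known to lie in `U` only away from the punctures, so `mono` does not compare the
  -- two components directly; both are compared with the one over the intersection.
  have hzU : z ∈ x.comp U := by
    have hmono := x.mono (T.starNhd x.mem ha ha' ⊓ U) U inf_le_right
    have hmono' := x.mono (T.starNhd x.mem ha ha' ⊓ U) (T.starNhd x.mem ha ha') inf_le_left
    obtain ⟨w, hw⟩ := x.comp_nonempty (T.starNhd x.mem ha ha' ⊓ U)
    rw [x.comp_eq_of_mem U (hmono hw)]
    rw [x.comp_eq_of_mem _ (hmono' hw)] at hz
    exact connectedComponentIn_mono _ (fun y hy => hsub' hy) hz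
  refine ⟨z, hzU, ?_⟩
  obtain ⟨σ, s, k, rfl, hpt', hk⟩ := exists_corner_of_mem_comp hq T ha ha' hz
  have hz' := x.mono (T.starNhd x.mem ha ha') (T.starNhd x.mem le_rfl hlt)
    (fun s hs => T.star_mono _ ha hs) hz
  -- The corner found deep in the star and the one found in the half star are joined inside the
  -- component over the half star, and passing to an adjacent triangle does not change the vertex.
  have hv : σ.vertex k = τ.vertex j := by
    refine LiftedTriangle.eq_of_corner_invariant hq vertex (fun _ _ _ _ h => h.vertex_eq)
      (x.isPreconnected_comp _) (fun y hy => ?_) hz' (by linarith) hy hj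
    obtain ⟨σ, s, k, h1, -, h2⟩ := exists_corner_of_mem_comp hq T le_rfl hlt hy
    exact ⟨σ, s, k, h1, h2⟩
  -- The part of `σ` beyond the threshold `a` is connected, lies over `U`, and contains both the
  -- chosen point and points close to the corner.
  have hmem : ∀ U' : TopologicalSpace.OpenNhdsOf (σ.vertex k).pt, (U : Set S) = U' →
      σ.toFun s ∈ (σ.vertex k).comp U' := by
    intro U' hUU
    obtain ⟨t₀, ht₀, hat₀⟩ := (((σ.isVertex_vertex k).2 U').and
      (eventually_vertex_iff.2 ⟨a, ha', fun t ht => ht⟩ :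
        ∀ᶠ t in comap (Subtype.val : IdealTriangle → Triangle) (𝓝 (Triangle.vertex k)),
          a < t.1.1 k)).exists
    rw [(σ.vertex k).comp_eq_of_mem U' ht₀]
    have hpre : IsPreconnected (σ.toFun '' {t | a < t.1.1 k}) :=
      (IdealTriangle.isPreconnected_corner k a).image _ σ.continuous.continuousOn
    refine hpre.subset_connectedComponentIn (mem_image_of_mem _ hat₀) ?_ (mem_image_of_mem _ hk)
    rintro _ ⟨t, ht, rfl⟩
    rw [← hUU]
    refine hsub' ?_
    change (q (σ.toFun t) : S) ∈ T.star x.pt a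
    rw [σ.isLift, IdealTriangulation.mem_star (by linarith)]
    exact ⟨k, hpt', ht⟩
  revert U'
  rw [← hv]
  exact hmem

end LiftedTriangle

end PuncturedSurface

namespace PuncturedSurface

/-! ### Developing a cocycle given on the sides of the triangles -/

namespace IdealTriangulation

variable {S : Type*} [TopologicalSpace S] {P : Set S} (T : IdealTriangulation S P)

/-- The point `z` is closer to the side `s` than to the other sides of the same face. -/
def Near (s : T.Face × Fin 3) (z : Σ _ : T.Face, IdealTriangle) : Prop :=
  z.1 = s.1 ∧ z.2.1.1 s.2 < z.2.1.1 (s.2 + 1) ∧ z.2.1.1 s.2 < z.2.1.1 (s.2 + 2)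

variable {T}

theorem isOpen_near (s : T.Face × Fin 3) : IsOpen {z | T.Near s z} := by
  rw [isOpen_sigma_iff]
  intro f
  change IsOpen {t : IdealTriangle | f = s.1 ∧ t.1.1 s.2 < t.1.1 (s.2 + 1) ∧
    t.1.1 s.2 < t.1.1 (s.2 + 2)}
  exact isOpen_const.and ((isOpen_lt (IdealTriangle.continuous_apply _)
    (IdealTriangle.continuous_apply _)).and (isOpen_lt (IdealTriangle.continuous_apply _)
    (IdealTriangle.continuous_apply _)))

theorem Near.lt {s : T.Face × Fin 3} {z : Σ _ : T.Face, IdealTriangle} (h : T.Near s z)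
    {j : Fin 3} (hj : j ≠ s.2) : z.2.1.1 s.2 < z.2.1.1 j := by
  rcases Complex₂.eq_or_eq_of_ne hj with rfl | rfl
  · exact h.2.1
  · exact h.2.2

theorem Near.unique {s s' : T.Face × Fin 3} {z : Σ _ : T.Face, IdealTriangle} (h : T.Near s z)
    (h' : T.Near s' z) : s = s' := by
  refine Prod.ext (h.1.symm.trans h'.1) ?_
  by_contra hne
  exact lt_asymm (h.lt (Ne.symm hne)) (h'.lt hne)

theorem Near.eq_of_side {s : T.Face × Fin 3} {z : Σ _ : T.Face, IdealTriangle} (h : T.Near s z)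
    {j : Fin 3} (hj : z.2.1.1 j = 0) : s = (z.1, j) := by
  refine Prod.ext h.1.symm ?_
  by_contra hne
  have := h.lt (Ne.symm hne)
  linarith [z.2.1.nonneg s.2]

theorem add_one_ne (j : Fin 3) : j + 1 ≠ j := by revert j; decide

theorem add_two_ne (j : Fin 3) : j + 2 ≠ j := by revert j; decide

theorem near_of_side {z : Σ _ : T.Face, IdealTriangle} {j : Fin 3} (hj : z.2.1.1 j = 0) :
    T.Near (z.1, j) z := by
  have pos : ∀ k, k ≠ j → z.2.1.1 j < z.2.1.1 k := fun k hk => by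
    rw [hj]
    exact lt_of_le_of_ne (z.2.1.nonneg k) fun h => hk (IdealTriangle.eq_of_side h.symm hj)
  exact ⟨rfl, pos (j + 1) (add_one_ne j), pos (j + 2) (add_two_ne j)⟩

variable (T) in
/-- Two points of the ideal triangles are glued along the sides `s` and `T.glue s`. -/
def GluedAlong (s : T.Face × Fin 3) (z z' : Σ _ : T.Face, IdealTriangle) : Prop :=
  z.1 = s.1 ∧ z.2.1.1 s.2 = 0 ∧ z'.1 = (T.glue s).1 ∧ z'.2.1.1 (T.glue s).2 = 0 ∧
    z'.2.1.1 ((T.glue s).2 + 2) = z.2.1.1 (s.2 + 1)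

theorem eq_or_gluedAlong {z z' : Σ _ : T.Face, IdealTriangle}
    (h : T.chart z.1 z.2 = T.chart z'.1 z'.2) : z = z' ∨ ∃ s, T.GluedAlong s z z' := by
  obtain ⟨f, t⟩ := z
  obtain ⟨f', t'⟩ := z'
  rcases T.chart_eq_chart h with ⟨h1, h2⟩ | ⟨i, i', hg, h1, h2, h3, -⟩
  · left
    dsimp only at h1 h2
    rw [h1, h2]
  · exact .inr ⟨(f, i), rfl, h1, by rw [hg], by rw [hg]; exact h2, by rw [hg]; exact h3⟩

theorem GluedAlong.near {s : T.Face × Fin 3} {z z' : Σ _ : T.Face, IdealTriangle}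
    (h : T.GluedAlong s z z') : T.Near s z := by
  obtain ⟨f, i⟩ := s
  obtain ⟨f', t⟩ := z
  obtain rfl : f' = f := h.1
  exact near_of_side h.2.1

theorem GluedAlong.near_glue {s : T.Face × Fin 3} {z z' : Σ _ : T.Face, IdealTriangle}
    (h : T.GluedAlong s z z') : T.Near (T.glue s) z' := by
  obtain ⟨f', t'⟩ := z'
  obtain ⟨-, -, h1, h2, -⟩ := h
  have := near_of_side (z := ⟨f', t'⟩) h2
  rwa [show (f', (T.glue s).2) = T.glue s from Prod.ext h1 rfl] at this

theorem GluedAlong.ne {s : T.Face × Fin 3} {z z' : Σ _ : T.Face, IdealTriangle}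
    (h : T.GluedAlong s z z') : z ≠ z' := by
  rintro rfl
  exact T.glue_ne s (h.near_glue.unique h.near)

/-- A point on a side is on no other side, so a second gluing must undo the first. Thus the only
nontrivial case of the cocycle identity is that of a side followed by its partner. -/
theorem GluedAlong.glue_eq {s s' : T.Face × Fin 3} {x y z : Σ _ : T.Face, IdealTriangle}
    (h : T.GluedAlong s x y) (h' : T.GluedAlong s' y z) : s' = T.glue s ∧ x = z := by
  obtain rfl := h'.near.unique h.near_glue
  refine ⟨rfl, ?_⟩
  obtain ⟨f, t⟩ := x
  obtain ⟨f', t'⟩ := z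
  obtain ⟨h1, h2, -, h3, h4⟩ := h
  obtain ⟨-, h5, h6, h7, h8⟩ := h'
  rw [T.glue_glue] at h6 h7 h8
  obtain rfl : f = f' := h1.trans h6.symm
  congr 1
  refine Subtype.ext (Triangle.ext_of_eq s.2 (h2.trans h7.symm) ?_)
  dsimp only at h2 h4 h7 h8
  linarith [t.1.sum_eq_one s.2, t'.1.sum_eq_one s.2, y.2.1.sum_eq_one (T.glue s).2]

open scoped Classical in
/-- The cocycle on the ideal triangles defined by elements attached to the sides. -/
def sideCocycle {G : Type*} [Group G] (h : T.Face × Fin 3 → G)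
    (z z' : Σ _ : T.Face, IdealTriangle) : G :=
  if hs : ∃ s, T.GluedAlong s z z' then h hs.choose else 1

section

variable {G : Type*} [Group G] (h : T.Face × Fin 3 → G)

theorem sideCocycle_eq {s : T.Face × Fin 3} {z z' : Σ _ : T.Face, IdealTriangle}
    (hs : T.GluedAlong s z z') : sideCocycle h z z' = h s := by
  have hs' : ∃ s, T.GluedAlong s z z' := ⟨s, hs⟩
  rw [sideCocycle, dif_pos hs', hs'.choose_spec.near.unique hs.near]

theorem sideCocycle_self (z : Σ _ : T.Face, IdealTriangle) : sideCocycle h z z = 1 := by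
  rw [sideCocycle, dif_neg]
  rintro ⟨s, hs⟩
  exact hs.ne rfl

-- The cocycle identity needs only that glued sides carry inverse elements. For local triviality,
-- the points nearer to a side than to the other two sides of its face, and those nearer to its
-- partner, form disjoint open sets; a function constant on each of them has the cocycle as
-- coboundary. In the interior of the faces nothing is glued.
open scoped Classical in
theorem localCocycle (hh : ∀ s, h (T.glue s) = (h s)⁻¹) :
    CocycleCovering.LocalCocycle G (fun z : Σ _ : T.Face, IdealTriangle => T.chart z.1 z.2)
      (sideCocycle h) where
  isQuotientMap := T.isQuotientMap_chart
  mul {x y z} hxy hyz := by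
    rcases eq_or_gluedAlong hxy with rfl | ⟨s, hs⟩
    · rw [sideCocycle_self, one_mul]
    · rcases eq_or_gluedAlong hyz with rfl | ⟨s', hs'⟩
      · rw [sideCocycle_self, mul_one]
      · rw [sideCocycle_eq h hs, sideCocycle_eq h hs']
        obtain ⟨rfl, rfl⟩ := hs.glue_eq hs'
        rw [hh, mul_inv_cancel, sideCocycle_self]
  coboundary z₀ := by
    by_cases hz₀ : ∃ i, z₀.2.1.1 i = 0
    · obtain ⟨i, hi⟩ := hz₀
      set s : T.Face × Fin 3 := (z₀.1, i)
      obtain ⟨κ, hκ, hκ'⟩ : ∃ κ : (Σ _ : T.Face, IdealTriangle) → G,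
          (∀ z, T.Near s z → κ z = 1) ∧ ∀ z, T.Near (T.glue s) z → κ z = h s :=
        ⟨fun z => if T.Near s z then 1 else h s, fun z hz => if_pos hz,
          fun z hz => if_neg fun h => T.glue_ne s (hz.unique h)⟩
      refine ⟨{z | T.Near s z} ∪ {z | T.Near (T.glue s) z}, κ,
        (isOpen_near _).union (isOpen_near _), .inl (near_of_side hi), ?_, ?_, ?_⟩
      · intro z z' hzz hz
        rcases eq_or_gluedAlong hzz with rfl | ⟨s', hs'⟩
        · exact hz
        · rcases hz with hz | hz
          · right
            rw [hz.unique hs'.near]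
            exact hs'.near_glue
          · left
            have := hs'.near_glue
            rw [← hz.unique hs'.near, T.glue_glue] at this
            exact this
      · rintro z (hz | hz)
        · filter_upwards [(isOpen_near s).mem_nhds hz] with z' hz'
          rw [hκ z' hz', hκ z hz]
        · filter_upwards [(isOpen_near (T.glue s)).mem_nhds hz] with z' hz'
          rw [hκ' z' hz', hκ' z hz]
      · intro z hz z' _ hzz
        rcases eq_or_gluedAlong hzz with rfl | ⟨s', hs'⟩
        · rw [sideCocycle_self, inv_mul_cancel]
        · rw [sideCocycle_eq h hs']
          rcases hz with hz | hz
          · obtain rfl := hz.unique hs'.near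
            rw [hκ' z' hs'.near_glue, hκ z hz, inv_one, one_mul]
          · obtain rfl := hz.unique hs'.near
            have h1 := hs'.near_glue
            rw [T.glue_glue] at h1
            rw [hκ' z hz, hκ z' h1, mul_one, hh]
    · refine ⟨⋂ i : Fin 3, {z | z.2.1.1 i ≠ 0}, fun _ => 1, ?_, ?_, ?_, ?_, ?_⟩
      · refine isOpen_iInter_of_finite fun i => isOpen_sigma_iff.2 fun f => ?_
        exact (isClosed_singleton.preimage (IdealTriangle.continuous_apply i)).isOpen_compl
      · simpa using hz₀
      · intro z z' hzz hz
        rcases eq_or_gluedAlong hzz with rfl | ⟨s, hs⟩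
        · exact hz
        · exact absurd hs.2.1 (mem_iInter.1 hz s.2)
      · exact fun _ _ => Eventually.of_forall fun _ => rfl
      · intro z hz z' _ hzz
        rcases eq_or_gluedAlong hzz with rfl | ⟨s, hs⟩
        · rw [sideCocycle_self, inv_mul_cancel]
        · exact absurd hs.2.1 (mem_iInter.1 hz s.2)

/-- Elements of a group attached to the sides of the faces, inverse to each other on glued sides,
come from elements attached to the lifted triangles. -/
theorem exists_development {Y : Type*} [TopologicalSpace Y] {q : Y → (Pᶜ : Set S)}
    (hq : IsUniversalCovering q) (hh : ∀ s, h (T.glue s) = (h s)⁻¹) :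
    ∃ g : LiftedTriangle T q → G,
      ∀ τ i τ' i', LiftedTriangle.Adjacent τ i τ' i' → g τ' = g τ * h (τ.face, i) := by
  have := hq.locallyPathConnectedSpace T
  have := hq.simplyConnected
  obtain ⟨u, hu, hu'⟩ := (localCocycle h hh).exists_trivialization hq.isCoveringMap.continuous
  -- The coordinate is constant along a lifted triangle, so the element read off at the barycenter
  -- can also be read off on a side, where it is compared with that of the neighbour.
  have hconst : ∀ (τ : LiftedTriangle T q) t,
      u ⟨τ.face, IdealTriangle.center⟩ (τ.toFun IdealTriangle.center) =
        u ⟨τ.face, t⟩ (τ.toFun t) := fun τ t =>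
    hu' IdealTriangle (fun t => ⟨τ.face, t⟩) τ.toFun
      (continuous_sigmaMk (ι := T.Face) (σ := fun _ => IdealTriangle) (i := τ.face)) τ.continuous
      (fun t => (τ.q_apply t).symm) _ t
  refine ⟨fun τ => u ⟨τ.face, IdealTriangle.center⟩ (τ.toFun IdealTriangle.center), ?_⟩
  intro τ i τ' i' hadj
  obtain ⟨t, t', ht, ht', htt, -⟩ := exists_glued_near_corner i i' (a := 0) one_pos
  have he := hadj.2 t t' ht ht' htt
  dsimp only
  rw [hconst τ t, hconst τ' t', ← he, ← sideCocycle_eq h (s := (τ.face, i))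
    (z := ⟨τ.face, t⟩) (z' := ⟨τ'.face, t'⟩)
    ⟨rfl, ht, by rw [hadj.1], by rw [hadj.1]; exact ht', by rw [hadj.1]; exact htt⟩]
  exact hu _ _ _ (τ.q_apply t).symm (by rw [he]; exact (τ'.q_apply t').symm)

end

end IdealTriangulation

end PuncturedSurface

namespace ComplexHyperbolic

open scoped ComplexConjugate

/-! ### The hermitian form -/

theorem herm_apply (v w : V) :
    herm v w = v 0 * conj (w 2) + v 1 * conj (w 1) + v 2 * conj (w 0) := by
  simp [herm, J, dotProduct, Matrix.mulVec, Fin.sum_univ_three]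

theorem herm_add_left (u v w : V) : herm (u + v) w = herm u w + herm v w := by
  simp only [herm_apply, Pi.add_apply]; ring

theorem herm_smul_left (a : ℂ) (v w : V) : herm (a • v) w = a * herm v w := by
  simp only [herm_apply, Pi.smul_apply, smul_eq_mul]; ring

theorem herm_add_right (u v w : V) : herm u (v + w) = herm u v + herm u w := by
  simp only [herm_apply, Pi.add_apply, map_add]; ring

theorem herm_smul_right (a : ℂ) (v w : V) : herm v (a • w) = conj a * herm v w := by
  simp only [herm_apply, Pi.smul_apply, smul_eq_mul, map_mul]; ring

theorem conj_herm (v w : V) : conj (herm v w) = herm w v := by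
  simp only [herm_apply, map_add, map_mul, Complex.conj_conj]; ring

theorem herm_zero_left (w : V) : herm 0 w = 0 := by simp [herm_apply]

theorem herm_comm_eq_zero {v w : V} : herm v w = 0 ↔ herm w v = 0 := by
  rw [← conj_herm, map_eq_zero]

theorem herm_self_eq_re (v : V) : herm v v = ((herm v v).re : ℂ) :=
  (Complex.conj_eq_iff_re.1 (conj_herm v v)).symm

/-- The hermitian form as a linear form in its first variable. -/
def hermLeft (w : V) : V →ₗ[ℂ] ℂ where
  toFun v := herm v w
  map_add' u v := herm_add_left u v w
  map_smul' a v := herm_smul_left a v w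

theorem hermLeft_apply (v w : V) : hermLeft w v = herm v w := rfl

theorem eq_zero_of_herm {v : V} (h : ∀ w, herm v w = 0) : v = 0 := by
  funext i
  have h0 := h (Pi.single 0 1)
  have h1 := h (Pi.single 1 1)
  have h2 := h (Pi.single 2 1)
  simp [herm_apply] at h0 h1 h2
  fin_cases i <;> simp_all

theorem exists_combination {b : Fin 3 → V} (hb : LinearIndependent ℂ b) (v : V) :
    ∃ a : Fin 3 → ℂ, v = a 0 • b 0 + a 1 • b 1 + a 2 • b 2 := by
  have hspan : Submodule.span ℂ (range b) = ⊤ :=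
    hb.span_eq_top_of_card_eq_finrank (by simp)
  obtain ⟨a, ha⟩ := (Submodule.mem_span_range_iff_exists_fun ℂ).1
    (hspan ▸ Submodule.mem_top : v ∈ Submodule.span ℂ (range b))
  exact ⟨a, by rw [← ha, Fin.sum_univ_three]⟩

theorem eq_of_herm_basis {b : Fin 3 → V} (hb : LinearIndependent ℂ b) {v w : V}
    (h : ∀ i, herm v (b i) = herm w (b i)) : v = w := by
  rw [← sub_eq_zero]
  refine eq_zero_of_herm fun u => ?_
  have h' : ∀ i, herm (v - w) (b i) = 0 := fun i => by
    rw [← hermLeft_apply, map_sub, hermLeft_apply, hermLeft_apply, h, sub_self]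
  obtain ⟨a, rfl⟩ := exists_combination hb u
  simp only [herm_add_right, herm_smul_right, h', mul_zero, add_zero]

theorem exists_herm_eq {b : Fin 3 → V} (hb : LinearIndependent ℂ b) (β : Fin 3 → ℂ) :
    ∃ v, ∀ i, herm v (b i) = β i := by
  let f : V →ₗ[ℂ] (Fin 3 → ℂ) := LinearMap.pi fun i => hermLeft (b i)
  have hf : Function.Injective f := by
    intro v w h
    exact eq_of_herm_basis hb fun i => congrFun h i
  obtain ⟨v, hv⟩ := LinearMap.injective_iff_surjective.1 hf β
  exact ⟨v, fun i => congrFun hv i⟩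

/-- The determinant of a Gram matrix. -/
def gramDet (c₁ c₂ c₃ : V) : ℂ :=
  herm c₁ c₁ * (herm c₂ c₂ * herm c₃ c₃ - herm c₂ c₃ * herm c₃ c₂)
    - herm c₁ c₂ * (herm c₂ c₁ * herm c₃ c₃ - herm c₂ c₃ * herm c₃ c₁)
    + herm c₁ c₃ * (herm c₂ c₁ * herm c₃ c₂ - herm c₂ c₂ * herm c₃ c₁)

/-- The Gram matrix is `C J Cᴴ`, with the vectors as rows of `C`, and `J` has determinant -1. -/
theorem gramDet_eq (c : Fin 3 → V) :
    gramDet (c 0) (c 1) (c 2) = -((Complex.normSq (Matrix.of c).det : ℝ) : ℂ) := by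
  have h : (Matrix.of fun i j => herm (c i) (c j)) =
      Matrix.of c * J * (Matrix.of c)ᴴ := by
    ext i j
    simp [Matrix.mul_apply, Fin.sum_univ_three, herm_apply, J]
    ring
  have h1 := congrArg Matrix.det h
  have hJ : J.det = -1 := by simp [J, Matrix.det_fin_three]
  rw [Matrix.det_mul, Matrix.det_mul, Matrix.det_conjTranspose, hJ, Matrix.det_fin_three] at h1
  rw [← Complex.mul_conj]
  simp only [Matrix.of_apply] at h1
  rw [gramDet]
  simp only [Complex.star_def] at h1
  linear_combination h1

theorem gramDet_re_neg {c : Fin 3 → V} (hc : LinearIndependent ℂ c) :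
    (gramDet (c 0) (c 1) (c 2)).re < 0 := by
  rw [gramDet_eq]
  have h : IsUnit (Matrix.of c) := Matrix.linearIndependent_rows_iff_isUnit.1 hc
  have h' := (Matrix.isUnit_iff_isUnit_det _).1 h
  simpa using Complex.normSq_pos.2 h'.ne_zero

theorem linearIndependent_of_gramDet_ne {c : Fin 3 → V} (h : gramDet (c 0) (c 1) (c 2) ≠ 0) :
    LinearIndependent ℂ c := by
  have : IsUnit (Matrix.of c) := by
    rw [Matrix.isUnit_iff_isUnit_det, isUnit_iff_ne_zero]
    intro h'
    rw [gramDet_eq, h'] at h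
    simp at h
  exact Matrix.linearIndependent_rows_iff_isUnit.2 this

/-- The form is determined by the Gram matrix of a basis. -/
theorem gramDet_mul_herm {c : Fin 3 → V} (hc : LinearIndependent ℂ c) (p r : V) :
    gramDet (c 0) (c 1) (c 2) * herm p r =
      herm p (c 0) * ((herm (c 1) (c 1) * herm (c 2) (c 2) - herm (c 1) (c 2) * herm (c 2) (c 1))
          * herm (c 0) r
        + (herm (c 0) (c 2) * herm (c 2) (c 1) - herm (c 0) (c 1) * herm (c 2) (c 2))
          * herm (c 1) r
        + (herm (c 0) (c 1) * herm (c 1) (c 2) - herm (c 0) (c 2) * herm (c 1) (c 1))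
          * herm (c 2) r)
      + herm p (c 1) * ((herm (c 1) (c 2) * herm (c 2) (c 0) - herm (c 1) (c 0) * herm (c 2) (c 2))
          * herm (c 0) r
        + (herm (c 0) (c 0) * herm (c 2) (c 2) - herm (c 0) (c 2) * herm (c 2) (c 0))
          * herm (c 1) r
        + (herm (c 0) (c 2) * herm (c 1) (c 0) - herm (c 0) (c 0) * herm (c 1) (c 2))
          * herm (c 2) r)
      + herm p (c 2) * ((herm (c 1) (c 0) * herm (c 2) (c 1) - herm (c 1) (c 1) * herm (c 2) (c 0))
          * herm (c 0) r
        + (herm (c 0) (c 1) * herm (c 2) (c 0) - herm (c 0) (c 0) * herm (c 2) (c 1))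
          * herm (c 1) r
        + (herm (c 0) (c 0) * herm (c 1) (c 1) - herm (c 0) (c 1) * herm (c 1) (c 0))
          * herm (c 2) r) := by
  obtain ⟨a, rfl⟩ := exists_combination hc p
  simp only [herm_add_left, herm_smul_left, gramDet]
  ring

/-- A vector orthogonal to a negative vector is positive. -/
theorem herm_pos_of_orthogonal {v c : V} (hv : (herm v v).re < 0) (hc : c ≠ 0)
    (h : herm v c = 0) : 0 < (herm c c).re := by
  -- Diagonalization of the form: `u 0 + u 2` and `u 1` span the positive part, `u 0 - u 2` the
  -- negative part.
  have key : ∀ u : V, (herm u u).re =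
      (Complex.normSq (u 0 + u 2) - Complex.normSq (u 0 - u 2)) / 2 + Complex.normSq (u 1) := by
    intro u
    simp [herm_apply, Complex.normSq_apply]
    ring
  have hs : (v 0 - v 2) * conj (c 0 - c 2) =
      (v 0 + v 2) * conj (c 0 + c 2) + 2 * (v 1 * conj (c 1)) := by
    rw [herm_apply] at h
    simp only [map_add, map_sub]
    linear_combination (-2) * h
  rw [key] at hv ⊢
  by_contra hcon
  push Not at hcon
  have n1 := congrArg Complex.normSq hs
  rw [Complex.normSq_mul, Complex.normSq_conj] at n1
  -- Cauchy-Schwarz on the positive part; the defect is given by Lagrange's identity.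
  have cs : Complex.normSq ((v 0 + v 2) * conj (c 0 + c 2) + 2 * (v 1 * conj (c 1))) ≤
      (Complex.normSq (v 0 + v 2) + 2 * Complex.normSq (v 1)) *
        (Complex.normSq (c 0 + c 2) + 2 * Complex.normSq (c 1)) := by
    have e : (Complex.normSq (v 0 + v 2) + 2 * Complex.normSq (v 1)) *
        (Complex.normSq (c 0 + c 2) + 2 * Complex.normSq (c 1)) -
        Complex.normSq ((v 0 + v 2) * conj (c 0 + c 2) + 2 * (v 1 * conj (c 1))) =
        2 * Complex.normSq ((v 0 + v 2) * c 1 - v 1 * (c 0 + c 2)) := by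
      simp only [Complex.normSq_apply, Complex.add_re, Complex.add_im, Complex.mul_re,
        Complex.mul_im, Complex.conj_re, Complex.conj_im, Complex.sub_re, Complex.sub_im,
        Complex.re_ofNat, Complex.im_ofNat]
      ring
    linarith [Complex.normSq_nonneg ((v 0 + v 2) * c 1 - v 1 * (c 0 + c 2))]
  have p1 := Complex.normSq_nonneg (v 0 + v 2)
  have p2 := Complex.normSq_nonneg (v 1)
  have p3 := Complex.normSq_nonneg (c 0 + c 2)
  have p4 := Complex.normSq_nonneg (c 1)
  have p5 := Complex.normSq_nonneg (c 0 - c 2)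
  have hpos : 0 < Complex.normSq (c 0 - c 2) := by
    rcases p5.lt_or_eq with h | h
    · exact h
    · exfalso
      have h1 : Complex.normSq (c 1) = 0 := by linarith
      have h2 : Complex.normSq (c 0 + c 2) = 0 := by linarith
      rw [Complex.normSq_eq_zero] at h1 h2
      have h3 := Complex.normSq_eq_zero.1 h.symm
      apply hc
      have h4 : c 0 = 0 := by linear_combination (h2 + h3) / 2
      have h5 : c 2 = 0 := by linear_combination (h2 - h3) / 2
      funext i
      fin_cases i <;> simp [h1, h4, h5]
  nlinarith

/-- The orthogonal complement of a vector, as a subspace. -/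
def orth (c : V) : Submodule ℂ V := LinearMap.ker (hermLeft c)

theorem mem_orth {c v : V} : v ∈ orth c ↔ herm v c = 0 := LinearMap.mem_ker

theorem finrank_orth {c : V} (hc : c ≠ 0) : Module.finrank ℂ (orth c) = 2 := by
  have hne : hermLeft c ≠ 0 := by
    intro h
    apply hc
    refine eq_zero_of_herm fun w => herm_comm_eq_zero.1 ?_
    exact LinearMap.congr_fun h w
  have h1 := LinearMap.finrank_range_add_finrank_ker (hermLeft c)
  have h2 : Module.finrank ℂ (LinearMap.range (hermLeft c)) = 1 := by
    rw [LinearMap.range_eq_top.2 (LinearMap.surjective hne)]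
    simp
  rw [h2, Module.finrank_fin_fun] at h1
  change 1 + Module.finrank ℂ (orth c) = 3 at h1
  omega

/-! ### Vectors representing a flag -/

namespace Flag

/-- The vectors `c` and `p` are a polar vector and a boundary vector of the flag `F`. -/
structure Rep (F : Flag) (c p : V) : Prop where
  polar_ne : c ≠ 0
  polar_orth : ∀ w ∈ F.line, herm w c = 0
  lift_ne : p ≠ 0
  lift_mem : p ∈ F.pt

theorem rep (F : Flag) : F.Rep F.polar F.lift :=
  ⟨F.exists_polar.choose_spec.1, F.exists_polar.choose_spec.2, F.exists_lift.choose_spec.1,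
    F.exists_lift.choose_spec.2⟩

variable {F F' : Flag} {c p c' p' : V}

namespace Rep

theorem line_eq (h : F.Rep c p) : F.line = orth c := by
  refine Submodule.eq_of_le_of_finrank_eq (fun w hw => mem_orth.2 (h.polar_orth w hw)) ?_
  rw [F.isComplexLine.1, finrank_orth h.polar_ne]

theorem pt_eq (h : F.Rep c p) : F.pt = Submodule.span ℂ {p} := by
  refine (Submodule.eq_of_le_of_finrank_eq ?_ ?_).symm
  · rw [Submodule.span_singleton_le_iff_mem]; exact h.lift_mem
  · rw [F.isBoundaryPoint.1, finrank_span_singleton h.lift_ne]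

theorem herm_lift_lift (h : F.Rep c p) : herm p p = 0 := F.isBoundaryPoint.2 p h.lift_mem

theorem herm_lift_polar (h : F.Rep c p) : herm p c = 0 :=
  h.polar_orth p (F.pt_le_line h.lift_mem)

theorem herm_polar_lift (h : F.Rep c p) : herm c p = 0 := herm_comm_eq_zero.1 h.herm_lift_polar

theorem polar_pos (h : F.Rep c p) : 0 < (herm c c).re := by
  obtain ⟨v, hv, hneg⟩ := F.isComplexLine.2
  exact herm_pos_of_orthogonal hneg h.polar_ne (h.polar_orth v hv)

theorem smul (h : F.Rep c p) {a b : ℂ} (ha : a ≠ 0) (hb : b ≠ 0) : F.Rep (a • c) (b • p) where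
  polar_ne := smul_ne_zero ha h.polar_ne
  polar_orth w hw := by rw [herm_smul_right, h.polar_orth w hw, mul_zero]
  lift_ne := smul_ne_zero hb h.lift_ne
  lift_mem := F.pt.smul_mem b h.lift_mem

/-- Subtracting from `c'` its projection to `c` leaves a vector of the line that is orthogonal to
the line, hence isotropic; as it is orthogonal to a negative vector, it must vanish. -/
theorem unique (h : F.Rep c p) (h' : F.Rep c' p') :
    ∃ a b : ℂ, a ≠ 0 ∧ b ≠ 0 ∧ c' = a • c ∧ p' = b • p := by
  have hp : p' ∈ Submodule.span ℂ {p} := h.pt_eq ▸ h'.lift_mem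
  obtain ⟨b, rfl⟩ := Submodule.mem_span_singleton.1 hp
  have hpos := h.polar_pos
  have hne : herm c c ≠ 0 := fun h0 => by rw [h0] at hpos; simp at hpos
  set a := herm c' c / herm c c with ha
  have hzero : c' - a • c = 0 := by
    have h1 : herm (c' - a • c) c = 0 := by
      rw [← hermLeft_apply, map_sub, map_smul, hermLeft_apply, hermLeft_apply, ha, smul_eq_mul,
        div_mul_cancel₀ _ hne, sub_self]
    have h2 : c' - a • c ∈ F.line := by rw [h.line_eq]; exact mem_orth.2 h1
    have hself : herm (c' - a • c) (c' - a • c) = 0 := by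
      have e1 := h.polar_orth _ h2
      have e2 := h'.polar_orth _ h2
      rw [sub_eq_add_neg, ← neg_smul, herm_add_right, herm_smul_right]
      rw [sub_eq_add_neg, ← neg_smul] at e1 e2
      rw [e1, e2, mul_zero, add_zero]
    by_contra hne'
    obtain ⟨v, hv, hneg⟩ := F.isComplexLine.2
    have hv' : herm v (c' - a • c) = 0 := by
      rw [sub_eq_add_neg, ← neg_smul, herm_add_right, herm_smul_right, h.polar_orth v hv,
        h'.polar_orth v hv, mul_zero, add_zero]
    have := herm_pos_of_orthogonal hneg hne' hv'
    rw [hself] at this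
    simp at this
  have hc' : c' = a • c := sub_eq_zero.1 hzero
  refine ⟨a, b, ?_, ?_, hc', rfl⟩
  · intro h0
    exact h'.polar_ne (by rw [hc', h0, zero_smul])
  · intro h0
    exact h'.lift_ne (by rw [h0, zero_smul])

theorem flag_eq (h : F.Rep c p) (h' : F'.Rep c p) : F = F' :=
  Flag.ext (h.line_eq.trans h'.line_eq.symm) (h.pt_eq.trans h'.pt_eq.symm)

theorem map (h : F.Rep c p) (A : U21) : (A • F).Rep (A.1 c) (A.1 p) where
  polar_ne := by simpa using h.polar_ne
  polar_orth := by
    rintro _ ⟨w, hw, rfl⟩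
    exact (A.2 w c).trans (h.polar_orth w hw)
  lift_ne := by simpa using h.lift_ne
  lift_mem := ⟨p, h.lift_mem, rfl⟩

end Rep

theorem exists_rep {c p : V} (hc : 0 < (herm c c).re) (hp : p ≠ 0) (hpp : herm p p = 0)
    (hpc : herm p c = 0) : ∃ F : Flag, F.Rep c p := by
  have hc0 : c ≠ 0 := by rintro rfl; rw [herm_zero_left] at hc; simp at hc
  have hcc : herm c c ≠ 0 := fun h0 => by rw [h0] at hc; simp at hc
  have hneg : ∃ v ∈ orth c, (herm v v).re < 0 := by
    obtain ⟨u, hu⟩ : ∃ u, herm p u ≠ 0 := by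
      by_contra h
      push Not at h
      exact hp (eq_zero_of_herm h)
    set w := u + (-(herm u c / herm c c)) • c with hw
    have hwc : herm w c = 0 := by
      rw [hw, herm_add_left, herm_smul_left, neg_mul, div_mul_cancel₀ _ hcc, add_neg_cancel]
    have hpw : herm p w ≠ 0 := by
      rw [hw, herm_add_right, herm_smul_right, hpc, mul_zero, add_zero]
      exact hu
    set z := herm p w with hz
    -- Adding a multiple of the isotropic vector `p` changes `herm w w` by twice the real part of `s
    -- * z`; this `s` brings it to -1.
    set s : ℂ := -(((herm w w).re + 1 : ℝ) : ℂ) * conj z / (2 * (Complex.normSq z : ℂ)) with hs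
    refine ⟨w + s • p, mem_orth.2 ?_, ?_⟩
    · rw [herm_add_left, herm_smul_left, hwc, hpc, mul_zero, add_zero]
    · have hn : (Complex.normSq z : ℂ) ≠ 0 := by
        exact_mod_cast (Complex.normSq_pos.2 hpw).ne'
      have hsz : s * z = -(((herm w w).re + 1) / 2 : ℝ) := by
        rw [hs, div_mul_eq_mul_div, div_eq_iff (mul_ne_zero two_ne_zero hn), mul_assoc,
          mul_comm (conj z), Complex.mul_conj]
        push_cast
        ring
      have hwp : herm w p = conj z := (conj_herm p w).symm
      have hsz' : conj s * conj z = -(((herm w w).re + 1) / 2 : ℝ) := by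
        rw [← map_mul, hsz, map_neg, Complex.conj_ofReal]
      have : herm (w + s • p) (w + s • p) = herm w w + s * z + conj s * conj z := by
        simp only [herm_add_left, herm_add_right, herm_smul_left, herm_smul_right, hpp, hwp, ← hz]
        ring
      rw [this, hsz, hsz']
      simp only [Complex.add_re, Complex.neg_re, Complex.ofReal_re]
      linarith
  refine ⟨⟨orth c, Submodule.span ℂ {p}, ⟨finrank_orth hc0, hneg⟩,
    ⟨finrank_span_singleton hp, ?_⟩, ?_⟩, ⟨hc0, fun w hw => mem_orth.1 hw, hp,
      Submodule.mem_span_singleton_self p⟩⟩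
  · intro v hv
    obtain ⟨a, rfl⟩ := Submodule.mem_span_singleton.1 hv
    rw [herm_smul_left, herm_smul_right, hpp, mul_zero, mul_zero]
  · rw [Submodule.span_singleton_le_iff_mem]
    exact mem_orth.2 hpc

end Flag

/-- Two bases with the same Gram matrix are related by an isometry. -/
theorem exists_isometry {b b' : Fin 3 → V} (hb : LinearIndependent ℂ b)
    (h : ∀ i j, herm (b i) (b j) = herm (b' i) (b' j)) : ∃ A : U21, ∀ i, A.1 (b i) = b' i := by
  have hb' : LinearIndependent ℂ b' := by
    refine linearIndependent_of_gramDet_ne ?_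
    have : gramDet (b' 0) (b' 1) (b' 2) = gramDet (b 0) (b 1) (b 2) := by
      simp only [gramDet, h]
    rw [this]
    intro h0
    have := gramDet_re_neg hb
    rw [h0] at this
    simp at this
  let B := basisOfLinearIndependentOfCardEqFinrank hb (by simp)
  let B' := basisOfLinearIndependentOfCardEqFinrank hb' (by simp)
  have hB : ∀ i, B i = b i := fun i => by simp [B]
  have hB' : ∀ i, B' i = b' i := fun i => by simp [B']
  let A : V ≃ₗ[ℂ] V := B.equiv B' (Equiv.refl _)
  have hA : ∀ i, A (b i) = b' i := fun i => by
    rw [← hB, ← hB']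
    exact B.equiv_apply i B' (Equiv.refl _)
  refine ⟨⟨A, fun v w => ?_⟩, hA⟩
  obtain ⟨x, rfl⟩ := exists_combination hb v
  obtain ⟨y, rfl⟩ := exists_combination hb w
  simp only [map_add, map_smul, hA, herm_add_left, herm_add_right, herm_smul_left,
    herm_smul_right, h]

end ComplexHyperbolic

namespace ComplexHyperbolic

open scoped ComplexConjugate

/-! ### The invariants in terms of representing vectors -/

/-- The invariant of a pair of flags which together with `phi` determines the pair. -/
def pairInv (F₁ F₂ : Flag) : ℂ :=
  (herm F₁.lift F₂.lift * herm F₁.polar F₂.polar) /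
    (herm F₁.lift F₂.polar * herm F₁.polar F₂.lift)

section

variable {F₁ F₂ F₃ : Flag} {c₁ c₂ c₃ p₁ p₂ p₃ : V}

/-- All scalars cancel, so the invariant can be computed from any representing vectors; the same
holds for the three lemmas that follow. -/
theorem phi_eq (h₁ : F₁.Rep c₁ p₁) (h₂ : F₂.Rep c₂ p₂) :
    phi F₁ F₂ = ‖herm c₁ c₂‖ ^ 2 / ((herm c₁ c₁).re * (herm c₂ c₂).re) := by
  obtain ⟨a₁, -, ha₁, -, e₁, -⟩ := h₁.unique F₁.rep
  obtain ⟨a₂, -, ha₂, -, e₂, -⟩ := h₂.unique F₂.rep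
  have n₁ : (herm (a₁ • c₁) (a₁ • c₁)).re = ‖a₁‖ ^ 2 * (herm c₁ c₁).re := by
    rw [herm_smul_left, herm_smul_right, ← mul_assoc, Complex.mul_conj, Complex.re_ofReal_mul,
      Complex.normSq_eq_norm_sq]
  have n₂ : (herm (a₂ • c₂) (a₂ • c₂)).re = ‖a₂‖ ^ 2 * (herm c₂ c₂).re := by
    rw [herm_smul_left, herm_smul_right, ← mul_assoc, Complex.mul_conj, Complex.re_ofReal_mul,
      Complex.normSq_eq_norm_sq]
  have n₃ : ‖herm (a₁ • c₁) (a₂ • c₂)‖ = ‖a₁‖ * ‖a₂‖ * ‖herm c₁ c₂‖ := by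
    rw [herm_smul_left, herm_smul_right, norm_mul, norm_mul, RCLike.norm_conj, mul_assoc]
  rw [phi, e₁, e₂, n₁, n₂, n₃]
  rw [← mul_div_mul_left (‖herm c₁ c₂‖ ^ 2) _
    (mul_ne_zero (pow_ne_zero 2 (norm_ne_zero_iff.2 ha₁)) (pow_ne_zero 2 (norm_ne_zero_iff.2 ha₂)))]
  congr 1 <;> ring

theorem Phi_eq (h₁ : F₁.Rep c₁ p₁) (h₂ : F₂.Rep c₂ p₂) (h₃ : F₃.Rep c₃ p₃) :
    Phi F₁ F₂ F₃ = (herm c₁ c₂ * herm c₂ c₃ * herm c₃ c₁) /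
      (herm c₁ c₁ * herm c₂ c₂ * herm c₃ c₃) := by
  obtain ⟨a₁, -, ha₁, -, e₁, -⟩ := h₁.unique F₁.rep
  obtain ⟨a₂, -, ha₂, -, e₂, -⟩ := h₂.unique F₂.rep
  obtain ⟨a₃, -, ha₃, -, e₃, -⟩ := h₃.unique F₃.rep
  rw [Phi, e₁, e₂, e₃]
  have hk : a₁ * conj a₁ * (a₂ * conj a₂) * (a₃ * conj a₃) ≠ 0 := by simp [ha₁, ha₂, ha₃]
  rw [← mul_div_mul_left (herm c₁ c₂ * herm c₂ c₃ * herm c₃ c₁) _ hk]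
  simp only [herm_smul_left, herm_smul_right]
  congr 1 <;> ring

theorem delta_eq (h₁ : F₁.Rep c₁ p₁) (h₂ : F₂.Rep c₂ p₂) (h₃ : F₃.Rep c₃ p₃) :
    delta F₁ F₂ F₃ = (herm c₂ c₃ * herm p₁ c₂) / (herm c₂ c₂ * herm p₁ c₃) := by
  obtain ⟨-, b₁, -, hb₁, -, e₁⟩ := h₁.unique F₁.rep
  obtain ⟨a₂, -, ha₂, -, e₂, -⟩ := h₂.unique F₂.rep
  obtain ⟨a₃, -, ha₃, -, e₃, -⟩ := h₃.unique F₃.rep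
  rw [delta, e₁, e₂, e₃]
  have hk : a₂ * conj a₂ * b₁ * conj a₃ ≠ 0 := by simp [hb₁, ha₂, ha₃]
  rw [← mul_div_mul_left (herm c₂ c₃ * herm p₁ c₂) _ hk]
  simp only [herm_smul_left, herm_smul_right]
  congr 1 <;> ring

theorem pairInv_eq (h₁ : F₁.Rep c₁ p₁) (h₂ : F₂.Rep c₂ p₂) :
    pairInv F₁ F₂ = (herm p₁ p₂ * herm c₁ c₂) / (herm p₁ c₂ * herm c₁ p₂) := by
  obtain ⟨a₁, b₁, ha₁, hb₁, e₁, f₁⟩ := h₁.unique F₁.rep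
  obtain ⟨a₂, b₂, ha₂, hb₂, e₂, f₂⟩ := h₂.unique F₂.rep
  rw [pairInv, e₁, e₂, f₁, f₂]
  have hk : a₁ * conj a₂ * b₁ * conj b₂ ≠ 0 := by simp [hb₁, ha₂, ha₁, hb₂]
  rw [← mul_div_mul_left (herm p₁ p₂ * herm c₁ c₂) _ hk]
  simp only [herm_smul_left, herm_smul_right]
  congr 1 <;> ring

theorem generic₂_iff (h₁ : F₁.Rep c₁ p₁) (h₂ : F₂.Rep c₂ p₂) :
    Generic₂ F₁ F₂ ↔ herm p₁ c₂ ≠ 0 ∧ herm p₂ c₁ ≠ 0 ∧ herm c₁ c₂ ≠ 0 := by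
  obtain ⟨a₁, -, ha₁, -, e₁, -⟩ := h₁.unique F₁.rep
  obtain ⟨a₂, -, ha₂, -, e₂, -⟩ := h₂.unique F₂.rep
  rw [Generic₂, h₁.pt_eq, h₂.pt_eq, Submodule.span_singleton_le_iff_mem,
    Submodule.span_singleton_le_iff_mem, h₁.line_eq, h₂.line_eq, mem_orth, mem_orth, e₁, e₂,
    herm_smul_left, herm_smul_right]
  simp [ha₁, ha₂]

theorem Generic₂.symm (h : Generic₂ F₁ F₂) : Generic₂ F₂ F₁ :=
  ⟨h.2.1, h.1, fun h0 => h.2.2 (herm_comm_eq_zero.1 h0)⟩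

theorem phi_comm (F₁ F₂ : Flag) : phi F₁ F₂ = phi F₂ F₁ := by
  rw [phi, phi, ← conj_herm F₂.polar F₁.polar, RCLike.norm_conj, mul_comm (herm F₁.polar _).re]

theorem phi_smul (A : PU21) (F₁ F₂ : Flag) : phi (A • F₁) (A • F₂) = phi F₁ F₂ := by
  induction A using QuotientGroup.induction_on with
  | H A =>
    change phi (A • F₁) (A • F₂) = _
    rw [phi_eq (F₁.rep.map A) (F₂.rep.map A), phi_eq F₁.rep F₂.rep]
    simp only [A.2 _ _]

theorem Phi_smul (A : PU21) (F₁ F₂ F₃ : Flag) :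
    Phi (A • F₁) (A • F₂) (A • F₃) = Phi F₁ F₂ F₃ := by
  induction A using QuotientGroup.induction_on with
  | H A =>
    change Phi (A • F₁) (A • F₂) (A • F₃) = _
    rw [Phi_eq (F₁.rep.map A) (F₂.rep.map A) (F₃.rep.map A), Phi_eq F₁.rep F₂.rep F₃.rep]
    simp only [A.2 _ _]

theorem delta_smul (A : PU21) (F₁ F₂ F₃ : Flag) :
    delta (A • F₁) (A • F₂) (A • F₃) = delta F₁ F₂ F₃ := by
  induction A using QuotientGroup.induction_on with
  | H A =>
    change delta (A • F₁) (A • F₂) (A • F₃) = _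
    rw [delta_eq (F₁.rep.map A) (F₂.rep.map A) (F₃.rep.map A), delta_eq F₁.rep F₂.rep F₃.rep]
    simp only [A.2 _ _]

theorem Generic₂.smul (h : Generic₂ F₁ F₂) (A : PU21) : Generic₂ (A • F₁) (A • F₂) := by
  induction A using QuotientGroup.induction_on with
  | H A =>
    refine (generic₂_iff (F₁.rep.map A) (F₂.rep.map A)).2 ?_
    simp only [A.2 _ _]
    exact (generic₂_iff F₁.rep F₂.rep).1 h

end

section

variable {F : Fin 3 → Flag} {c p : Fin 3 → V}

theorem linearIndependent_polar_iff (h : ∀ i, (F i).Rep (c i) (p i)) :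
    LinearIndependent ℂ (fun i => (F i).polar) ↔ LinearIndependent ℂ c := by
  choose a b ha hb e f using fun i => (h i).unique (F i).rep
  have : (fun i => (F i).polar) = (fun i => Units.mk0 (a i) (ha i)) • c :=
    funext fun i => e i
  rw [this]
  exact LinearIndependent.units_smul_iff c (fun i => Units.mk0 (a i) (ha i))

/-- Three flags are in general position: symmetric formulation. -/
theorem generic₃_iff : Generic₃ (F 0) (F 1) (F 2) ↔
    (∀ i j, i ≠ j → Generic₂ (F i) (F j)) ∧ LinearIndependent ℂ (fun i => (F i).polar) := by
  have e : ![(F 0).polar, (F 1).polar, (F 2).polar] = fun i => (F i).polar := by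
    funext i; fin_cases i <;> rfl
  rw [Generic₃, e]
  constructor
  · rintro ⟨h1, h2, h3, h4⟩
    refine ⟨fun i j hij => ?_, h4⟩
    fin_cases i <;> fin_cases j
    exacts [absurd rfl hij, h1, h3.symm, h1.symm, absurd rfl hij, h2, h3, h2.symm, absurd rfl hij]
  · rintro ⟨h1, h2⟩
    exact ⟨h1 _ _ (by decide), h1 _ _ (by decide), h1 _ _ (by decide), h2⟩

theorem Generic₃.perm (h : Generic₃ (F 0) (F 1) (F 2)) (π : Equiv.Perm (Fin 3)) :
    Generic₃ (F (π 0)) (F (π 1)) (F (π 2)) := by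
  obtain ⟨h1, h2⟩ := generic₃_iff.1 h
  exact (generic₃_iff (F := fun i => F (π i))).2
    ⟨fun i j hij => h1 _ _ (π.injective.ne hij), h2.comp π π.injective⟩

theorem Generic₃.smul (h : Generic₃ (F 0) (F 1) (F 2)) (A : PU21) :
    Generic₃ (A • F 0) (A • F 1) (A • F 2) := by
  obtain ⟨h1, h2⟩ := generic₃_iff.1 h
  refine (generic₃_iff (F := fun i => A • F i)).2 ⟨fun i j hij => (h1 i j hij).smul A, ?_⟩
  induction A using QuotientGroup.induction_on with
  | H A =>
    refine (linearIndependent_polar_iff (F := fun i => A • F i)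
      (fun i => (F i).rep.map A)).2 ?_
    exact h2.map' A.1.toLinearMap A.1.ker

end

/-! ### Normalized representing vectors -/

theorem Flag.exists_unit_rep (F : Flag) : ∃ c p, F.Rep c p ∧ herm c c = 1 := by
  have hpos := F.rep.polar_pos
  set r := (herm F.polar F.polar).re with hr
  have hs : (Real.sqrt r : ℂ) ≠ 0 := by exact_mod_cast (Real.sqrt_pos.2 hpos).ne'
  refine ⟨(Real.sqrt r : ℂ)⁻¹ • F.polar, (1 : ℂ) • F.lift,
    F.rep.smul (inv_ne_zero hs) one_ne_zero, ?_⟩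
  rw [herm_smul_left, herm_smul_right, herm_self_eq_re, ← hr, map_inv₀, Complex.conj_ofReal]
  have : (r : ℂ) = Real.sqrt r * Real.sqrt r := by
    exact_mod_cast (Real.mul_self_sqrt hpos.le).symm
  rw [this]
  field_simp

theorem exists_phase {h : ℂ} (hh : h ≠ 0) : ∃ a : ℂ, a * conj a = 1 ∧ conj a * h = ‖h‖ := by
  have hn : (‖h‖ : ℂ) ≠ 0 := by exact_mod_cast norm_ne_zero_iff.2 hh
  have hc : conj h ≠ 0 := (map_ne_zero _).2 hh
  have hm : h * conj h = (‖h‖ : ℂ) ^ 2 := by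
    rw [Complex.mul_conj, Complex.normSq_eq_norm_sq]; push_cast; rfl
  refine ⟨conj (‖h‖ / h), ?_, ?_⟩
  · rw [Complex.conj_conj, map_div₀, Complex.conj_ofReal, div_mul_div_comm, mul_comm (conj h), hm]
    field_simp
  · rw [Complex.conj_conj, div_mul_cancel₀ _ hh]

section

variable {F₁ F₂ : Flag} {c₁ c₂ p₁ p₂ : V}

theorem phi_eq_of_unit (h₁ : F₁.Rep c₁ p₁) (h₂ : F₂.Rep c₂ p₂) (u₁ : herm c₁ c₁ = 1)
    (u₂ : herm c₂ c₂ = 1) : phi F₁ F₂ = ‖herm c₁ c₂‖ ^ 2 := by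
  rw [phi_eq h₁ h₂, u₁, u₂]; simp

theorem phi_coe_eq_of_unit (h₁ : F₁.Rep c₁ p₁) (h₂ : F₂.Rep c₂ p₂) (u₁ : herm c₁ c₁ = 1)
    (u₂ : herm c₂ c₂ = 1) : (phi F₁ F₂ : ℂ) = herm c₁ c₂ * herm c₂ c₁ := by
  rw [phi_eq_of_unit h₁ h₂ u₁ u₂, ← conj_herm c₁ c₂, Complex.mul_conj,
    Complex.normSq_eq_norm_sq]

theorem exists_unit_rep_real (F₂ : Flag) (h₁ : F₁.Rep c₁ p₁)
    (u₁ : herm c₁ c₁ = 1) (hg : Generic₂ F₁ F₂) :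
    ∃ c₂ p₂, F₂.Rep c₂ p₂ ∧ herm c₂ c₂ = 1 ∧ herm c₁ c₂ = Real.sqrt (phi F₁ F₂) := by
  obtain ⟨c₂, p₂, h₂, u₂⟩ := F₂.exists_unit_rep
  have hne := ((generic₂_iff h₁ h₂).1 hg).2.2
  obtain ⟨a, ha, ha'⟩ := exists_phase hne
  have ha0 : a ≠ 0 := by rintro rfl; simp at ha
  refine ⟨a • c₂, (1 : ℂ) • p₂, h₂.smul ha0 one_ne_zero, ?_, ?_⟩
  · rw [herm_smul_left, herm_smul_right, u₂, mul_one, ha]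
  · rw [herm_smul_right, ha', phi_eq_of_unit h₁ h₂ u₁ u₂, Real.sqrt_sq (norm_nonneg _)]

theorem Flag.Rep.normalize_lift {F : Flag} {c p d : V} (h : F.Rep c p) (hd : herm p d ≠ 0) :
    ∃ p', F.Rep c p' ∧ herm p' d = 1 := by
  have := h.smul one_ne_zero (inv_ne_zero hd)
  rw [one_smul] at this
  exact ⟨_, this, by rw [herm_smul_left, inv_mul_cancel₀ hd]⟩

theorem phi_pos (h : Generic₂ F₁ F₂) : 0 < phi F₁ F₂ := by
  obtain ⟨c₁, p₁, h₁, u₁⟩ := F₁.exists_unit_rep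
  obtain ⟨c₂, p₂, h₂, u₂⟩ := F₂.exists_unit_rep
  rw [phi_eq_of_unit h₁ h₂ u₁ u₂]
  exact pow_pos (norm_pos_iff.2 ((generic₂_iff h₁ h₂).1 h).2.2) 2

theorem Generic₂.exists_normalized (h : Generic₂ F₁ F₂) :
    ∃ c₁ p₁ c₂ p₂, F₁.Rep c₁ p₁ ∧ F₂.Rep c₂ p₂ ∧ herm c₁ c₁ = 1 ∧ herm c₂ c₂ = 1 ∧
      herm c₁ c₂ = Real.sqrt (phi F₁ F₂) ∧ herm p₁ c₂ = 1 ∧ herm p₂ c₁ = 1 := by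
  obtain ⟨c₁, p₁, h₁, u₁⟩ := F₁.exists_unit_rep
  obtain ⟨c₂, p₂, h₂, u₂, hr⟩ := exists_unit_rep_real F₂ h₁ u₁ h
  obtain ⟨g1, g2, -⟩ := (generic₂_iff h₁ h₂).1 h
  obtain ⟨p₁', h₁', e₁⟩ := h₁.normalize_lift g1
  obtain ⟨p₂', h₂', e₂⟩ := h₂.normalize_lift g2
  exact ⟨c₁, p₁', c₂, p₂', h₁', h₂', u₁, u₂, hr, e₁, e₂⟩

/-- Pairing a relation with `p₁` isolates the coefficient of `c₂`, and pairing the rest with `c₁`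
isolates that of `c₁`. -/
theorem linearIndependent_pair (h₁ : F₁.Rep c₁ p₁) (h₂ : F₂.Rep c₂ p₂) (h : Generic₂ F₁ F₂) :
    LinearIndependent ℂ ![c₁, c₂, p₁] := by
  obtain ⟨g1, -, -⟩ := (generic₂_iff h₁ h₂).1 h
  have hcc : herm c₁ c₁ ≠ 0 := fun h0 => by
    have := h₁.polar_pos
    rw [h0] at this
    simp at this
  rw [Fintype.linearIndependent_iff]
  intro a ha
  rw [Fin.sum_univ_three] at ha
  simp only [Matrix.cons_val_zero, Matrix.cons_val_one, Matrix.cons_val] at ha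
  have hp := congrArg (fun v => herm v p₁) ha
  have hc := congrArg (fun v => herm v c₁) ha
  simp only [herm_add_left, herm_smul_left, herm_zero_left, h₁.herm_polar_lift,
    h₁.herm_lift_lift, h₁.herm_lift_polar, mul_zero, add_zero, zero_add] at hp hc
  have h1 : a 1 = 0 := (mul_eq_zero.1 hp).resolve_right fun h0 => g1 (herm_comm_eq_zero.1 h0)
  rw [h1, zero_mul, add_zero] at hc
  have h0 : a 0 = 0 := (mul_eq_zero.1 hc).resolve_right hcc
  rw [h0, h1, zero_smul, zero_smul, zero_add, zero_add] at ha
  have h2 : a 2 = 0 := (smul_eq_zero.1 ha).resolve_right h₁.lift_ne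
  intro i
  fin_cases i <;> assumption

/-- A pair of flags in generic position has trivial stabilizer. -/
theorem Generic₂.eq_one (h : Generic₂ F₁ F₂) {A : PU21} (hA₁ : A • F₁ = F₁) (hA₂ : A • F₂ = F₂) :
    A = 1 := by
  induction A using QuotientGroup.induction_on with
  | H B =>
    replace hA₁ : B • F₁ = F₁ := hA₁
    replace hA₂ : B • F₂ = F₂ := hA₂
    have h₁ := F₁.rep
    have h₂ := F₂.rep
    have k₁ := h₁.map B
    have k₂ := h₂.map B
    rw [hA₁] at k₁
    rw [hA₂] at k₂
    obtain ⟨l, n, hl, hn, e₁, f₁⟩ := h₁.unique k₁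
    obtain ⟨m, -, hm, -, e₂, -⟩ := h₂.unique k₂
    obtain ⟨g1, -, g3⟩ := (generic₂_iff h₁ h₂).1 h
    have hcc : herm F₁.polar F₁.polar ≠ 0 := fun h0 => by
      have := h₁.polar_pos
      rw [h0] at this
      simp at this
    have i1 := B.2 F₁.polar F₁.polar
    have i2 := B.2 F₁.polar F₂.polar
    have i3 := B.2 F₁.lift F₂.polar
    rw [e₁, herm_smul_left, herm_smul_right, ← mul_assoc] at i1
    rw [e₁, e₂, herm_smul_left, herm_smul_right, ← mul_assoc] at i2
    rw [f₁, e₂, herm_smul_left, herm_smul_right, ← mul_assoc] at i3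
    -- The vectors `c₁`, `c₂`, `p₁` are eigenvectors; the nonzero products among them force the
    -- three eigenvalues to be equal.
    have j1 : l * conj l = 1 := mul_right_cancel₀ hcc (i1.trans (one_mul _).symm)
    have j2 : l * conj m = 1 := mul_right_cancel₀ g3 (i2.trans (one_mul _).symm)
    have j3 : n * conj m = 1 := mul_right_cancel₀ g1 (i3.trans (one_mul _).symm)
    have lm : m = l := by
      have := mul_left_cancel₀ hl (j2.trans j1.symm)
      simpa using congrArg conj this
    have nl : n = l :=
      mul_right_cancel₀ ((map_ne_zero (starRingEnd ℂ)).2 hm) (j3.trans j2.symm)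
    refine (QuotientGroup.eq_one_iff B).2 ⟨l, fun v => ?_⟩
    obtain ⟨a, rfl⟩ := exists_combination (linearIndependent_pair h₁ h₂ h) v
    simp only [Matrix.cons_val_zero, Matrix.cons_val_one, Matrix.cons_val, map_add, map_smul, e₁,
      e₂, f₁, lm, nl, smul_add, smul_comm l]

theorem Generic₂.eq_of_smul (h : Generic₂ F₁ F₂) {A B : PU21} (h₁ : A • F₁ = B • F₁)
    (h₂ : A • F₂ = B • F₂) : A = B := by
  have : B⁻¹ * A = 1 := by
    refine h.eq_one ?_ ?_
    · rw [mul_smul, h₁, inv_smul_smul]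
    · rw [mul_smul, h₂, inv_smul_smul]
  exact (inv_mul_eq_one.1 this).symm

/-- Pairs of flags with the same invariants are congruent. -/
theorem Generic₂.exists_smul_eq (h : Generic₂ F₁ F₂) {F₁' F₂' : Flag} (h' : Generic₂ F₁' F₂')
    (hphi : phi F₁ F₂ = phi F₁' F₂') (hm : pairInv F₁ F₂ = pairInv F₁' F₂') :
    ∃ A : PU21, A • F₁ = F₁' ∧ A • F₂ = F₂' := by
  obtain ⟨c₁, p₁, c₂, p₂, h₁, h₂, u₁, u₂, hr, e₁, e₂⟩ := h.exists_normalized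
  obtain ⟨c₁', p₁', c₂', p₂', h₁', h₂', u₁', u₂', hr', e₁', e₂'⟩ := h'.exists_normalized
  rw [pairInv_eq h₁ h₂, pairInv_eq h₁' h₂', hr, hr', ← hphi, e₁, e₁', ← conj_herm p₂ c₁,
    ← conj_herm p₂' c₁', e₂, e₂', map_one, mul_one, div_one, div_one] at hm
  have hs : (Real.sqrt (phi F₁ F₂) : ℂ) ≠ 0 := by
    exact_mod_cast (Real.sqrt_pos.2 (phi_pos h)).ne'
  have hpp := mul_right_cancel₀ hs hm
  rw [← hphi] at hr'
  have hli := linearIndependent_pair h₁ h₂ h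
  have sw : ∀ {v w v' w' : V}, herm v w = herm v' w' → herm w v = herm w' v' := by
    intro v w v' w' h
    rw [← conj_herm v w, ← conj_herm v' w', h]
  -- The normalized Gram matrix of `c₁`, `c₂`, `p₁` involves `phi` alone. The value of `pairInv`
  -- enters only through the product of `p₂` with `p₁`, which fixes the position of the remaining
  -- vector.
  obtain ⟨B, hB⟩ := exists_isometry (b' := ![c₁', c₂', p₁']) hli (by
    intro i j
    have g1 := u₁.trans u₁'.symm
    have g2 := u₂.trans u₂'.symm
    have g3 := hr.trans hr'.symm
    have g4 := e₁.trans e₁'.symm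
    have g5 := h₁.herm_lift_lift.trans h₁'.herm_lift_lift.symm
    have g6 := h₁.herm_lift_polar.trans h₁'.herm_lift_polar.symm
    fin_cases i <;> fin_cases j
    exacts [g1, g3, sw g6, sw g3, g2, sw g4, g6, g4, g5])
  have b1 : B.1 c₁ = c₁' := hB 0
  have b2 : B.1 c₂ = c₂' := hB 1
  have b3 : B.1 p₁ = p₁' := hB 2
  have b4 : B.1 p₂ = p₂' := by
    refine eq_of_herm_basis (linearIndependent_pair h₁' h₂' h') fun i => ?_
    fin_cases i
    · change herm (B.1 p₂) c₁' = herm p₂' c₁'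
      rw [← b1, B.2, b1, e₂, e₂']
    · change herm (B.1 p₂) c₂' = herm p₂' c₂'
      rw [← b2, B.2, b2, h₂.herm_lift_polar, h₂'.herm_lift_polar]
    · change herm (B.1 p₂) p₁' = herm p₂' p₁'
      rw [← b3, B.2, b3]
      exact sw hpp
  refine ⟨QuotientGroup.mk B, ?_, ?_⟩
  · have := h₁.map B
    rw [b1, b3] at this
    exact this.flag_eq h₁'
  · have := h₂.map B
    rw [b2, b4] at this
    exact this.flag_eq h₂'

end

end ComplexHyperbolic

namespace ComplexHyperbolic

open scoped ComplexConjugate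

theorem fin3_add_one_add_one (i : Fin 3) : i + 1 + 1 = i + 2 := by revert i; decide

theorem fin3_add_one_add_two (i : Fin 3) : i + 1 + 2 = i := by revert i; decide

theorem fin3_add_two_add_one (i : Fin 3) : i + 2 + 1 = i := by revert i; decide

theorem fin3_add_two_add_two (i : Fin 3) : i + 2 + 2 = i + 1 := by revert i; decide

theorem fin3_eq_or_eq_of_ne {i j : Fin 3} (h : i ≠ j) : j = i + 1 ∨ j = i + 2 := by
  revert i j; decide

/-! ### Relations between the invariants of a triple of flags -/

theorem Phi_rotate (F₁ F₂ F₃ : Flag) : Phi F₁ F₂ F₃ = Phi F₂ F₃ F₁ := by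
  rw [Phi, Phi]; congr 1 <;> ring

theorem Phi_swap (F₁ F₂ F₃ : Flag) : Phi F₁ F₂ F₃ = conj (Phi F₁ F₃ F₂) := by
  rw [Phi, Phi]
  simp only [map_div₀, map_mul, conj_herm]
  congr 1 <;> ring

theorem norm_Phi_sq (F₁ F₂ F₃ : Flag) :
    ‖Phi F₁ F₂ F₃‖ ^ 2 = phi F₁ F₂ * phi F₂ F₃ * phi F₁ F₃ := by
  obtain ⟨c₁, p₁, h₁, u₁⟩ := F₁.exists_unit_rep
  obtain ⟨c₂, p₂, h₂, u₂⟩ := F₂.exists_unit_rep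
  obtain ⟨c₃, p₃, h₃, u₃⟩ := F₃.exists_unit_rep
  rw [Phi_eq h₁ h₂ h₃, phi_eq_of_unit h₁ h₂ u₁ u₂, phi_eq_of_unit h₂ h₃ u₂ u₃,
    phi_eq_of_unit h₁ h₃ u₁ u₃, u₁, u₂, u₃, ← conj_herm c₁ c₃]
  simp only [mul_one, div_one, norm_mul, RCLike.norm_conj]
  ring

theorem delta_mul_delta {F₁ F₂ F₃ : Flag} (h₁₂ : Generic₂ F₁ F₂) (h₁₃ : Generic₂ F₁ F₃) :
    delta F₁ F₂ F₃ * delta F₁ F₃ F₂ = phi F₂ F₃ := by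
  obtain ⟨c₁, p₁, h₁, u₁⟩ := F₁.exists_unit_rep
  obtain ⟨c₂, p₂, h₂, u₂⟩ := F₂.exists_unit_rep
  obtain ⟨c₃, p₃, h₃, u₃⟩ := F₃.exists_unit_rep
  have n₂ := ((generic₂_iff h₁ h₂).1 h₁₂).1
  have n₃ := ((generic₂_iff h₁ h₃).1 h₁₃).1
  rw [delta_eq h₁ h₂ h₃, delta_eq h₁ h₃ h₂, phi_coe_eq_of_unit h₂ h₃ u₂ u₃, u₂, u₃]
  field_simp

theorem delta_ne_zero {F₁ F₂ F₃ : Flag} (h₁₂ : Generic₂ F₁ F₂) (h₁₃ : Generic₂ F₁ F₃)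
    (h₂₃ : Generic₂ F₂ F₃) : delta F₁ F₂ F₃ ≠ 0 := by
  intro h
  have := delta_mul_delta h₁₂ h₁₃
  rw [h, zero_mul] at this
  have h' : phi F₂ F₃ = 0 := by exact_mod_cast this.symm
  exact (phi_pos h₂₃).ne' h'

section

variable {F : Fin 3 → Flag}

theorem gramDet_eq_of_unit {c p : Fin 3 → V} (hr : ∀ i, (F i).Rep (c i) (p i))
    (hu : ∀ i, herm (c i) (c i) = 1) :
    gramDet (c 0) (c 1) (c 2) = 1 - phi (F 0) (F 1) - phi (F 1) (F 2) - phi (F 0) (F 2) +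
      Phi (F 0) (F 1) (F 2) + Phi (F 0) (F 2) (F 1) := by
  rw [gramDet, Phi_eq (hr 0) (hr 1) (hr 2), Phi_eq (hr 0) (hr 2) (hr 1),
    phi_coe_eq_of_unit (hr 0) (hr 1) (hu 0) (hu 1), phi_coe_eq_of_unit (hr 1) (hr 2) (hu 1) (hu 2),
    phi_coe_eq_of_unit (hr 0) (hr 2) (hu 0) (hu 2), hu, hu, hu]
  ring

theorem Generic₃.gram_neg (h : Generic₃ (F 0) (F 1) (F 2)) :
    (1 - phi (F 0) (F 1) - phi (F 1) (F 2) - phi (F 0) (F 2) +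
      Phi (F 0) (F 1) (F 2) + Phi (F 0) (F 2) (F 1) : ℂ).re < 0 := by
  choose c p hr hu using fun i => (F i).exists_unit_rep
  rw [← gramDet_eq_of_unit hr hu]
  exact gramDet_re_neg ((linearIndependent_polar_iff hr).1 (generic₃_iff.1 h).2)

theorem ofReal_two_mul_re (z : ℂ) : ((2 * z.re : ℝ) : ℂ) = z + conj z := (Complex.add_conj z).symm

/-- This is the isotropy of the first boundary vector, written in the basis of polar vectors by
`gramDet_mul_herm`; its product with its own polar vector is zero, which leaves four terms. -/
theorem Generic₃.circle (h : Generic₃ (F 0) (F 1) (F 2)) :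
    ‖delta (F 0) (F 1) (F 2)‖ ^ 2 * (1 - phi (F 0) (F 2)) +
      2 * (delta (F 0) (F 1) (F 2) * (Phi (F 0) (F 2) (F 1) - phi (F 1) (F 2))).re +
      phi (F 1) (F 2) * (1 - phi (F 0) (F 1)) = 0 := by
  choose c p hr hu using fun i => (F i).exists_unit_rep
  obtain ⟨h2, h3⟩ := generic₃_iff.1 h
  have hE := gramDet_mul_herm ((linearIndependent_polar_iff hr).1 h3) (p 0) (p 0)
  have n1 := ((generic₂_iff (hr 0) (hr 1)).1 (h2 0 1 (by decide))).1
  have n2 := ((generic₂_iff (hr 0) (hr 2)).1 (h2 0 2 (by decide))).1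
  have n2' : herm (c 2) (p 0) ≠ 0 := fun h0 => n2 (herm_comm_eq_zero.1 h0)
  rw [(hr 0).herm_lift_lift, (hr 0).herm_lift_polar, (hr 0).herm_polar_lift] at hE
  simp only [hu, mul_zero, zero_mul, zero_add, mul_one, one_mul] at hE
  apply Complex.ofReal_injective
  rw [Complex.ofReal_add, Complex.ofReal_add, ofReal_two_mul_re, ← Complex.normSq_eq_norm_sq,
    Complex.ofReal_mul, ← Complex.mul_conj, Complex.ofReal_mul, Complex.ofReal_sub,
    Complex.ofReal_sub, phi_coe_eq_of_unit (hr 0) (hr 1) (hu 0) (hu 1),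
    phi_coe_eq_of_unit (hr 1) (hr 2) (hu 1) (hu 2),
    phi_coe_eq_of_unit (hr 0) (hr 2) (hu 0) (hu 2), Phi_eq (hr 0) (hr 2) (hr 1),
    delta_eq (hr 0) (hr 1) (hr 2)]
  simp only [hu, mul_one, one_mul, map_mul, map_div₀, map_sub, conj_herm, div_one,
    Complex.ofReal_one, Complex.ofReal_zero]
  field_simp
  linear_combination (-1 : ℂ) * (herm (c 1) (c 2) * herm (c 2) (c 1)) * hE

/-- Expanding the product of two boundary vectors by `gramDet_mul_herm` leaves four terms, which are
those of the numerator of m; Δ is the Gram determinant. That the right side ignores the third flag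
is what makes the edge condition a gluing condition. -/
theorem Generic₃.pairInv_eq (h : Generic₃ (F 0) (F 1) (F 2)) :
    (phi (F 0) (F 2) * phi (F 1) (F 2) * (Phi (F 0) (F 1) (F 2) - phi (F 0) (F 1))
      + phi (F 0) (F 2) * (phi (F 0) (F 1) * phi (F 1) (F 2) - Phi (F 0) (F 1) (F 2)) *
        delta (F 0) (F 2) (F 1)
      + phi (F 1) (F 2) * (phi (F 0) (F 1) * phi (F 0) (F 2) - Phi (F 0) (F 1) (F 2)) *
        conj (delta (F 1) (F 2) (F 0))
      + Phi (F 0) (F 1) (F 2) * (1 - phi (F 0) (F 1)) * delta (F 0) (F 2) (F 1) *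
        conj (delta (F 1) (F 2) (F 0))) /
    ((1 - phi (F 0) (F 1) - phi (F 1) (F 2) - phi (F 0) (F 2) + Phi (F 0) (F 1) (F 2) +
      Phi (F 0) (F 2) (F 1)) * phi (F 0) (F 2) * phi (F 1) (F 2)) = pairInv (F 0) (F 1) := by
  have hD0 : (1 - phi (F 0) (F 1) - phi (F 1) (F 2) - phi (F 0) (F 2) +
      Phi (F 0) (F 1) (F 2) + Phi (F 0) (F 2) (F 1) : ℂ) ≠ 0 := by
    intro h0
    have := h.gram_neg
    rw [h0] at this
    simp at this
  choose c p hr hu using fun i => (F i).exists_unit_rep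
  obtain ⟨h2, h3⟩ := generic₃_iff.1 h
  have hE := gramDet_mul_herm ((linearIndependent_polar_iff hr).1 h3) (p 0) (p 1)
  have n01 := ((generic₂_iff (hr 0) (hr 1)).1 (h2 0 1 (by decide)))
  have n02 := ((generic₂_iff (hr 0) (hr 2)).1 (h2 0 2 (by decide))).2.2
  have n12 := ((generic₂_iff (hr 1) (hr 2)).1 (h2 1 2 (by decide))).2.2
  have n02' : herm (c 2) (c 0) ≠ 0 := fun h0 => n02 (herm_comm_eq_zero.1 h0)
  have n12' : herm (c 2) (c 1) ≠ 0 := fun h0 => n12 (herm_comm_eq_zero.1 h0)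
  have n1 : herm (c 0) (p 1) ≠ 0 := fun h0 => n01.2.1 (herm_comm_eq_zero.1 h0)
  have n0 := n01.1
  rw [gramDet_eq_of_unit hr hu, (hr 0).herm_lift_polar, (hr 1).herm_polar_lift] at hE
  generalize hD : (1 - phi (F 0) (F 1) - phi (F 1) (F 2) - phi (F 0) (F 2) +
      Phi (F 0) (F 1) (F 2) + Phi (F 0) (F 2) (F 1) : ℂ) = D at *
  rw [ComplexHyperbolic.pairInv_eq (hr 0) (hr 1),
    phi_coe_eq_of_unit (hr 0) (hr 1) (hu 0) (hu 1),
    phi_coe_eq_of_unit (hr 1) (hr 2) (hu 1) (hu 2),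
    phi_coe_eq_of_unit (hr 0) (hr 2) (hu 0) (hu 2), Phi_eq (hr 0) (hr 1) (hr 2),
    delta_eq (hr 0) (hr 2) (hr 1), delta_eq (hr 1) (hr 2) (hr 0)]
  simp only [hu, mul_zero, zero_mul, zero_add, mul_one, one_mul, add_zero] at hE
  simp only [hu, mul_one, one_mul, map_mul, map_div₀, conj_herm, div_one]
  rw [div_eq_div_iff (by simp [hD0, n02, n12, n02', n12']) (mul_ne_zero n0 n1)]
  field_simp
  linear_combination (-herm (c 0) (c 1)) * hE

/-! ### Congruence of triples -/

/-- The phases of the unit polar vectors make two products positive, after which Φ gives the third;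
the scale of each boundary vector makes one product 1, after which δ gives the other. -/
theorem Generic₃.exists_normalized (h : Generic₃ (F 0) (F 1) (F 2)) :
    ∃ c p : Fin 3 → V, (∀ i, (F i).Rep (c i) (p i)) ∧ (∀ i, herm (c i) (c i) = 1) ∧
      herm (c 0) (c 1) = Real.sqrt (phi (F 0) (F 1)) ∧
      herm (c 1) (c 2) = Real.sqrt (phi (F 1) (F 2)) ∧
      herm (c 2) (c 0) = Phi (F 0) (F 1) (F 2) /
        (Real.sqrt (phi (F 0) (F 1)) * Real.sqrt (phi (F 1) (F 2))) ∧
      (∀ i, herm (p i) (c (i + 2)) = 1) ∧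
      ∀ i, herm (p i) (c (i + 1)) =
        delta (F i) (F (i + 1)) (F (i + 2)) / herm (c (i + 1)) (c (i + 2)) := by
  obtain ⟨h2, -⟩ := generic₃_iff.1 h
  obtain ⟨c₀, p₀, h₀, u₀⟩ := (F 0).exists_unit_rep
  obtain ⟨c₁, p₁, h₁, u₁, r₁⟩ := exists_unit_rep_real (F 1) h₀ u₀ (h2 0 1 (by decide))
  obtain ⟨c₂, p₂, h₂, u₂, r₂⟩ := exists_unit_rep_real (F 2) h₁ u₁ (h2 1 2 (by decide))
  have n₀ := ((generic₂_iff h₀ h₂).1 (h2 0 2 (by decide))).1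
  have n₁ := ((generic₂_iff h₁ h₀).1 (h2 1 0 (by decide))).1
  have n₂ := ((generic₂_iff h₂ h₁).1 (h2 2 1 (by decide))).1
  obtain ⟨q₀, k₀, e₀⟩ := h₀.normalize_lift n₀
  obtain ⟨q₁, k₁, e₁⟩ := h₁.normalize_lift n₁
  obtain ⟨q₂, k₂, e₂⟩ := h₂.normalize_lift n₂
  have hrep : ∀ i, (F i).Rep (![c₀, c₁, c₂] i) (![q₀, q₁, q₂] i) := by
    intro i; fin_cases i <;> assumption
  have hunit : ∀ i, herm (![c₀, c₁, c₂] i) (![c₀, c₁, c₂] i) = 1 := by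
    intro i; fin_cases i <;> assumption
  have hone : ∀ i, herm (![q₀, q₁, q₂] i) (![c₀, c₁, c₂] (i + 2)) = 1 := by
    intro i; fin_cases i <;> assumption
  refine ⟨![c₀, c₁, c₂], ![q₀, q₁, q₂], hrep, hunit, r₁, r₂, ?_, hone, fun i => ?_⟩
  · have s₁ : (Real.sqrt (phi (F 0) (F 1)) : ℂ) ≠ 0 := by
      exact_mod_cast (Real.sqrt_pos.2 (phi_pos (h2 0 1 (by decide)))).ne'
    have s₂ : (Real.sqrt (phi (F 1) (F 2)) : ℂ) ≠ 0 := by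
      exact_mod_cast (Real.sqrt_pos.2 (phi_pos (h2 1 2 (by decide)))).ne'
    rw [Phi_eq h₀ h₁ h₂, u₀, u₁, u₂, r₁, r₂]
    change herm c₂ c₀ = _
    field_simp
  · have hne := ((generic₂_iff (hrep (i + 1)) (hrep (i + 2))).1
      (h2 (i + 1) (i + 2) (by revert i; decide))).2.2
    rw [delta_eq (hrep i) (hrep (i + 1)) (hrep (i + 2)), hunit, hone]
    field_simp

/-- Triples of flags with the same invariants are congruent. -/
theorem Generic₃.exists_smul_eq {F' : Fin 3 → Flag} (h : Generic₃ (F 0) (F 1) (F 2))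
    (h' : Generic₃ (F' 0) (F' 1) (F' 2)) (h₀₁ : phi (F 0) (F 1) = phi (F' 0) (F' 1))
    (h₁₂ : phi (F 1) (F 2) = phi (F' 1) (F' 2))
    (hPhi : Phi (F 0) (F 1) (F 2) = Phi (F' 0) (F' 1) (F' 2))
    (hδ : ∀ i, delta (F i) (F (i + 1)) (F (i + 2)) = delta (F' i) (F' (i + 1)) (F' (i + 2))) :
    ∃ A : PU21, ∀ i, A • F i = F' i := by
  obtain ⟨c, p, hr, hu, g₀, g₁, g₂, ho, hd⟩ := h.exists_normalized
  obtain ⟨c', p', hr', hu', g₀', g₁', g₂', ho', hd'⟩ := h'.exists_normalized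
  have hli := (linearIndependent_polar_iff hr).1 (generic₃_iff.1 h).2
  have hli' := (linearIndependent_polar_iff hr').1 (generic₃_iff.1 h').2
  have sw : ∀ {v w v' w' : V}, herm v w = herm v' w' → herm w v = herm w' v' := by
    intro v w v' w' h
    rw [← conj_herm v w, ← conj_herm v' w', h]
  have e₀ : herm (c 0) (c 1) = herm (c' 0) (c' 1) := by rw [g₀, g₀', h₀₁]
  have e₁ : herm (c 1) (c 2) = herm (c' 1) (c' 2) := by rw [g₁, g₁', h₁₂]
  have e₂ : herm (c 2) (c 0) = herm (c' 2) (c' 0) := by rw [g₂, g₂', h₀₁, h₁₂, hPhi]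
  have hgram : ∀ i j, herm (c i) (c j) = herm (c' i) (c' j) := by
    intro i j
    have f := fun i => (hu i).trans (hu' i).symm
    fin_cases i <;> fin_cases j
    exacts [f 0, e₀, sw e₂, sw e₀, f 1, e₁, e₂, sw e₁, f 2]
  obtain ⟨B, hB⟩ := exists_isometry hli hgram
  have hp : ∀ i, B.1 (p i) = p' i := by
    intro i
    refine eq_of_herm_basis hli' fun j => ?_
    rw [← hB, B.2, hB]
    have : j = i ∨ j = i + 1 ∨ j = i + 2 := by revert i j; decide
    rcases this with rfl | rfl | rfl
    · rw [(hr j).herm_lift_polar, (hr' j).herm_lift_polar]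
    · rw [hd, hd', hδ, hgram]
    · rw [ho, ho']
  refine ⟨QuotientGroup.mk B, fun i => ?_⟩
  have := (hr i).map B
  rw [hB, hp] at this
  exact this.flag_eq (hr' i)

end

/-! ### Realization of the invariants -/

/-- For nonzero `ζ`, putting `s = σ * conj ζ` with real `σ` leaves a real quadratic equation with
positive discriminant. For `ζ = 0` the hypothesis makes `a` and `b` of opposite sign, and a real
square root works. -/
theorem exists_real_quadratic {a b : ℝ} {ζ : ℂ} (h : a * b < ‖ζ‖ ^ 2) :
    ∃ s : ℂ, 2 * (s * ζ).re - a * ‖s‖ ^ 2 = b := by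
  by_cases hζ : ζ = 0
  · subst hζ
    have hab : a * b < 0 := by simpa using h
    have ha : a ≠ 0 := by rintro rfl; simp at hab
    refine ⟨Real.sqrt (-b / a), ?_⟩
    have hpos : 0 ≤ -b / a := by
      rw [show -b / a = -(a * b) / a ^ 2 by field_simp]
      exact div_nonneg (by linarith) (sq_nonneg a)
    rw [mul_zero, Complex.zero_re, Complex.norm_real, Real.norm_eq_abs, sq_abs, Real.sq_sqrt hpos]
    field_simp
    ring
  · set N := ‖ζ‖ ^ 2 with hN
    have hNpos : 0 < N := pow_pos (norm_pos_iff.2 hζ) 2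
    obtain ⟨σ, hσ⟩ : ∃ σ : ℝ, 2 * σ * N - a * σ ^ 2 * N = b := by
      by_cases ha : a = 0
      · exact ⟨b / (2 * N), by rw [ha]; field_simp; ring⟩
      · have hd : 0 ≤ N * (N - a * b) := mul_nonneg hNpos.le (by linarith)
        refine ⟨(N + Real.sqrt (N * (N - a * b))) / (a * N), ?_⟩
        have hs := Real.sq_sqrt hd
        field_simp
        ring_nf
        ring_nf at hs
        rw [hs]
        ring
    refine ⟨σ * conj ζ, ?_⟩
    have e1 : (σ * conj ζ * ζ : ℂ) = ((σ * N : ℝ) : ℂ) := by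
      rw [mul_assoc, mul_comm (conj ζ), Complex.mul_conj, Complex.normSq_eq_norm_sq]
      rw [hN]
      push_cast
      rfl
    rw [e1, Complex.ofReal_re, norm_mul, RCLike.norm_conj, Complex.norm_real, Real.norm_eq_abs,
      mul_pow, sq_abs, ← hN]
    linarith

/-- Realization of a Gram matrix of signature `(2,1)` with ones on the diagonal. -/
theorem exists_gram (x y : ℝ) (z : ℂ)
    (h : 1 - x ^ 2 - y ^ 2 - ‖z‖ ^ 2 + 2 * (x * y * z.re) < 0) :
    ∃ c : Fin 3 → V, (∀ i, herm (c i) (c i) = 1) ∧ herm (c 0) (c 1) = x ∧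
      herm (c 1) (c 2) = y ∧ herm (c 2) (c 0) = z := by
  have nz : ‖z‖ ^ 2 = z.re ^ 2 + z.im ^ 2 := by
    rw [← Complex.normSq_eq_norm_sq, Complex.normSq_apply]; ring
  set ζ : ℂ := y - x * conj z with hζ
  have nζ : ‖ζ‖ ^ 2 = (y - x * z.re) ^ 2 + (x * z.im) ^ 2 := by
    rw [← Complex.normSq_eq_norm_sq, Complex.normSq_apply, hζ]; simp; ring
  -- The third vector is prescribed by its products with the first two up to its coordinate `s`, and
  -- its unit norm is the equation for `s`. The solvability condition is the negativity of the Gram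
  -- determinant.
  obtain ⟨s, hs⟩ := exists_real_quadratic (a := 1 - x ^ 2) (b := 1 - ‖z‖ ^ 2) (ζ := ζ) (by
    rw [nζ]; rw [nz] at h ⊢; nlinarith)
  have hs' : s * ζ + conj s * conj ζ - (1 - (x : ℂ) ^ 2) * (s * conj s) = 1 - z * conj z := by
    have := congrArg (fun r : ℝ => (r : ℂ)) hs
    simp only [Complex.ofReal_sub, Complex.ofReal_mul] at this
    rw [← Complex.ofReal_mul 2, ofReal_two_mul_re, ← Complex.normSq_eq_norm_sq,
      ← Complex.normSq_eq_norm_sq, ← Complex.mul_conj, ← Complex.mul_conj, map_mul] at this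
    push_cast at this
    linear_combination this
  have h2 : conj (2 : ℂ) = 2 := Complex.conj_ofNat 2
  refine ⟨![![0, 1, 0], ![1, x, (1 - (x : ℂ) ^ 2) / 2],
    ![s, z, conj ζ - (1 - (x : ℂ) ^ 2) / 2 * s]], fun i => ?_, ?_, ?_, ?_⟩
  · fin_cases i
    · simp [herm_apply]
    · simp [herm_apply, h2]; ring
    · simp [herm_apply, h2]
      linear_combination hs'
  · simp [herm_apply]
  · simp [herm_apply, hζ, h2]
    ring
  · simp [herm_apply]

/-- Realization of the invariants of a triple of flags. -/
theorem exists_triple (φ : Fin 3 → ℝ) (Φ : ℂ) (δ : Fin 3 → ℂ) (hφ : ∀ i, 0 < φ i)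
    (hΦ : ‖Φ‖ ^ 2 = φ 2 * φ 0 * φ 1) (hΔ : 1 - φ 2 - φ 0 - φ 1 + 2 * Φ.re < 0)
    (hδ : ∀ i, δ i ≠ 0)
    (hc : ∀ i, ‖δ i‖ ^ 2 * (1 - φ (i + 1)) + 2 * (δ i * (conj Φ - φ i)).re +
      φ i * (1 - φ (i + 2)) = 0) :
    ∃ F : Fin 3 → Flag, Generic₃ (F 0) (F 1) (F 2) ∧
      (∀ i, phi (F (i + 1)) (F (i + 2)) = φ i) ∧ Phi (F 0) (F 1) (F 2) = Φ ∧
      ∀ i, delta (F i) (F (i + 1)) (F (i + 2)) = δ i := by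
  set x := Real.sqrt (φ 2) with hx
  set y := Real.sqrt (φ 0) with hy
  have hx0 : 0 < x := Real.sqrt_pos.2 (hφ 2)
  have hy0 : 0 < y := Real.sqrt_pos.2 (hφ 0)
  have hx2 : x ^ 2 = φ 2 := Real.sq_sqrt (hφ 2).le
  have hy2 : y ^ 2 = φ 0 := Real.sq_sqrt (hφ 0).le
  have hxC : (x : ℂ) ≠ 0 := by exact_mod_cast hx0.ne'
  have hyC : (y : ℂ) ≠ 0 := by exact_mod_cast hy0.ne'
  set z : ℂ := Φ / ((x * y : ℝ) : ℂ) with hz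
  have hxyz : (x : ℂ) * y * z = Φ := by rw [hz]; push_cast; field_simp
  have nz : ‖z‖ ^ 2 = φ 1 := by
    rw [hz, norm_div, Complex.norm_real, Real.norm_eq_abs, div_pow, sq_abs, hΦ, mul_pow, hx2, hy2]
    have := (hφ 2).ne'
    have := (hφ 0).ne'
    field_simp
  have hzre : x * y * z.re = Φ.re := by
    rw [← hxyz, ← Complex.ofReal_mul, Complex.re_ofReal_mul]
  obtain ⟨c, hu, g₀, g₁, g₂⟩ := exists_gram x y z (by rw [hx2, hy2, nz, hzre]; linarith)
  have sq : ∀ v w : V, herm v w * herm w v = ((‖herm v w‖ ^ 2 : ℝ) : ℂ) := fun v w => by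
    rw [← conj_herm v w, Complex.mul_conj, Complex.normSq_eq_norm_sq]
  have N : ∀ i, herm (c (i + 1)) (c (i + 2)) * herm (c (i + 2)) (c (i + 1)) = φ i := by
    intro i
    rw [sq]
    fin_cases i
    · change ((‖herm (c 1) (c 2)‖ ^ 2 : ℝ) : ℂ) = φ 0
      rw [g₁, Complex.norm_real, Real.norm_eq_abs, sq_abs, hy2]
    · change ((‖herm (c 2) (c 0)‖ ^ 2 : ℝ) : ℂ) = φ 1
      rw [g₂, nz]
    · change ((‖herm (c 0) (c 1)‖ ^ 2 : ℝ) : ℂ) = φ 2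
      rw [g₀, Complex.norm_real, Real.norm_eq_abs, sq_abs, hx2]
  have R : ∀ i, herm (c i) (c (i + 1)) * herm (c (i + 1)) (c (i + 2)) * herm (c (i + 2)) (c i) =
      Φ := by
    intro i
    rw [← hxyz, ← g₀, ← g₁, ← g₂]
    fin_cases i
    · rfl
    · change herm (c 1) (c 2) * herm (c 2) (c 0) * herm (c 0) (c 1) = _; ring
    · change herm (c 2) (c 0) * herm (c 0) (c 1) * herm (c 1) (c 2) = _; ring
  have ne : ∀ i, herm (c (i + 1)) (c (i + 2)) ≠ 0 := fun i h0 => by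
    have := N i
    rw [h0, zero_mul] at this
    exact (hφ i).ne' (by exact_mod_cast this.symm)
  have hdet : (gramDet (c 0) (c 1) (c 2)).re < 0 := by
    have e : gramDet (c 0) (c 1) (c 2) = 1 - φ 2 - φ 0 - φ 1 + (Φ + conj Φ) := by
      have n0 := N 0
      have n1 := N 1
      have n2 := N 2
      have r0 := R 0
      have r0' := congrArg conj r0
      simp only [map_mul, conj_herm] at r0'
      change herm (c 1) (c 2) * herm (c 2) (c 1) = _ at n0
      change herm (c 2) (c 0) * herm (c 0) (c 2) = _ at n1
      change herm (c 0) (c 1) * herm (c 1) (c 0) = _ at n2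
      change herm (c 0) (c 1) * herm (c 1) (c 2) * herm (c 2) (c 0) = _ at r0
      change herm (c 1) (c 0) * herm (c 2) (c 1) * herm (c 0) (c 2) = _ at r0'
      rw [gramDet, hu, hu, hu]
      linear_combination r0 + r0' - n0 - n1 - n2
    rw [e, ← ofReal_two_mul_re]
    simpa using hΔ
  have hli : LinearIndependent ℂ c := linearIndependent_of_gramDet_ne fun h0 => by
    rw [h0] at hdet
    simp at hdet
  have hp : ∀ i, ∃ p, herm p (c i) = 0 ∧ herm p (c (i + 1)) = δ i ∧
      herm p (c (i + 2)) = herm (c (i + 1)) (c (i + 2)) ∧ herm p p = 0 := by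
    intro i
    have hli' : LinearIndependent ℂ fun k => c (i + k) := hli.comp _ (add_right_injective i)
    -- A vector is determined by its products with the polar basis; these make `p` orthogonal to its
    -- polar vector and give it the invariant `δ i`. Isotropy then follows from `gramDet_mul_herm`
    -- and the relation `hc`.
    obtain ⟨p, hp⟩ := exists_herm_eq hli' ![0, δ i, herm (c (i + 1)) (c (i + 2))]
    have p0 := hp 0
    have p1 := hp 1
    have p2 := hp 2
    have hE := gramDet_mul_herm hli' p p
    simp only [add_zero] at p0 hE
    change herm p (c i) = 0 at p0
    change herm p (c (i + 1)) = δ i at p1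
    change herm p (c (i + 2)) = herm (c (i + 1)) (c (i + 2)) at p2
    have hne : gramDet (c i) (c (i + 1)) (c (i + 2)) ≠ 0 := fun h0 => by
      have := gramDet_re_neg hli'
      simp only [add_zero] at this
      rw [h0] at this
      simp at this
    refine ⟨p, p0, p1, p2, (mul_eq_zero.1 (hE.trans ?_)).resolve_left hne⟩
    have p0' := herm_comm_eq_zero.1 p0
    have p1' : herm (c (i + 1)) p = conj (δ i) := by rw [← p1, conj_herm]
    have p2' : herm (c (i + 2)) p = herm (c (i + 2)) (c (i + 1)) := by
      rw [← conj_herm p, p2, conj_herm]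
    have n0 := N i
    have n1 := N (i + 1)
    have n2 := N (i + 2)
    have f1 := fin3_add_one_add_one i
    have f2 := fin3_add_one_add_two i
    have f3 := fin3_add_two_add_one i
    have f4 := fin3_add_two_add_two i
    rw [f1, f2] at n1
    rw [f3, f4] at n2
    have r := R i
    have r' := congrArg conj r
    simp only [map_mul, conj_herm] at r'
    have hci := congrArg (fun r : ℝ => (r : ℂ)) (hc i)
    simp only [Complex.ofReal_add, Complex.ofReal_zero] at hci
    rw [ofReal_two_mul_re, ← Complex.normSq_eq_norm_sq, Complex.ofReal_mul,
      ← Complex.mul_conj] at hci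
    simp only [map_mul, map_sub, Complex.conj_conj, Complex.conj_ofReal, Complex.ofReal_mul,
      Complex.ofReal_sub, Complex.ofReal_one] at hci
    rw [p0, p0', p1, p1', p2, p2', hu, hu, hu]
    linear_combination hci - δ i * conj (δ i) * n1 + δ i * r' + conj (δ i) * r -
      (δ i + conj (δ i)) * n0 + (1 - herm (c i) (c (i + 1)) * herm (c (i + 1)) (c i)) * n0 -
      φ i * n2
  choose p hp0 hp1 hp2 hpp using hp
  have hrep : ∀ i, ∃ F : Flag, F.Rep (c i) (p i) := by
    intro i
    refine Flag.exists_rep (by rw [hu]; simp) ?_ (hpp i) (hp0 i)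
    intro h0
    have := hp1 i
    rw [h0, herm_zero_left] at this
    exact hδ i this.symm
  choose F hF using hrep
  have hg : ∀ i j, i ≠ j → herm (p i) (c j) ≠ 0 ∧ herm (c i) (c j) ≠ 0 := by
    intro i j hij
    have hj := fin3_eq_or_eq_of_ne hij
    have f1 := fin3_add_two_add_one i
    have f2 := fin3_add_two_add_two i
    have f3 := fin3_add_one_add_one i
    have f4 := fin3_add_one_add_two i
    rcases hj with rfl | rfl
    · refine ⟨by rw [hp1]; exact hδ i, ?_⟩
      have := ne (i + 2)
      rwa [f1, f2] at this
    · refine ⟨by rw [hp2]; exact ne i, fun h0 => ?_⟩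
      have := ne (i + 1)
      rw [f3, f4] at this
      exact this (herm_comm_eq_zero.1 h0)
  refine ⟨F, generic₃_iff.2 ⟨fun i j hij => (generic₂_iff (hF i) (hF j)).2
    ⟨(hg i j hij).1, (hg j i hij.symm).1, (hg i j hij).2⟩,
    (linearIndependent_polar_iff hF).2 hli⟩, fun i => ?_, ?_, fun i => ?_⟩
  · have := phi_coe_eq_of_unit (hF (i + 1)) (hF (i + 2)) (hu _) (hu _)
    rw [N] at this
    exact_mod_cast this
  · rw [Phi_eq (hF 0) (hF 1) (hF 2), hu, hu, hu]
    simpa using R 0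
  · rw [delta_eq (hF i) (hF (i + 1)) (hF (i + 2)), hu, hp1, hp2, one_mul,
      mul_div_cancel_left₀ _ (ne i)]

end ComplexHyperbolic

/-! ### Decorations as invariants of triples of flags on the faces -/

namespace ComplexHyperbolic

theorem pairInv_smul (A : PU21) (F₁ F₂ : Flag) : pairInv (A • F₁) (A • F₂) = pairInv F₁ F₂ := by
  induction A using QuotientGroup.induction_on with
  | H A =>
    change pairInv (A • F₁) (A • F₂) = _
    rw [pairInv_eq (F₁.rep.map A) (F₂.rep.map A), pairInv_eq F₁.rep F₂.rep]
    simp only [A.2 _ _]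

theorem Generic₃.generic₂ {F : Fin 3 → Flag} (h : Generic₃ (F 0) (F 1) (F 2)) {i j : Fin 3}
    (hij : i ≠ j) : Generic₂ (F i) (F j) :=
  (generic₃_iff.1 h).1 i j hij

end ComplexHyperbolic

namespace PuncturedSurface

open ComplexHyperbolic

namespace Complex₂

variable {T : Complex₂}

theorem perm_cases (π : Equiv.Perm (Fin 3)) :
    (∃ i, π = Equiv.addLeft i) ∨ ∃ i, π = Equiv.addLeft i * Equiv.swap 1 2 := by
  revert π; decide

theorem perm_corners (π : Equiv.Perm (Fin 3)) :
    (π 2 + 1 = π 0 ∧ π 2 + 2 = π 1) ∨ (π 2 + 1 = π 1 ∧ π 2 + 2 = π 0) := by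
  revert π; decide

theorem fin3_add_one_ne_add_two (i : Fin 3) : i + 1 ≠ i + 2 := by revert i; decide

theorem fin3_add_two_ne_add_one (i : Fin 3) : i + 2 ≠ i + 1 := by revert i; decide

theorem addLeft_mul_finRotate (i : Fin 3) :
    Equiv.addLeft i * finRotate 3 = Equiv.addLeft (i + 1) := by revert i; decide

/-- The values of `(φ, Φ, δ)` on the face `f` are the invariants of the triple of flags `F`. -/
def Matches (φ : T.Edge → ℝ) (Φ δ : T.OrderedFace → ℂ) (f : T.Face) (F : Fin 3 → Flag) : Prop :=
  ∀ o : T.OrderedFace, o.face = f →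
    φ o.edgeij = phi (F (o.corner 0)) (F (o.corner 1)) ∧
    Φ o = Phi (F (o.corner 0)) (F (o.corner 1)) (F (o.corner 2)) ∧
    δ o = delta (F (o.corner 0)) (F (o.corner 1)) (F (o.corner 2))

section

variable {φ : T.Edge → ℝ} {Φ δ : T.OrderedFace → ℂ} {f : T.Face} {F : Fin 3 → Flag}

theorem matches_of (hφ : ∀ i, φ (T.edge f i) = phi (F (i + 1)) (F (i + 2)))
    (hΦ : ∀ π, Φ ⟨f, π⟩ = Phi (F (π 0)) (F (π 1)) (F (π 2)))
    (hδ : ∀ π, δ ⟨f, π⟩ = delta (F (π 0)) (F (π 1)) (F (π 2))) : Matches φ Φ δ f F := by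
  rintro ⟨f, π⟩ rfl
  refine ⟨?_, hΦ π, hδ π⟩
  refine (hφ (π 2)).trans ?_
  rcases perm_corners π with ⟨h0, h1⟩ | ⟨h1, h0⟩
  · rw [h0, h1]
  · rw [h0, h1, phi_comm]

theorem Matches.smul (h : Matches φ Φ δ f F) (A : PU21) : Matches φ Φ δ f (fun i => A • F i) := by
  intro o ho
  rw [phi_smul, Phi_smul, delta_smul]
  exact h o ho

theorem Matches.φ_edge (h : Matches φ Φ δ f F) (i : Fin 3) :
    φ (T.edge f i) = phi (F (i + 1)) (F (i + 2)) := by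
  have := (h ⟨f, Equiv.addLeft (i + 1)⟩ rfl).1
  change φ (T.edge f (i + 1 + 2)) = phi (F (i + 1 + 0)) (F (i + 1 + 1)) at this
  rwa [fin3_add_one_add_two, add_zero, fin3_add_one_add_one] at this

theorem Matches.φ_edgejk (h : Matches φ Φ δ f F) {o : T.OrderedFace} (ho : o.face = f) :
    φ o.edgejk = phi (F (o.corner 1)) (F (o.corner 2)) :=
  (h o.jki ho).1

theorem Matches.φ_edgeik (h : Matches φ Φ δ f F) {o : T.OrderedFace} (ho : o.face = f) :
    φ o.edgeik = phi (F (o.corner 0)) (F (o.corner 2)) :=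
  (h o.ikj ho).1

/-- This turns the edge condition of a decoration into an equality of pair invariants. -/
theorem Matches.decM_eq (h : Matches φ Φ δ f F) (hF : Generic₃ (F 0) (F 1) (F 2))
    {o : T.OrderedFace} (ho : o.face = f) :
    decM φ Φ δ o = pairInv (F (o.corner 0)) (F (o.corner 1)) := by
  have e₁ : δ o.ikj = delta (F (o.corner 0)) (F (o.corner 2)) (F (o.corner 1)) := (h o.ikj ho).2.2
  have e₂ : δ o.jki = delta (F (o.corner 1)) (F (o.corner 2)) (F (o.corner 0)) := (h o.jki ho).2.2
  have e₃ : Φ o.ikj = Phi (F (o.corner 0)) (F (o.corner 2)) (F (o.corner 1)) := (h o.ikj ho).2.1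
  rw [decM, decDelta, h.φ_edgejk ho, h.φ_edgeik ho, (h o ho).1, (h o ho).2.1, e₁, e₂, e₃]
  exact (hF.perm o.corner).pairInv_eq (F := fun i => F (o.corner i))

end

/-- Flags attached to the corners of the faces, agreeing along glued sides up to isometry, have
a decoration as invariants. -/
theorem exists_decoration (B : T.Face → Fin 3 → Flag)
    (hB : ∀ f, Generic₃ (B f 0) (B f 1) (B f 2))
    (hg : ∀ f i f' i', T.glue (f, i) = (f', i') → ∃ A : PU21,
      A • B f' (i' + 2) = B f (i + 1) ∧ A • B f' (i' + 1) = B f (i + 2)) :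
    ∃ D : T.Decoration, ∀ f, Matches D.φ D.Φ D.δ f (B f) := by
  -- A glued side carries a congruent pair in the opposite order, and `phi` is symmetric, so the
  -- value descends to edges.
  let φ : T.Edge → ℝ := Quot.lift (fun s => phi (B s.1 (s.2 + 1)) (B s.1 (s.2 + 2))) (by
    rintro ⟨f, i⟩ ⟨f', i'⟩ h
    obtain ⟨A, h₁, h₂⟩ := hg f i f' i' h
    change phi (B f (i + 1)) (B f (i + 2)) = phi (B f' (i' + 1)) (B f' (i' + 2))
    rw [← h₁, ← h₂, phi_smul, phi_comm])
  let Φ : T.OrderedFace → ℂ := fun o =>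
    Phi (B o.face (o.corner 0)) (B o.face (o.corner 1)) (B o.face (o.corner 2))
  let δ : T.OrderedFace → ℂ := fun o =>
    delta (B o.face (o.corner 0)) (B o.face (o.corner 1)) (B o.face (o.corner 2))
  have hm : ∀ f, Matches φ Φ δ f (B f) := fun f =>
    matches_of (fun i => rfl) (fun π => rfl) (fun π => rfl)
  have hij : ∀ o : T.OrderedFace, φ o.edgeij = _ := fun o => (hm o.face o rfl).1
  have hjk : ∀ o : T.OrderedFace, φ o.edgejk = _ := fun o => (hm o.face).φ_edgejk rfl
  have hik : ∀ o : T.OrderedFace, φ o.edgeik = _ := fun o => (hm o.face).φ_edgeik rfl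
  have hg₃ : ∀ o : T.OrderedFace, Generic₃ (B o.face (o.corner 0)) (B o.face (o.corner 1))
    (B o.face (o.corner 2)) := fun o => (hB o.face).perm o.corner
  have hgo : ∀ (o : T.OrderedFace) (i j : Fin 3), i ≠ j →
      Generic₂ (B o.face (o.corner i)) (B o.face (o.corner j)) := fun o i j h =>
    (hg₃ o).generic₂ (F := fun i => B o.face (o.corner i)) h
  refine ⟨{
    φ := φ
    Φ := Φ
    δ := δ
    φ_pos := ?_
    norm_Φ := fun o => ?_
    Φ_rotate := fun o => Phi_rotate _ _ _
    Φ_swap := fun o => Phi_swap _ _ _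
    decDelta_neg := fun o => ?_
    δ_mul_δ := fun o => ?_
    circle := fun o => ?_
    compat := ?_ }, hm⟩
  · rintro ⟨f, i⟩
    exact phi_pos ((hB f).generic₂ (F := B f) (fin3_add_one_ne_add_two i))
  · rw [hij, hjk, hik]
    exact norm_Phi_sq _ _ _
  · rw [decDelta, hij, hjk, hik]
    exact (hg₃ o).gram_neg (F := fun i => B o.face (o.corner i))
  · rw [hjk]
    exact delta_mul_delta (hgo o 0 1 (by decide)) (hgo o 0 2 (by decide))
  · rw [hij, hjk, hik]
    exact (hg₃ o).circle (F := fun i => B o.face (o.corner i))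
  · rintro ⟨f, i⟩
    obtain ⟨⟨f', i'⟩, h⟩ : ∃ s, T.glue (f, i) = s := ⟨_, rfl⟩
    obtain ⟨A, h₁, h₂⟩ := hg f i f' i' h
    rw [h, (hm f).decM_eq (hB f) rfl, (hm f').decM_eq (hB f') rfl]
    change pairInv (B f (i + 1 + 0)) (B f (i + 1 + 1)) =
      pairInv (B f' (i' + 1 + 1)) (B f' (i' + 1 + 0))
    rw [add_zero, add_zero, fin3_add_one_add_one, fin3_add_one_add_one, ← h₁, ← h₂, pairInv_smul]

namespace Decoration

theorem ext_of_matches {D D' : T.Decoration} {B : T.Face → Fin 3 → Flag}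
    (h : ∀ f, Matches D.φ D.Φ D.δ f (B f)) (h' : ∀ f, Matches D'.φ D'.Φ D'.δ f (B f)) :
    D = D' := by
  have hφ : D.φ = D'.φ := by
    funext e
    obtain ⟨⟨f, i⟩, rfl⟩ := Quot.exists_rep e
    exact ((h f).φ_edge i).trans ((h' f).φ_edge i).symm
  have hΦ : D.Φ = D'.Φ := funext fun o => (h o.face o rfl).2.1.trans (h' o.face o rfl).2.1.symm
  have hδ : D.δ = D'.δ := funext fun o => (h o.face o rfl).2.2.trans (h' o.face o rfl).2.2.symm
  cases D
  cases D'
  cases hφ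
  cases hΦ
  cases hδ
  rfl

variable (D : T.Decoration)

theorem Φ_addLeft (f : T.Face) (i : Fin 3) :
    D.Φ ⟨f, Equiv.addLeft i⟩ = D.Φ ⟨f, Equiv.addLeft 0⟩ := by
  have h : ∀ i, D.Φ ⟨f, Equiv.addLeft i⟩ = D.Φ ⟨f, Equiv.addLeft (i + 1)⟩ := fun i => by
    rw [← addLeft_mul_finRotate]
    exact D.Φ_rotate _
  have h0 := h 0
  have h1 := h 1
  fin_cases i
  · rfl
  · exact h0.symm
  · exact (h0.trans h1).symm

/-- The relations of a decoration determine the remaining orderings: exchanging the last two corners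
conjugates Φ and replaces δ by φ/δ. -/
theorem matches_of_cyclic {f : T.Face} {F : Fin 3 → Flag} (hF : Generic₃ (F 0) (F 1) (F 2))
    (hφ : ∀ i, phi (F (i + 1)) (F (i + 2)) = D.φ (T.edge f i))
    (hΦ : Phi (F 0) (F 1) (F 2) = D.Φ ⟨f, Equiv.addLeft 0⟩)
    (hδ : ∀ i, delta (F i) (F (i + 1)) (F (i + 2)) = D.δ ⟨f, Equiv.addLeft i⟩) :
    Matches D.φ D.Φ D.δ f F := by
  have hΦ' : ∀ i, D.Φ ⟨f, Equiv.addLeft i⟩ = Phi (F (i + 0)) (F (i + 1)) (F (i + 2)) := by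
    intro i
    rw [Φ_addLeft, ← hΦ]
    fin_cases i
    · rfl
    · exact Phi_rotate _ _ _
    · exact (Phi_rotate _ _ _).symm
  have hδ' : ∀ i, D.δ ⟨f, Equiv.addLeft i⟩ = delta (F (i + 0)) (F (i + 1)) (F (i + 2)) := by
    intro i
    rw [add_zero, hδ]
  refine matches_of (fun i => (hφ i).symm) (fun π => ?_) fun π => ?_
  · rcases perm_cases π with ⟨i, rfl⟩ | ⟨i, rfl⟩
    · exact hΦ' i
    · change _ = Phi (F (i + 0)) (F (i + 2)) (F (i + 1))
      rw [Phi_swap, ← hΦ', D.Φ_swap ⟨f, Equiv.addLeft i⟩, starRingEnd_apply, star_star]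
      rfl
  · rcases perm_cases π with ⟨i, rfl⟩ | ⟨i, rfl⟩
    · exact hδ' i
    · have hne : ∀ {j k : Fin 3}, j ≠ k → Generic₂ (F (i + j)) (F (i + k)) := fun h =>
        hF.generic₂ ((add_right_injective i).ne h)
      have n₁ := hne (show (0 : Fin 3) ≠ 1 by decide)
      have n₂ := hne (show (0 : Fin 3) ≠ 2 by decide)
      have n₃ := hne (show (1 : Fin 3) ≠ 2 by decide)
      change _ = delta (F (i + 0)) (F (i + 2)) (F (i + 1))
      refine mul_left_cancel₀ (delta_ne_zero n₁ n₂ n₃) ?_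
      rw [delta_mul_delta n₁ n₂, ← hδ', hφ]
      refine (D.δ_mul_δ ⟨f, Equiv.addLeft i⟩).trans ?_
      change ((D.φ (T.edge f (i + 0)) : ℝ) : ℂ) = _
      rw [add_zero]

/-- The values of a decoration on a face are realized by a generic triple of flags. -/
theorem exists_matches (f : T.Face) :
    ∃ F : Fin 3 → Flag, Generic₃ (F 0) (F 1) (F 2) ∧ Matches D.φ D.Φ D.δ f F := by
  have hik : ∀ i, (⟨f, Equiv.addLeft i⟩ : T.OrderedFace).edgeik = T.edge f (i + 1) := fun i => rfl
  have hij : ∀ i, (⟨f, Equiv.addLeft i⟩ : T.OrderedFace).edgeij = T.edge f (i + 2) := fun i => rfl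
  have hjk : ∀ i, (⟨f, Equiv.addLeft i⟩ : T.OrderedFace).edgejk = T.edge f i := fun i =>
    congrArg (T.edge f) (add_zero i)
  have hswap : ∀ i, D.Φ (⟨f, Equiv.addLeft i⟩ : T.OrderedFace).ikj =
      star (D.Φ ⟨f, Equiv.addLeft 0⟩) := fun i => by
    rw [← D.Φ_addLeft f i, D.Φ_swap ⟨f, Equiv.addLeft i⟩, star_star]
  obtain ⟨F, h, hφ, hΦ, hδ⟩ := exists_triple (fun i => D.φ (T.edge f i))
    (D.Φ ⟨f, Equiv.addLeft 0⟩) (fun i => D.δ ⟨f, Equiv.addLeft i⟩) (fun i => D.φ_pos _)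
    (D.norm_Φ ⟨f, Equiv.addLeft 0⟩) (by
      have h := D.decDelta_neg ⟨f, Equiv.addLeft 0⟩
      rw [decDelta, hij, hjk, hik, hswap] at h
      simp only [Complex.add_re, Complex.sub_re, Complex.one_re, Complex.ofReal_re,
        Complex.star_def, Complex.conj_re, zero_add] at h
      linarith) (fun i h0 => by
      have h := D.δ_mul_δ ⟨f, Equiv.addLeft i⟩
      rw [h0, zero_mul] at h
      exact (D.φ_pos _).ne' (Complex.ofReal_eq_zero.1 h.symm)) (fun i => by
      have h := D.circle ⟨f, Equiv.addLeft i⟩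
      rwa [hij, hjk, hik, hswap] at h)
  exact ⟨F, h, D.matches_of_cyclic h hφ hΦ hδ⟩

/-- Triples of flags realizing a decoration fit together along glued sides. -/
theorem exists_smul_eq_of_glue {f f' : T.Face} {i i' : Fin 3} (h : T.glue (f, i) = (f', i'))
    {F F' : Fin 3 → Flag} (hF : Generic₃ (F 0) (F 1) (F 2)) (hF' : Generic₃ (F' 0) (F' 1) (F' 2))
    (hm : Matches D.φ D.Φ D.δ f F) (hm' : Matches D.φ D.Φ D.δ f' F') :
    ∃ A : PU21, A • F' (i' + 2) = F (i + 1) ∧ A • F' (i' + 1) = F (i + 2) := by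
  -- The two invariants of the pair agree: `phi` because the edge is shared, `pairInv` by the edge
  -- condition.
  refine (hF'.generic₂ (fin3_add_two_ne_add_one i')).exists_smul_eq
    (hF.generic₂ (fin3_add_one_ne_add_two i)) ?_ ?_
  · rw [phi_comm, ← hm.φ_edge, ← hm'.φ_edge]
    exact congrArg D.φ (show T.edge f i = T.edge f' i' from Quot.sound h).symm
  · have hc := D.compat (f, i)
    rw [h, hm.decM_eq hF rfl, hm'.decM_eq hF' rfl] at hc
    change pairInv (F (i + 1 + 0)) (F (i + 1 + 1)) =
      pairInv (F' (i' + 1 + 1)) (F' (i' + 1 + 0)) at hc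
    rw [add_zero, add_zero, fin3_add_one_add_one, fin3_add_one_add_one] at hc
    exact hc.symm

theorem exists_smul_eq_of_matches {f : T.Face} {F F' : Fin 3 → Flag}
    (hF : Generic₃ (F 0) (F 1) (F 2)) (hF' : Generic₃ (F' 0) (F' 1) (F' 2))
    (hm : Matches D.φ D.Φ D.δ f F) (hm' : Matches D.φ D.Φ D.δ f F') :
    ∃ A : PU21, ∀ i, A • F i = F' i := by
  refine hF.exists_smul_eq hF' ((hm.φ_edge 2).symm.trans (hm'.φ_edge 2))
    ((hm.φ_edge 0).symm.trans (hm'.φ_edge 0))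
    ((hm ⟨f, 1⟩ rfl).2.1.symm.trans (hm' ⟨f, 1⟩ rfl).2.1) fun i => ?_
  have h := (hm ⟨f, Equiv.addLeft i⟩ rfl).2.2.symm.trans (hm' ⟨f, Equiv.addLeft i⟩ rfl).2.2
  change delta (F (i + 0)) (F (i + 1)) (F (i + 2)) =
    delta (F' (i + 0)) (F' (i + 1)) (F' (i + 2)) at h
  rwa [add_zero] at h

end Decoration

end Complex₂

end PuncturedSurface

/-! ### Flagged representations and decorations -/

namespace PuncturedSurface

open ComplexHyperbolic Complex₂

section

variable {S : Type*} [TopologicalSpace S] {P : Set S} {Y : Type*} [TopologicalSpace Y]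
  {T : IdealTriangulation S P} {q : Y → (Pᶜ : Set S)}

namespace FlaggedRep

/-- The flags at the vertices of a lifted triangle. -/
def flags (a : FlaggedRep q) (τ : LiftedTriangle T q) (i : Fin 3) : Flag := a.F (τ.vertex i)

theorem isGeneric_iff {a : FlaggedRep q} : a.IsGeneric T ↔
    ∀ τ : LiftedTriangle T q, Generic₃ (a.flags τ 0) (a.flags τ 1) (a.flags τ 2) := by
  constructor
  · exact fun h τ => h τ τ.vertex τ.isVertex_vertex
  · intro h τ x hx
    obtain rfl : x = τ.vertex := funext fun i => LiftedTriangle.isVertex_iff.1 (hx i)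
    exact h τ

theorem hasInvariants_iff {a : FlaggedRep q} {D : T.Decoration} : a.HasInvariants T D ↔
    ∀ τ : LiftedTriangle T q, Matches D.φ D.Φ D.δ τ.face (a.flags τ) := by
  constructor
  · exact fun h τ => h τ τ.vertex τ.isVertex_vertex
  · intro h τ x hx
    obtain rfl : x = τ.vertex := funext fun i => LiftedTriangle.isVertex_iff.1 (hx i)
    exact h τ

theorem flags_translate (a : FlaggedRep q) (γ : deckGroup q) (τ : LiftedTriangle T q) (i : Fin 3) :
    a.flags (τ.translate γ) i = a.ρ γ • a.flags τ i := by
  rw [flags, LiftedTriangle.vertex_translate, a.equivariant]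
  rfl

theorem HasInvariants.smul {a : FlaggedRep q} {D : T.Decoration} (h : a.HasInvariants T D)
    (A : PU21) : (A • a).HasInvariants T D :=
  fun τ x hx => Matches.smul (F := fun i => a.F (x i)) (h τ x hx) A

theorem cls_eq_iff {a b : FlaggedRep q} : a.cls = b.cls ↔ ∃ A : PU21, A • b = a :=
  Quotient.eq''.trans (MulAction.orbitRel_apply.trans Iff.rfl)

/-- Lifts of the same face are deck translates of each other, so equivariance makes their triples
congruent and one lift per face suffices. Neighbouring lifts share two vertices, hence two flags. -/
theorem exists_hasInvariants (hq : IsUniversalCovering q) {a : FlaggedRep q}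
    (ha : a.IsGeneric T) : ∃ D : T.Decoration, a.HasInvariants T D := by
  choose τ hτ using LiftedTriangle.exists_face (T := T) hq
  have key : ∀ τ' : LiftedTriangle T q, ∃ A : PU21, ∀ i, A • a.flags (τ τ'.face) i = a.flags τ' i := by
    intro τ'
    obtain ⟨γ, hγ⟩ := LiftedTriangle.exists_translate_eq hq (hτ τ'.face)
    exact ⟨a.ρ γ, fun i => by rw [← flags_translate, hγ]⟩
  obtain ⟨D, hD⟩ := exists_decoration (fun f => a.flags (τ f))
    (fun f => isGeneric_iff.1 ha (τ f)) (by
      intro f i f' i' h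
      obtain ⟨τ', j, hadj⟩ := LiftedTriangle.exists_adjacent hq (τ f) i
      obtain ⟨rfl, rfl⟩ : τ'.face = f' ∧ j = i' := by
        have := hadj.1
        rw [hτ, h] at this
        simpa [eq_comm] using this
      obtain ⟨A, hA⟩ := key τ'
      refine ⟨A, (hA _).trans ?_, (hA _).trans ?_⟩
      · rw [flags, flags, hadj.vertex_eq]
      · rw [flags, flags, hadj.vertex_eq'])
  refine ⟨D, hasInvariants_iff.2 fun τ' => ?_⟩
  obtain ⟨A, hA⟩ := key τ'
  have := (hD τ'.face).smul A
  rwa [show (fun i => A • a.flags (τ τ'.face) i) = a.flags τ' from funext hA] at this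

theorem HasInvariants.unique (hq : IsUniversalCovering q) {a : FlaggedRep q}
    {D D' : T.Decoration} (h : a.HasInvariants T D) (h' : a.HasInvariants T D') : D = D' := by
  choose τ hτ using LiftedTriangle.exists_face (T := T) hq
  refine Decoration.ext_of_matches (B := fun f => a.flags (τ f)) (fun f => ?_) fun f => ?_
  · have := hasInvariants_iff.1 h (τ f)
    rwa [hτ] at this
  · have := hasInvariants_iff.1 h' (τ f)
    rwa [hτ] at this

/-- Generic pairs with the same invariants are congruent. -/
theorem HasInvariants.cls_eq (hq : IsUniversalCovering q) {a b : FlaggedRep q}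
    (ha : a.IsGeneric T) (hb : b.IsGeneric T) {D : T.Decoration} (h : a.HasInvariants T D)
    (h' : b.HasInvariants T D) : a.cls = b.cls := by
  rw [isGeneric_iff] at ha hb
  rw [hasInvariants_iff] at h h'
  choose A hA using fun τ => D.exists_smul_eq_of_matches (hb τ) (ha τ) (h' τ) (h τ)
  -- On adjacent triangles the two isometries agree on the generic pair of flags at the common side,
  -- which has trivial stabilizer.
  have hconst : ∀ τ τ', A τ = A τ' := by
    refine LiftedTriangle.eq_of_adjacent_invariant hq A fun τ i τ' i' hadj => ?_
    refine ((hb τ).generic₂ (F := b.flags τ) (fin3_add_one_ne_add_two i)).eq_of_smul ?_ ?_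
    · have e := hA τ' (i' + 2)
      rw [flags, flags, ← hadj.vertex_eq] at e
      exact (hA τ (i + 1)).trans e.symm
    · have e := hA τ' (i' + 1)
      rw [flags, flags, ← hadj.vertex_eq'] at e
      exact (hA τ (i + 2)).trans e.symm
  have hF : ∀ τ x, A τ • b.F x = a.F x := by
    intro τ x
    obtain ⟨τ', j, hx⟩ := LiftedTriangle.exists_isVertex hq T x
    rw [LiftedTriangle.isVertex_iff.1 hx, hconst τ τ']
    exact hA τ' j
  have := hq.simplyConnected
  obtain ⟨y⟩ : Nonempty Y := inferInstance
  obtain ⟨τ, -⟩ := LiftedTriangle.exists_eq_apply hq T y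
  refine cls_eq_iff.2 ⟨A τ, FlaggedRep.ext (MonoidHom.ext fun γ => ?_) (funext (hF τ))⟩
  -- The representations need no separate argument: equivariance prescribes the image of a generic
  -- pair, and this determines an element of PU(2,1).
  refine ((ha τ).generic₂ (F := a.flags τ) (fin3_add_one_ne_add_two 0)).eq_of_smul ?_ ?_
  all_goals
    refine Eq.trans ?_ (a.equivariant γ _)
    rw [← hF τ (γ • _), b.equivariant, flags, ← hF τ]
    change (A τ * b.ρ γ * (A τ)⁻¹) • A τ • _ = _
    rw [mul_smul, inv_smul_smul, mul_smul]

/-- Every decoration consists of the invariants of a generic pair. -/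
theorem exists_of_decoration (hq : IsUniversalCovering q) (D : T.Decoration) :
    ∃ a : FlaggedRep q, a.IsGeneric T ∧ a.HasInvariants T D := by
  choose B hB hBm using D.exists_matches
  have hgl := fun s : T.Face × Fin 3 => D.exists_smul_eq_of_glue
    (f := s.1) (i := s.2) (f' := (T.glue s).1) (i' := (T.glue s).2) rfl
    (hB _) (hB _) (hBm _) (hBm _)
  choose h h₁ h₂ using hgl
  -- The matching isometry of a side is unique, and the inverse of that of `s` matches the partner
  -- side.
  have hinv : ∀ s, h (T.glue s) = (h s)⁻¹ := by
    intro s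
    have e₁ := h₁ (T.glue s)
    have e₂ := h₂ (T.glue s)
    rw [T.glue_glue] at e₁ e₂
    refine ((hB s.1).generic₂ (fin3_add_two_ne_add_one s.2)).eq_of_smul ?_ ?_
    · rw [e₁, eq_inv_smul_iff, h₂]
    · rw [e₂, eq_inv_smul_iff, h₁]
  obtain ⟨g, hg⟩ := T.exists_development h hq hinv
  have adj₁ : ∀ {τ i τ' i'}, LiftedTriangle.Adjacent (T := T) (q := q) τ i τ' i' →
      g τ • B τ.face (i + 1) = g τ' • B τ'.face (i' + 2) := by
    intro τ i τ' i' hadj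
    have := h₁ (τ.face, i)
    rw [hadj.1] at this
    rw [hg τ i τ' i' hadj, mul_smul, this]
  have adj₂ : ∀ {τ i τ' i'}, LiftedTriangle.Adjacent (T := T) (q := q) τ i τ' i' →
      g τ • B τ.face (i + 2) = g τ' • B τ'.face (i' + 1) := by
    intro τ i τ' i' hadj
    have := h₂ (τ.face, i)
    rw [hadj.1] at this
    rw [hg τ i τ' i' hadj, mul_smul, this]
  choose σ j hσ using LiftedTriangle.exists_isVertex hq T
  let F : LiftedPuncture q → Flag := fun x => g (σ x) • B (σ x).face (j x)
  have hF : ∀ τ i, F (τ.vertex i) = g τ • B τ.face i := fun τ i =>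
    LiftedTriangle.IsVertex.eq_of_corner_invariant hq (fun τ i => g τ • B τ.face i)
      (fun τ i τ' i' hadj => adj₁ hadj) (hσ _) (τ.isVertex_vertex i)
  -- Passing to a neighbour multiplies both `g` factors on the right by the same side element, since
  -- a translate has the same face; the quotient is unchanged.
  have hρ : ∀ γ τ τ', g (LiftedTriangle.translate γ τ) * (g τ)⁻¹ =
      g (LiftedTriangle.translate γ τ') * (g τ')⁻¹ := by
    intro γ
    refine LiftedTriangle.eq_of_adjacent_invariant hq
      (fun τ => g (LiftedTriangle.translate γ τ) * (g τ)⁻¹) fun τ i τ' i' hadj => ?_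
    have e₁ := hg _ _ _ _ hadj
    have e₂ := hg _ _ _ _ (hadj.translate γ)
    change g (LiftedTriangle.translate γ τ') = g (LiftedTriangle.translate γ τ) * h (τ.face, i) at e₂
    simp only [e₁, e₂]
    group
  have := hq.simplyConnected
  obtain ⟨y⟩ : Nonempty Y := inferInstance
  obtain ⟨τ₀, -⟩ := LiftedTriangle.exists_eq_apply hq T y
  have htr : ∀ γ τ, g (LiftedTriangle.translate γ τ) =
      g (LiftedTriangle.translate γ τ₀) * (g τ₀)⁻¹ * g τ := by
    intro γ τ
    rw [← hρ γ τ τ₀, inv_mul_cancel_right]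
  let a : FlaggedRep q :=
    { ρ := MonoidHom.mk' (fun γ => g (LiftedTriangle.translate γ τ₀) * (g τ₀)⁻¹) (by
        intro γ γ'
        rw [show LiftedTriangle.translate (γ * γ') τ₀ =
          LiftedTriangle.translate γ (LiftedTriangle.translate γ' τ₀) from rfl, htr γ]
        group)
      F := F
      equivariant := by
        intro γ x
        obtain ⟨τ, i, hx⟩ := LiftedTriangle.exists_isVertex hq T x
        rw [LiftedTriangle.isVertex_iff.1 hx, ← LiftedTriangle.vertex_translate, hF, hF,
          htr γ τ, mul_smul]
        rfl }
  have hflags : ∀ τ, a.flags τ = fun i => g τ • B τ.face i := fun τ => funext (hF τ)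
  refine ⟨a, isGeneric_iff.2 fun τ => ?_, hasInvariants_iff.2 fun τ => ?_⟩
  · rw [hflags]
    exact (hB τ.face).smul (g τ)
  · rw [hflags]
    exact (hBm τ.face).smul (g τ)

end FlaggedRep

end

end PuncturedSurface

end

theorem theorem1 (g p : ℕ) (hp : 0 < p) (hgp : 2 < 2 * g + p)
    {S : Type*} [TopologicalSpace S] (hS : PuncturedSurface.IsClosedSurfaceOfGenus g S)
    {P : Set S} (hP : P.ncard = p)
    (T : PuncturedSurface.IdealTriangulation S P)
    {Y : Type*} [TopologicalSpace Y] (q : Y → (Pᶜ : Set S))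
    (hq : PuncturedSurface.IsUniversalCovering q) :
    ∃ e : PuncturedSurface.genericRepSpace T q ≃ T.Decoration,
      ∀ (a : PuncturedSurface.FlaggedRep q) (ha : a.IsGeneric T),
        a.HasInvariants T (e ⟨a.cls, a, ha, rfl⟩) := by
  have hex : ∀ c : PuncturedSurface.genericRepSpace T q, ∃ D : T.Decoration,
      ∃ a : PuncturedSurface.FlaggedRep q, a.IsGeneric T ∧ a.cls = c.1 ∧ a.HasInvariants T D := by
    rintro ⟨c, a, ha, hc⟩
    obtain ⟨D, hD⟩ := a.exists_hasInvariants hq ha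
    exact ⟨D, a, ha, hc, hD⟩
  choose e a ha hc hD using hex
  have he : ∀ (b : PuncturedSurface.FlaggedRep q) (hb : b.IsGeneric T),
      b.HasInvariants T (e ⟨b.cls, b, hb, rfl⟩) := by
    intro b hb
    -- The decoration was read off from a chosen representative; any other pair in the class is a
    -- PU(2,1)-translate of it and has the same invariants.
    obtain ⟨A, hA⟩ := PuncturedSurface.FlaggedRep.cls_eq_iff.1 (hc ⟨b.cls, b, hb, rfl⟩).symm
    have := (hD ⟨b.cls, b, hb, rfl⟩).smul A
    rwa [hA] at this
  refine ⟨Equiv.ofBijective e ⟨fun c c' h => Subtype.ext ?_, fun D => ?_⟩, he⟩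
  · rw [← hc c, ← hc c']
    exact (hD c).cls_eq hq (ha c) (ha c') (h ▸ hD c')
  · obtain ⟨b, hb, hbD⟩ := PuncturedSurface.FlaggedRep.exists_of_decoration hq D
    exact ⟨⟨b.cls, b, hb, rfl⟩, (he b hb).unique hq hbD⟩
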